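/- Let $p$ be a prime, $K_0$ a $p$-adic field (a complete discretely valued field of characteristic $0$ with perfect residue field of characteristic $p$), $\widehat{\overline{K_0}}$ the completion of an algebraic closure of $K_0$, and $\Delta$ a finite non-empty set. For $\alpha\in\Delta$ let $K_\alpha$ be a perfectoid field (complete, with non-discrete valuation of rank $1$ and with surjective Frobenius on $K_\alpha^\circ/p$) such that $K_0\subset K_\alpha\subset\widehat{\overline{K_0}}$. *The base rings.* Let $K_\Delta=\widehat{\bigotimes}_{\alpha\in\Delta}K_\alpha$ be the completed tensor product over $K_0$, that is, the completion of the algebraic tensor product for the seminorm $|x|_\Delta=\inf\max_i\prod_\alpha|x_{i,\alpha}|$, the infimum being over all expressions $x=\sum_i\bigotimes_\alpha x_{i,\alpha}$. Let $\mathcal O_{K,\Delta}\subset K_\Delta$ be the completed tensor product of the rings of integers of the $K_\alpha$, i.e. the closed subring of $K_\Delta$ that they generate. An embedding family is a family $s=(s_\alpha)_{\alpha\in\Delta}$ of continuous $K_0$-embeddings $s_\alpha:K_\alpha\to\widehat{\overline{K_0}}$; let $K_s$ be the completion of the compositum of the $s_\alpha(K_\alpha)$. Two families $s,s'$ are equivalent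 if there is a bicontinuous field isomorphism $u:K_s\to K_{s'}$ with $u\circ s_\alpha=s'_\alpha$ for all $\alpha$; let $\mathfrak S$ be the set of equivalence classes. For $s\in\mathfrak S$ put $|x|_s=|\beta_s(x)|$ on $K_\Delta$, where $\beta_s:K_\Delta\to K_s$ is the continuous homomorphism with $\bigotimes_\alpha x_\alpha\mapsto\prod_\alpha s_\alpha(x_\alpha)$. Let $\varpi_\alpha\in K_\alpha$ with $|p|\le|\varpi_\alpha|<1$, and let $I_\varpi\subset\mathcal O_{K,\Delta}$ be the ideal that they generate. For the second base ring, suppose that each $\varpi_\alpha$ is given with a compatible system of $p$-power roots $(\varpi_\alpha^{1/p^n})_{n\ge0}$ in $K_\alpha$. Let $\mathcal O_{K,\Delta}^\flat=\varprojlim_{x\mapsto x^p}\mathcal O_{K,\Delta}/I_\varpi$, let $\varpi_\alpha^\flat\in\mathcal O_{K,\Delta}^\flat$ be the element with components $\varpi_\alpha^{1/p^n}$, and let $K_\Delta^\flat$ be obtained from $\mathcal O_{K,\Delta}^\flat$ by inverting all the $\varpi_\alpha^\flat$. For $s\in\mathfrak S$ let $|\cdot|_s$ be the multiplicative seminorm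 on $K_\Delta^\flat$ with $|x|_s=|\lim_m\beta_s(\tilde x_m)^{p^m}|$ for $x=(x_m)_{m\ge 0}\in\mathcal O_{K,\Delta}^\flat$, where $\tilde x_m\in\mathcal O_{K,\Delta}$ lifts $x_m$. *Perfectoid algebras.* Let $(A,(\pi_\alpha)_\alpha)$ be $(K_\Delta,(\varpi_\alpha)_\alpha)$ or $(K_\Delta^\flat,(\varpi^\flat_\alpha)_\alpha)$. A Banach algebra over $A$ is a commutative $A$-algebra $R$ with maps $\|\cdot\|_s:R\to\mathbb R_{\ge0}$, $s\in\mathfrak S$, such that $\|x+y\|_s\le\max(\|x\|_s,\|y\|_s)$, $\|\lambda x\|_s=|\lambda|_s\|x\|_s$ for $\lambda\in A$, $\|xy\|_s\le\|x\|_s\|y\|_s$, $\|1\|_s\in\{0,1\}$, $\bigcap_s\ker\|\cdot\|_s=0$, and such that $\|x\|=\sup_s\|x\|_s$ is finite for all $x$ and $R$ is complete for $\|\cdot\|$. It is perfectoid if the ring $R^\circ$ of power-bounded elements is open and bounded and $x\mapsto x^p$ is surjective on $R^\circ/(\pi_\alpha:\alpha\in\Delta)$. The tilt of a perfectoid $R$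 is $R^\flat=\varprojlim_{x\mapsto x^p}R=\{(x^{(n)})_{n\ge0}:(x^{(n+1)})^p=x^{(n)}\}$ with componentwise multiplication and with $(x+y)^{(n)}=\lim_m(x^{(n+m)}+y^{(n+m)})^{p^m}$. A commutative ring $B$ is von Neumann regular if for every $x\in B$ there is $y\in B$ with $x^2y=x$. **Proposition.** Let $R$ be a perfectoid $K_\Delta$-algebra or a perfectoid $K_\Delta^\flat$-algebra. Then $R$ is von Neumann regular if and only if $R^\flat$ is von Neumann regular. Likewise, $R$ is a field if and only if $R^\flat$ is a field. -/

import Mathlib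

set_option linter.unusedSectionVars false
set_option linter.unusedVariables false
open Filter Topology

/-- A commutative ring is von Neumann regular if every `x` admits `y` with `x ^ 2 * y = x`. -/
def IsVonNeumannRegular (R : Type*) [CommRing R] : Prop :=
  ∀ x : R, ∃ y : R, x ^ 2 * y = x

section Spectral

/-- `f` is a power-multiplicative nonarchimedean norm which defines the topology of `R`, and
`p` is topologically nilpotent for it. -/
structure IsSpectralNorm (p : ℕ) {R : Type*} [NormedCommRing R] (f : R → ℝ) : Prop where
  nonneg : ∀ x, 0 ≤ f x
  map_zero : f 0 = 0
  map_neg : ∀ x, f (-x) = f x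
  add_le : ∀ x y, f (x + y) ≤ max (f x) (f y)
  mul_le : ∀ x y, f (x * y) ≤ f x * f y
  map_one_le : f 1 ≤ 1
  map_pow : ∀ x (n : ℕ), 1 ≤ n → f (x ^ n) = f x ^ n
  le_norm : ∀ x, f x ≤ ‖x‖
  norm_le : ∃ M : ℝ, ∀ x, ‖x‖ ≤ M * f x
  map_p_lt : f (p : R) < 1

/-- `R` is uniform, and `p` is topologically nilpotent in `R`. -/
def HasSpectralNorm (p : ℕ) (R : Type*) [NormedCommRing R] : Prop :=
  ∃ f : R → ℝ, IsSpectralNorm p f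

namespace IsSpectralNorm

variable {p : ℕ} [hp : Fact p.Prime] {R : Type*} [NormedCommRing R] {f : R → ℝ}

lemma sub_le (h : IsSpectralNorm p f) (x y : R) : f (x - y) ≤ max (f x) (f y) := by
  rw [sub_eq_add_neg, ← h.map_neg y]; exact h.add_le _ _

lemma sub_comm (h : IsSpectralNorm p f) (x y : R) : f (x - y) = f (y - x) := by
  rw [← h.map_neg, neg_sub]

lemma sum_le (h : IsSpectralNorm p f) {ι : Type*} (s : Finset ι) (g : ι → R) {B : ℝ}
    (hB : 0 ≤ B) (hg : ∀ i ∈ s, f (g i) ≤ B) : f (∑ i ∈ s, g i) ≤ B := by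
  classical
  induction s using Finset.induction_on with
  | empty => simpa [h.map_zero] using hB
  | insert a s ha ih =>
    rw [Finset.sum_insert ha]
    exact (h.add_le _ _).trans (max_le (hg _ (Finset.mem_insert_self _ _))
      (ih fun i hi => hg i (Finset.mem_insert_of_mem hi)))

lemma natCast_le (h : IsSpectralNorm p f) (n : ℕ) : f (n : R) ≤ 1 := by
  induction n with
  | zero => simp [h.map_zero]
  | succ n ih => push_cast; exact (h.add_le _ _).trans (max_le ih h.map_one_le)

lemma pow_le (h : IsSpectralNorm p f) (x : R) (n : ℕ) : f (x ^ n) ≤ f x ^ n := by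
  rcases Nat.eq_zero_or_pos n with rfl | hn
  · simpa using h.map_one_le
  · exact (h.map_pow x n hn).le

/-- `(u + v) ^ p` and `u ^ p + v ^ p` differ by a multiple of `p u v`. -/
lemma exists_add_pow (u v : R) : ∃ w : R, (u + v) ^ p = u ^ p + v ^ p + w ∧
    w = p * ∑ k ∈ Finset.Ioo 0 p, u ^ k * v ^ (p - k) * ((p.choose k / p : ℕ) : R) :=
  ⟨_, add_pow_prime_eq' hp.out u v, rfl⟩

lemma add_pow_error (h : IsSpectralNorm p f) {u v : R} {D e : ℝ} (he : 0 ≤ e) (he1 : e ≤ 1)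
    (hu : f u ≤ e * D) (hv : f v ≤ D) :
    f ((u + v) ^ p - u ^ p - v ^ p) ≤ f (p : R) * (e * D ^ p) := by
  obtain ⟨w, hw, hw'⟩ := exists_add_pow (p := p) u v
  have hD : 0 ≤ D := (h.nonneg _).trans hv
  have : (u + v) ^ p - u ^ p - v ^ p = w := by rw [hw]; ring
  rw [this, hw']
  refine (h.mul_le _ _).trans (mul_le_mul_of_nonneg_left ?_ (h.nonneg _))
  refine h.sum_le _ _ (by positivity) fun k hk => ?_
  obtain ⟨hk0, hkp⟩ := Finset.mem_Ioo.1 hk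
  calc f (u ^ k * v ^ (p - k) * ((p.choose k / p : ℕ) : R))
      ≤ f (u ^ k * v ^ (p - k)) * 1 :=
        (h.mul_le _ _).trans (mul_le_mul_of_nonneg_left (h.natCast_le _) (h.nonneg _))
    _ ≤ f (u ^ k) * f (v ^ (p - k)) := by rw [mul_one]; exact h.mul_le _ _
    _ ≤ (e * D) ^ k * D ^ (p - k) := by
        refine mul_le_mul ((h.pow_le _ _).trans (pow_le_pow_left₀ (h.nonneg _) hu _))
          ((h.pow_le _ _).trans (pow_le_pow_left₀ (h.nonneg _) hv _)) (h.nonneg _) (by positivity)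
    _ = e ^ k * D ^ p := by
        rw [mul_pow, mul_assoc, ← pow_add]; congr 2; omega
    _ ≤ e * D ^ p := by
        refine mul_le_mul_of_nonneg_right ?_ (by positivity)
        calc e ^ k ≤ e ^ 1 := pow_le_pow_of_le_one he he1 hk0
          _ = e := pow_one e

lemma pow_sub_pow_le (h : IsSpectralNorm p f) {u v : R} {D e c : ℝ} (he : 0 ≤ e) (hec : e ≤ c)
    (hc : c ≤ 1) (hpc : f (p : R) ≤ c) (huv : f (u - v) ≤ e * D) (hv : f v ≤ D) :
    f (u ^ p - v ^ p) ≤ e * c * D ^ p := by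
  have hD : 0 ≤ D := (h.nonneg _).trans hv
  have h1 := h.add_pow_error he (hec.trans hc) huv hv
  have e1 : u ^ p - v ^ p = ((u - v + v) ^ p - (u - v) ^ p - v ^ p) + (u - v) ^ p := by
    rw [sub_add_cancel]; ring
  rw [e1]
  refine (h.add_le _ _).trans (max_le (h1.trans ?_) ((h.pow_le _ _).trans ?_))
  · calc f (p : R) * (e * D ^ p) ≤ c * (e * D ^ p) := by gcongr
      _ = _ := by ring
  · calc f (u - v) ^ p ≤ (e * D) ^ p := pow_le_pow_left₀ (h.nonneg _) huv _
      _ = e ^ p * D ^ p := mul_pow _ _ _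
      _ ≤ e * c * D ^ p := by
        refine mul_le_mul_of_nonneg_right ?_ (by positivity)
        calc e ^ p ≤ e ^ 2 := pow_le_pow_of_le_one he (hec.trans hc) hp.out.two_le
          _ = e * e := sq e
          _ ≤ e * c := by gcongr

lemma pow_sub_pow_iter (h : IsSpectralNorm p f) {u v : R} {D e c : ℝ} (he : 0 ≤ e) (hec : e ≤ c)
    (hc : c ≤ 1) (hpc : f (p : R) ≤ c) (huv : f (u - v) ≤ e * D) (hv : f v ≤ D) (m : ℕ) :
    f (u ^ p ^ m - v ^ p ^ m) ≤ e * c ^ m * D ^ p ^ m := by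
  have hc0 : 0 ≤ c := he.trans hec
  induction m with
  | zero => simpa using huv
  | succ m ih =>
    rw [pow_succ p m, pow_mul, pow_mul, pow_mul]
    have h2 : e * c ^ m ≤ c := (mul_le_of_le_one_right he (pow_le_one₀ hc0 hc)).trans hec
    have := h.pow_sub_pow_le (by positivity) h2 hc hpc ih
      ((h.pow_le v _).trans (pow_le_pow_left₀ (h.nonneg _) hv _))
    calc _ ≤ _ := this
      _ = _ := by ring

end IsSpectralNorm

/-- The scale `C ^ (1 / p ^ m)`. -/
noncomputable def tiltScale (p : ℕ) (C : ℝ) (m : ℕ) : ℝ := C ^ (((p : ℝ) ^ m)⁻¹)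

section scale

variable {p : ℕ} [hp : Fact p.Prime] {C : ℝ}

lemma tiltScale_one_le (hC : 1 ≤ C) (m : ℕ) : 1 ≤ tiltScale p C m :=
  Real.one_le_rpow hC (by positivity)

lemma tiltScale_mono {C' : ℝ} (hC : 1 ≤ C) (h : C ≤ C') (m : ℕ) :
    tiltScale p C m ≤ tiltScale p C' m :=
  Real.rpow_le_rpow (by linarith) h (by positivity)

lemma tiltScale_mul {C' : ℝ} (hC : 1 ≤ C) (hC' : 1 ≤ C') (m : ℕ) :
    tiltScale p (C * C') m = tiltScale p C m * tiltScale p C' m :=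
  Real.mul_rpow (by linarith) (by linarith)

lemma tiltScale_pow (hC : 1 ≤ C) (n m : ℕ) :
    tiltScale p C (n + m) ^ p ^ m = tiltScale p C n := by
  have hp0 : (p : ℝ) ≠ 0 := by exact_mod_cast hp.out.ne_zero
  unfold tiltScale
  rw [← Real.rpow_natCast, ← Real.rpow_mul (by linarith)]
  congr 1
  push_cast
  rw [pow_add]
  field_simp

lemma tiltScale_pow_succ (hC : 1 ≤ C) (n : ℕ) :
    tiltScale p C (n + 1) ^ p = tiltScale p C n := by
  simpa using tiltScale_pow (p := p) hC n 1

lemma tiltScale_zero : tiltScale p C 0 = C := by simp [tiltScale]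

lemma le_tiltScale {x : ℝ} (hx : 0 ≤ x) (hC : 1 ≤ C) {m : ℕ} (h : x ^ p ^ m ≤ C) :
    x ≤ tiltScale p C m := by
  have h1 := tiltScale_pow (p := p) hC 0 m
  rw [zero_add, tiltScale_zero] at h1
  rw [← h1] at h
  exact le_of_pow_le_pow_left₀ (pow_ne_zero _ hp.out.ne_zero)
    (zero_le_one.trans (tiltScale_one_le hC m)) h

end scale

/-- The sequences `a` and `b` are of size `O(1) ^ (1 / p ^ m)` and agree modulo a topologically
nilpotent error. -/
def TiltClose (p : ℕ) {R : Type*} [NormedCommRing R] (f : R → ℝ) (a b : ℕ → R) : Prop :=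
  ∃ C c : ℝ, 1 ≤ C ∧ 0 ≤ c ∧ c < 1 ∧ ∀ m, f (a m) ≤ tiltScale p C m ∧ f (b m) ≤ tiltScale p C m ∧
    f (a m - b m) ≤ c * tiltScale p C m

/-- The sequence `a` is compatible under the `p`-th power map, up to a topologically
nilpotent error. -/
def TiltCoherent (p : ℕ) {R : Type*} [NormedCommRing R] (f : R → ℝ) (a : ℕ → R) : Prop :=
  TiltClose p f (fun m => a (m + 1) ^ p) a

namespace TiltClose

variable {p : ℕ} [hp : Fact p.Prime] {R : Type*} [NormedCommRing R] {f : R → ℝ}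
  {a b a' b' d : ℕ → R}

lemma symm (h : IsSpectralNorm p f) (hab : TiltClose p f a b) : TiltClose p f b a := by
  obtain ⟨C, c, hC, hc, hc1, H⟩ := hab
  exact ⟨C, c, hC, hc, hc1, fun m => ⟨(H m).2.1, (H m).1, by rw [h.sub_comm]; exact (H m).2.2⟩⟩

lemma refl_left (h : IsSpectralNorm p f) (hab : TiltClose p f a b) : TiltClose p f a a := by
  obtain ⟨C, c, hC, hc, hc1, H⟩ := hab
  exact ⟨C, 0, hC, le_rfl, one_pos, fun m => ⟨(H m).1, (H m).1, by simp [h.map_zero]⟩⟩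

lemma refl_right (h : IsSpectralNorm p f) (hab : TiltClose p f a b) : TiltClose p f b b :=
  (hab.symm h).refl_left h

/-- Two closeness relations with common constants. -/
lemma common (hab : TiltClose p f a b) (hab' : TiltClose p f a' b') :
    ∃ C c : ℝ, 1 ≤ C ∧ 0 ≤ c ∧ c < 1 ∧ ∀ m,
      (f (a m) ≤ tiltScale p C m ∧ f (b m) ≤ tiltScale p C m ∧
        f (a m - b m) ≤ c * tiltScale p C m) ∧
      (f (a' m) ≤ tiltScale p C m ∧ f (b' m) ≤ tiltScale p C m ∧
        f (a' m - b' m) ≤ c * tiltScale p C m) := by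
  obtain ⟨C, c, hC, hc, hc1, H⟩ := hab
  obtain ⟨C', c', hC', hc', hc1', H'⟩ := hab'
  refine ⟨max C C', max c c', le_max_of_le_left hC, le_max_of_le_left hc, max_lt hc1 hc1',
    fun m => ?_⟩
  have h1 : tiltScale p C m ≤ tiltScale p (max C C') m := tiltScale_mono hC (le_max_left _ _) m
  have h2 : tiltScale p C' m ≤ tiltScale p (max C C') m := tiltScale_mono hC' (le_max_right _ _) m
  have p1 : 0 ≤ tiltScale p C m := zero_le_one.trans (tiltScale_one_le hC m)
  have p2 : 0 ≤ tiltScale p C' m := zero_le_one.trans (tiltScale_one_le hC' m)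
  exact ⟨⟨(H m).1.trans h1, (H m).2.1.trans h1, (H m).2.2.trans
      (mul_le_mul (le_max_left _ _) h1 p1 (le_max_of_le_left hc))⟩,
    ⟨(H' m).1.trans h2, (H' m).2.1.trans h2, (H' m).2.2.trans
      (mul_le_mul (le_max_right _ _) h2 p2 (le_max_of_le_left hc))⟩⟩

lemma trans (h : IsSpectralNorm p f) (hab : TiltClose p f a b) (hbd : TiltClose p f b d) :
    TiltClose p f a d := by
  obtain ⟨C, c, hC, hc, hc1, H⟩ := hab.common hbd
  refine ⟨C, c, hC, hc, hc1, fun m => ⟨(H m).1.1, (H m).2.2.1, ?_⟩⟩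
  rw [← sub_add_sub_cancel (a m) (b m) (d m)]
  exact (h.add_le _ _).trans (max_le (H m).1.2.2 (H m).2.2.2)

lemma add (h : IsSpectralNorm p f) (hab : TiltClose p f a b) (hab' : TiltClose p f a' b') :
    TiltClose p f (fun m => a m + a' m) (fun m => b m + b' m) := by
  obtain ⟨C, c, hC, hc, hc1, H⟩ := hab.common hab'
  refine ⟨C, c, hC, hc, hc1, fun m => ⟨?_, ?_, ?_⟩⟩
  · exact (h.add_le _ _).trans (max_le (H m).1.1 (H m).2.1)
  · exact (h.add_le _ _).trans (max_le (H m).1.2.1 (H m).2.2.1)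
  · rw [add_sub_add_comm]
    exact (h.add_le _ _).trans (max_le (H m).1.2.2 (H m).2.2.2)

lemma neg (h : IsSpectralNorm p f) (hab : TiltClose p f a b) :
    TiltClose p f (fun m => -a m) (fun m => -b m) := by
  obtain ⟨C, c, hC, hc, hc1, H⟩ := hab
  refine ⟨C, c, hC, hc, hc1, fun m => ⟨?_, ?_, ?_⟩⟩
  · rw [h.map_neg]; exact (H m).1
  · rw [h.map_neg]; exact (H m).2.1
  · rw [← neg_sub', h.map_neg]; exact (H m).2.2

lemma mul (h : IsSpectralNorm p f) (hab : TiltClose p f a b) (hab' : TiltClose p f a' b') :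
    TiltClose p f (fun m => a m * a' m) (fun m => b m * b' m) := by
  obtain ⟨C, c, hC, hc, hc1, H⟩ := hab.common hab'
  refine ⟨C * C, c, by nlinarith, hc, hc1, fun m => ?_⟩
  have hp0 : 0 ≤ tiltScale p C m := zero_le_one.trans (tiltScale_one_le hC m)
  rw [tiltScale_mul hC hC]
  refine ⟨?_, ?_, ?_⟩
  · exact (h.mul_le _ _).trans (mul_le_mul (H m).1.1 (H m).2.1 (h.nonneg _) hp0)
  · exact (h.mul_le _ _).trans (mul_le_mul (H m).1.2.1 (H m).2.2.1 (h.nonneg _) hp0)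
  · have e : a m * a' m - b m * b' m = (a m - b m) * a' m + b m * (a' m - b' m) := by ring
    rw [e]
    refine (h.add_le _ _).trans (max_le ?_ ?_)
    · calc _ ≤ f (a m - b m) * f (a' m) := h.mul_le _ _
        _ ≤ (c * tiltScale p C m) * tiltScale p C m :=
          mul_le_mul (H m).1.2.2 (H m).2.1 (h.nonneg _) (by positivity)
        _ = _ := by ring
    · calc _ ≤ f (b m) * f (a' m - b' m) := h.mul_le _ _
        _ ≤ tiltScale p C m * (c * tiltScale p C m) :=
          mul_le_mul (H m).1.2.1 (H m).2.2.2 (h.nonneg _) hp0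
        _ = _ := by ring

/-- Closeness is preserved by the shifted `p`-th power. -/
lemma shift (h : IsSpectralNorm p f) (hab : TiltClose p f a b) :
    TiltClose p f (fun m => a (m + 1) ^ p) (fun m => b (m + 1) ^ p) := by
  obtain ⟨C, c, hC, hc, hc1, H⟩ := hab
  refine ⟨C, c, hC, hc, hc1, fun m => ?_⟩
  have hp0 : 0 ≤ tiltScale p C (m + 1) := zero_le_one.trans (tiltScale_one_le hC _)
  rw [← tiltScale_pow_succ hC m]
  refine ⟨(h.pow_le _ _).trans (pow_le_pow_left₀ (h.nonneg _) (H _).1 _),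
    (h.pow_le _ _).trans (pow_le_pow_left₀ (h.nonneg _) (H _).2.1 _), ?_⟩
  refine (h.pow_sub_pow_le hc (le_max_left c (f (p : R))) (max_le hc1.le h.map_p_lt.le)
    (le_max_right _ _) (H _).2.2 (H _).2.1).trans ?_
  refine mul_le_mul_of_nonneg_right ?_ (by positivity)
  exact mul_le_of_le_one_right hc (max_le hc1.le h.map_p_lt.le)

/-- The shifted `p`-th power is additive up to closeness. -/
lemma shift_add (h : IsSpectralNorm p f) (ha : TiltClose p f a a) (hb : TiltClose p f b b) :
    TiltClose p f (fun m => (a (m + 1) + b (m + 1)) ^ p)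
      (fun m => a (m + 1) ^ p + b (m + 1) ^ p) := by
  obtain ⟨C, c, hC, hc, hc1, H⟩ := ha.common hb
  refine ⟨C, f (p : R), hC, h.nonneg _, h.map_p_lt, fun m => ?_⟩
  rw [← tiltScale_pow_succ hC m]
  have ha' := (H (m + 1)).1.1
  have hb' := (H (m + 1)).2.1
  refine ⟨(h.pow_le _ _).trans (pow_le_pow_left₀ (h.nonneg _)
      ((h.add_le _ _).trans (max_le ha' hb')) _),
    (h.add_le _ _).trans (max_le ((h.pow_le _ _).trans (pow_le_pow_left₀ (h.nonneg _) ha' _))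
      ((h.pow_le _ _).trans (pow_le_pow_left₀ (h.nonneg _) hb' _))), ?_⟩
  have := h.add_pow_error zero_le_one le_rfl (by simpa using ha') hb'
  rw [sub_sub, one_mul] at this
  exact this

lemma const (h : IsSpectralNorm p f) (x : R) (hx : f x ≤ 1) :
    TiltClose p f (fun _ => x) (fun _ => x) :=
  ⟨1, 0, le_rfl, le_rfl, one_pos, fun m =>
    ⟨hx.trans (tiltScale_one_le le_rfl m), hx.trans (tiltScale_one_le le_rfl m),
      by simp [h.map_zero]⟩⟩

end TiltClose

namespace TiltCoherent

variable {p : ℕ} [hp : Fact p.Prime] {R : Type*} [NormedCommRing R] {f : R → ℝ}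
  {a b : ℕ → R}

lemma good (h : IsSpectralNorm p f) (ha : TiltCoherent p f a) : TiltClose p f a a :=
  TiltClose.refl_right h ha

lemma add (h : IsSpectralNorm p f) (ha : TiltCoherent p f a) (hb : TiltCoherent p f b) :
    TiltCoherent p f (fun m => a m + b m) :=
  (TiltClose.shift_add h (ha.good h) (hb.good h)).trans h (TiltClose.add h ha hb)

lemma neg (h : IsSpectralNorm p f) (ha : TiltCoherent p f a) :
    TiltCoherent p f (fun m => -a m) := by
  have h1 := TiltClose.shift_add h (ha.good h) ((ha.good h).neg h)
  have hz : ∀ m, (a (m + 1) + -a (m + 1)) ^ p = 0 := fun m => by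
    rw [add_neg_cancel, zero_pow hp.out.ne_zero]
  simp only [hz] at h1
  have h2 := TiltClose.add h (TiltClose.neg h ((ha.good h).shift h)) h1
  simp only [add_zero, neg_add_cancel_left] at h2
  exact (h2.symm h).trans h (TiltClose.neg h ha)

lemma mul (h : IsSpectralNorm p f) (ha : TiltCoherent p f a) (hb : TiltCoherent p f b) :
    TiltCoherent p f (fun m => a m * b m) := by
  have := TiltClose.mul h ha hb
  simpa only [TiltCoherent, mul_pow] using this

lemma of_perfection (h : IsSpectralNorm p f) (x : ℕ → R) (hx : ∀ n, x (n + 1) ^ p = x n) :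
    TiltCoherent p f x := by
  have key : TiltClose p f x x := by
    refine ⟨max 1 (f (x 0)), 0, le_max_left _ _, le_rfl, one_pos, fun m => ?_⟩
    have hm : x m ^ p ^ m = x 0 := by
      induction m with
      | zero => simp
      | succ m ih => rw [pow_succ' p m, pow_mul, hx, ih]
    have : f (x m) ≤ tiltScale p (max 1 (f (x 0))) m := by
      refine le_tiltScale (h.nonneg _) (le_max_left _ _) ?_
      rw [← h.map_pow _ _ (Nat.one_le_iff_ne_zero.2 (pow_ne_zero _ hp.out.ne_zero)), hm]
      exact le_max_right _ _
    exact ⟨this, this, by simp [h.map_zero]⟩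
  simpa only [TiltCoherent, hx] using key

lemma congr (h : IsSpectralNorm p f) (hab : TiltClose p f a b) (hb : TiltCoherent p f b) :
    TiltCoherent p f a :=
  ((hab.shift h).trans h hb).trans h (hab.symm h)

end TiltCoherent

/-- The sequence `n ↦ lim_m a (n + m) ^ (p ^ m)`. -/
noncomputable def tiltLim (p : ℕ) {R : Type*} [NormedCommRing R] (a : ℕ → R) (n : ℕ) : R :=
  limUnder atTop fun m => a (n + m) ^ p ^ m

section Limit

variable {p : ℕ} [hp : Fact p.Prime] {R : Type*} [NormedCommRing R] {f : R → ℝ}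
  {a b : ℕ → R}

lemma IsSpectralNorm.continuous (h : IsSpectralNorm p f) : Continuous f := by
  refine LipschitzWith.continuous (K := 1) (LipschitzWith.of_dist_le_mul fun x y => ?_)
  rw [NNReal.coe_one, one_mul, Real.dist_eq, dist_eq_norm, abs_sub_le_iff]
  have key : ∀ u v : R, f u - f v ≤ ‖u - v‖ := fun u v => by
    have h1 := h.add_le (u - v) v
    rw [sub_add_cancel] at h1
    have h2 := h.le_norm (u - v)
    have h3 := h.nonneg v
    have h4 := h.nonneg (u - v)
    have : max (f (u - v)) (f v) ≤ f (u - v) + f v := max_le (by linarith) (by linarith)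
    linarith
  exact ⟨key x y, by rw [norm_sub_rev]; exact key y x⟩

lemma tiltClose_pow_bound (h : IsSpectralNorm p f) (hab : TiltClose p f a b) :
    ∃ C e c : ℝ, 1 ≤ C ∧ 0 ≤ e ∧ e ≤ c ∧ 0 ≤ c ∧ c < 1 ∧ (∀ m, f (b m) ≤ tiltScale p C m) ∧
      ∀ n m, f (a (n + m) ^ p ^ m - b (n + m) ^ p ^ m) ≤ e * c ^ m * tiltScale p C n := by
  obtain ⟨C, e, hC, he, he1, H⟩ := hab
  refine ⟨C, e, max e (f (p : R)), hC, he, le_max_left _ _, le_max_of_le_left he,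
    max_lt he1 h.map_p_lt, fun m => (H m).2.1, fun n m => ?_⟩
  have := h.pow_sub_pow_iter he (le_max_left _ _) (max_le he1.le h.map_p_lt.le)
    (le_max_right e (f (p : R))) (H (n + m)).2.2 (H (n + m)).2.1 m
  rwa [tiltScale_pow hC] at this

lemma tiltLim_tendsto [CompleteSpace R] (h : IsSpectralNorm p f) (ha : TiltCoherent p f a)
    (n : ℕ) : Tendsto (fun m => a (n + m) ^ p ^ m) atTop (𝓝 (tiltLim p a n)) := by
  obtain ⟨C, e, c, hC, he, hec, hc, hc1, -, H⟩ := tiltClose_pow_bound h ha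
  obtain ⟨M, hM⟩ := h.norm_le
  refine (CauchySeq.tendsto_limUnder ?_)
  refine cauchySeq_of_le_geometric c (|M| * (e * tiltScale p C n)) hc1 fun m => ?_
  rw [dist_comm, dist_eq_norm]
  have h1 := H n m
  rw [← pow_mul, ← pow_succ', add_assoc] at h1
  calc _ ≤ M * _ := hM _
    _ ≤ |M| * _ := mul_le_mul_of_nonneg_right (le_abs_self _) (h.nonneg _)
    _ ≤ |M| * (e * c ^ m * tiltScale p C n) := mul_le_mul_of_nonneg_left h1 (abs_nonneg _)
    _ = _ := by ring

lemma tiltLim_pow [CompleteSpace R] (h : IsSpectralNorm p f) (ha : TiltCoherent p f a) (n : ℕ) :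
    tiltLim p a (n + 1) ^ p = tiltLim p a n := by
  have h1 := (tiltLim_tendsto h ha (n + 1)).pow p
  have h2 := (tiltLim_tendsto h ha n).comp (tendsto_add_atTop_nat 1)
  refine tendsto_nhds_unique h1 (h2.congr fun m => ?_)
  simp only [Function.comp_apply]
  rw [← pow_mul, ← pow_succ, add_right_comm, add_assoc]

lemma tiltLim_close [CompleteSpace R] (h : IsSpectralNorm p f) (ha : TiltCoherent p f a) :
    TiltClose p f (tiltLim p a) a := by
  obtain ⟨C, e, c, hC, he, hec, hc, hc1, Hb, H⟩ := tiltClose_pow_bound h ha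
  have step : ∀ n m, f (a (n + m) ^ p ^ m - a n) ≤ e * tiltScale p C n := by
    intro n m
    have hs : 0 ≤ tiltScale p C n := zero_le_one.trans (tiltScale_one_le hC n)
    induction m with
    | zero => simpa [h.map_zero] using mul_nonneg he hs
    | succ m ih =>
      have h1 := H n m
      rw [← pow_mul, ← pow_succ', add_assoc] at h1
      rw [← sub_add_sub_cancel _ (a (n + m) ^ p ^ m)]
      refine (h.add_le _ _).trans (max_le (h1.trans ?_) ih)
      exact mul_le_mul_of_nonneg_right (mul_le_of_le_one_right he (pow_le_one₀ hc hc1.le)) hs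
  have lim : ∀ n, f (tiltLim p a n - a n) ≤ e * tiltScale p C n := fun n =>
    le_of_tendsto ((h.continuous.tendsto _).comp ((tiltLim_tendsto h ha n).sub_const (a n)))
      (Eventually.of_forall fun m => step n m)
  refine ⟨C, e, hC, he, hec.trans_lt hc1, fun m => ⟨?_, Hb m, lim m⟩⟩
  have hs : 0 ≤ tiltScale p C m := zero_le_one.trans (tiltScale_one_le hC m)
  rw [← sub_add_cancel (tiltLim p a m) (a m)]
  exact (h.add_le _ _).trans (max_le ((lim m).trans
    (mul_le_of_le_one_left hs (hec.trans hc1.le))) (Hb m))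

lemma eq_of_tiltClose (h : IsSpectralNorm p f) {x y : ℕ → R} (hx : ∀ n, x (n + 1) ^ p = x n)
    (hy : ∀ n, y (n + 1) ^ p = y n) (hxy : TiltClose p f x y) : x = y := by
  obtain ⟨C, e, c, hC, he, hec, hc, hc1, -, H⟩ := tiltClose_pow_bound h hxy
  obtain ⟨M, hM⟩ := h.norm_le
  have iter : ∀ (z : ℕ → R), (∀ n, z (n + 1) ^ p = z n) → ∀ n m, z (n + m) ^ p ^ m = z n := by
    intro z hz n m
    induction m with
    | zero => simp
    | succ m ih => rw [pow_succ' p m, pow_mul, ← add_assoc, hz, ih]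
  funext n
  have h0 : f (x n - y n) ≤ 0 := by
    have hlim : Tendsto (fun m => e * c ^ m * tiltScale p C n) atTop (𝓝 0) := by
      simpa using ((tendsto_pow_atTop_nhds_zero_of_lt_one hc hc1).const_mul e).mul_const
        (tiltScale p C n)
    refine ge_of_tendsto hlim (Eventually.of_forall fun m => ?_)
    simpa only [iter x hx, iter y hy] using H n m
  have h1 : f (x n - y n) = 0 := le_antisymm h0 (h.nonneg _)
  have h2 := hM (x n - y n)
  rw [h1, mul_zero] at h2
  exact sub_eq_zero.1 (norm_le_zero_iff.1 h2)

end Limit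

/-- The tilt `lim_{x ↦ x ^ p} R` of a complete uniform ring `R`: the sequences `x` with
`x (n + 1) ^ p = x n`. Multiplication is componentwise and
`(x + y) n = lim_m (x (n + m) + y (n + m)) ^ (p ^ m)`. -/
def BanachTilt {p : ℕ} {R : Type*} [NormedCommRing R] (_h : HasSpectralNorm p R) : Type _ :=
  Perfection R p

namespace BanachTilt

variable {p : ℕ} [hp : Fact p.Prime] {R : Type*} [NormedCommRing R] [CompleteSpace R]
  {h : HasSpectralNorm p R}

/-- The element of the tilt attached to an approximately compatible sequence. -/
noncomputable def ofSeq (h : HasSpectralNorm p R) (a : ℕ → R)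
    (ha : ∃ f, IsSpectralNorm p f ∧ TiltCoherent p f a) : BanachTilt h :=
  ⟨tiltLim p a, fun n => tiltLim_pow ha.choose_spec.1 ha.choose_spec.2 n⟩

lemma coherent {f : R → ℝ} (hf : IsSpectralNorm p f) (x : BanachTilt h) : TiltCoherent p f x.1 :=
  TiltCoherent.of_perfection hf x.1 x.2

lemma close_ofSeq {f : R → ℝ} (hf : IsSpectralNorm p f) {a : ℕ → R} (ha : TiltCoherent p f a)
    (ha' : ∃ f, IsSpectralNorm p f ∧ TiltCoherent p f a) :
    TiltClose p f (ofSeq h a ha').1 a :=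
  tiltLim_close hf ha

lemma eq_of_close {f : R → ℝ} (hf : IsSpectralNorm p f) {x y : BanachTilt h}
    (hxy : TiltClose p f x.1 y.1) : x = y :=
  Subtype.ext (eq_of_tiltClose hf x.2 y.2 hxy)

noncomputable instance : Add (BanachTilt h) where
  add x y := ofSeq h (fun m => x.1 m + y.1 m)
    ⟨h.choose, h.choose_spec, (coherent h.choose_spec x).add h.choose_spec
      (coherent h.choose_spec y)⟩

noncomputable instance : Neg (BanachTilt h) where
  neg x := ofSeq h (fun m => -x.1 m)
    ⟨h.choose, h.choose_spec, (coherent h.choose_spec x).neg h.choose_spec⟩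

instance : Zero (BanachTilt h) where
  zero := ⟨fun _ => 0, fun _ => zero_pow hp.out.ne_zero⟩

instance : One (BanachTilt h) where
  one := ⟨fun _ => 1, fun _ => one_pow _⟩

instance : Mul (BanachTilt h) where
  mul x y := ⟨fun n => x.1 n * y.1 n, fun n => by rw [mul_pow, x.2 n, y.2 n]⟩

lemma add_close {f : R → ℝ} (hf : IsSpectralNorm p f) (x y : BanachTilt h) :
    TiltClose p f (x + y).1 (fun m => x.1 m + y.1 m) :=
  close_ofSeq hf ((coherent hf x).add hf (coherent hf y)) _

lemma neg_close {f : R → ℝ} (hf : IsSpectralNorm p f) (x : BanachTilt h) :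
    TiltClose p f (-x).1 (fun m => -x.1 m) :=
  close_ofSeq hf ((coherent hf x).neg hf) _

lemma self_close {f : R → ℝ} (hf : IsSpectralNorm p f) (x : BanachTilt h) : TiltClose p f x.1 x.1 :=
  (coherent hf x).good hf

noncomputable instance : CommRing (BanachTilt h) where
  add_assoc x y z := by
    obtain ⟨f, hf⟩ := id h
    refine eq_of_close hf (((add_close hf _ _).trans hf
      ((add_close hf x y).add hf (self_close hf z))).trans hf (TiltClose.symm hf
      ((add_close hf _ _).trans hf ?_)))
    simpa only [add_assoc] using (self_close hf x).add hf (add_close hf y z)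
  zero_add x := by
    obtain ⟨f, hf⟩ := id h
    refine eq_of_close hf ((add_close hf 0 x).trans hf ?_)
    have : (fun m => (0 : BanachTilt h).1 m + x.1 m) = x.1 := funext fun m => zero_add _
    rw [this]; exact self_close hf x
  add_zero x := by
    obtain ⟨f, hf⟩ := id h
    refine eq_of_close hf ((add_close hf x 0).trans hf ?_)
    have : (fun m => x.1 m + (0 : BanachTilt h).1 m) = x.1 := funext fun m => add_zero _
    rw [this]; exact self_close hf x
  add_comm x y := by
    obtain ⟨f, hf⟩ := id h
    refine eq_of_close hf ((add_close hf x y).trans hf (TiltClose.symm hf ?_))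
    simpa only [add_comm] using add_close hf y x
  left_distrib x y z := by
    obtain ⟨f, hf⟩ := id h
    refine eq_of_close hf (TiltClose.trans hf (b := fun m => x.1 m * (y.1 m + z.1 m))
      ((self_close hf x).mul hf (add_close hf y z)) (TiltClose.symm hf ?_))
    simp only [mul_add]
    exact add_close hf (x * y) (x * z)
  right_distrib x y z := by
    obtain ⟨f, hf⟩ := id h
    refine eq_of_close hf (TiltClose.trans hf (b := fun m => (x.1 m + y.1 m) * z.1 m)
      ((add_close hf x y).mul hf (self_close hf z)) (TiltClose.symm hf ?_))
    simp only [add_mul]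
    exact add_close hf (x * z) (y * z)
  zero_mul x := Subtype.ext (funext fun m => zero_mul _)
  mul_zero x := Subtype.ext (funext fun m => mul_zero _)
  mul_assoc x y z := Subtype.ext (funext fun m => mul_assoc _ _ _)
  one_mul x := Subtype.ext (funext fun m => one_mul _)
  mul_one x := Subtype.ext (funext fun m => mul_one _)
  mul_comm x y := Subtype.ext (funext fun m => mul_comm _ _)
  neg_add_cancel x := by
    obtain ⟨f, hf⟩ := id h
    refine eq_of_close hf ((add_close hf (-x) x).trans hf ?_)
    have h1 := (neg_close hf x).add hf (self_close hf x)
    simp only [neg_add_cancel] at h1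
    exact h1
  nsmul := nsmulRec
  zsmul := zsmulRec

/-- The multiplicative map `x ↦ x♯ = x⁽⁰⁾`. -/
def sharp (x : BanachTilt h) : R := x.1 0

end BanachTilt

end Spectral

section Banach

variable (R : Type*) [NormedCommRing R] [IsUltrametricDist R]

/-- The subring `R°` of power-bounded elements. -/
def powerBounded : Subring R where
  carrier := {x | Bornology.IsBounded (Set.range fun n : ℕ => x ^ n)}
  zero_mem' := by
    refine isBounded_iff_forall_norm_le.2 ⟨max ‖(1 : R)‖ 0, ?_⟩
    rintro _ ⟨n, rfl⟩
    rcases Nat.eq_zero_or_pos n with rfl | hn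
    · simp
    · simp [zero_pow hn.ne']
  one_mem' := by
    refine isBounded_iff_forall_norm_le.2 ⟨‖(1 : R)‖, ?_⟩
    rintro _ ⟨n, rfl⟩
    simp
  mul_mem' := by
    intro x y hx hy
    obtain ⟨A, hA⟩ := isBounded_iff_forall_norm_le.1 hx
    obtain ⟨B, hB⟩ := isBounded_iff_forall_norm_le.1 hy
    refine isBounded_iff_forall_norm_le.2 ⟨A * B, ?_⟩
    rintro _ ⟨n, rfl⟩
    have h1 := hA _ ⟨n, rfl⟩
    have h2 := hB _ ⟨n, rfl⟩
    simp only [mul_pow]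
    exact (norm_mul_le _ _).trans (mul_le_mul h1 h2 (norm_nonneg _) ((norm_nonneg _).trans h1))
  add_mem' := by
    intro x y hx hy
    obtain ⟨A, hA⟩ := isBounded_iff_forall_norm_le.1 hx
    obtain ⟨B, hB⟩ := isBounded_iff_forall_norm_le.1 hy
    have hA0 : 0 ≤ A := (norm_nonneg _).trans (hA _ ⟨0, rfl⟩)
    have hB0 : 0 ≤ B := (norm_nonneg _).trans (hB _ ⟨0, rfl⟩)
    refine isBounded_iff_forall_norm_le.2 ⟨A * B, ?_⟩
    rintro _ ⟨n, rfl⟩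
    have hn : ∀ (k : ℕ) (z : R), ‖k • z‖ ≤ ‖z‖ := fun k z => by
      induction k with
      | zero => simp
      | succ k ih =>
        rw [succ_nsmul]
        exact (IsUltrametricDist.norm_add_le_max _ _).trans (max_le ih le_rfl)
    simp only [add_pow]
    refine IsUltrametricDist.norm_sum_le_of_forall_le_of_nonneg (by positivity) fun k _ => ?_
    rw [mul_comm, ← nsmul_eq_mul]
    refine (hn _ _).trans ((norm_mul_le _ _).trans ?_)
    exact mul_le_mul (hA _ ⟨k, rfl⟩) (hB _ ⟨_, rfl⟩) (norm_nonneg _) hA0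
  neg_mem' := by
    intro x hx
    obtain ⟨A, hA⟩ := isBounded_iff_forall_norm_le.1 hx
    refine isBounded_iff_forall_norm_le.2 ⟨A, ?_⟩
    rintro _ ⟨n, rfl⟩
    have := hA _ ⟨n, rfl⟩
    simp only at this ⊢
    rw [neg_pow]
    rcases neg_one_pow_eq_or R n with h | h <;> rw [h] <;> simpa using this

end Banach

/-- A base ring `A` with a family of multiplicative seminorms `|·|_s`, and a set of generators of
a pseudo-uniformizing ideal. The last two fields record that `A` has a topologically nilpotent
unit whose size does not depend on `s`, and that `p` is topologically nilpotent. -/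
structure SeminormedBase (p : ℕ) (A : Type*) [CommRing A] where
  Idx : Type*
  v : Idx → MulRingSeminorm A
  gens : Set A
  exists_unit : ∃ π : A, IsUnit π ∧ ∃ c : ℝ, 0 < c ∧ c < 1 ∧ ∀ s, v s π = c
  p_small : ∃ c < (1 : ℝ), ∀ s, v s (p : A) ≤ c

section Family

variable {p : ℕ} {A : Type*} [CommRing A]

/-- The structure of a Banach algebra over the base on the `A`-algebra `R`: a family of norms
`‖·‖_s` whose supremum is the norm of `R`. Completeness of `R` is a separate hypothesis.
The value `‖1‖_s = 0` is allowed, so that a residue field of `A`, whose norms are all zero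
except one, is a Banach algebra over `A`. -/
structure NormFamily (B : SeminormedBase p A) (R : Type*) [NormedCommRing R] [Algebra A R] where
  norm : B.Idx → R → ℝ
  nonneg : ∀ s x, 0 ≤ norm s x
  add_le : ∀ s x y, norm s (x + y) ≤ max (norm s x) (norm s y)
  norm_smul : ∀ s (a : A) (x : R), norm s (a • x) = B.v s a * norm s x
  eq_zero : ∀ x, (∀ s, norm s x = 0) → x = 0
  mul_le : ∀ s x y, norm s (x * y) ≤ norm s x * norm s y
  norm_one : ∀ s, norm s 1 = 1 ∨ norm s 1 = 0
  isLUB : ∀ x, IsLUB (Set.range fun s => norm s x) ‖x‖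

variable {B : SeminormedBase p A} {R : Type*} [NormedCommRing R] [IsUltrametricDist R]
  [Algebra A R]

/-- The ideal of `R°` generated by the pseudo-uniformizing ideal of the base. -/
def NormFamily.pseudoIdeal (_N : NormFamily B R) : Ideal (powerBounded R) :=
  Ideal.span {z | ∃ a ∈ B.gens, (z : R) = algebraMap A R a}

/-- The (complete) Banach algebra `R` is perfectoid: `R°` is open and bounded, and Frobenius is
surjective on `R° / ϖ`. -/
structure NormFamily.IsPerfectoid (N : NormFamily B R) : Prop where
  isOpen : IsOpen (powerBounded R : Set R)
  isBounded : Bornology.IsBounded (powerBounded R : Set R)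
  frobenius_surjective :
    Function.Surjective fun z : powerBounded R ⧸ N.pseudoIdeal => z ^ p

namespace NormFamily

lemma norm_smul_eq (N : NormFamily B R) {a : A} {c : ℝ} (hc : 0 ≤ c) (ha : ∀ s, B.v s a = c) (x : R) :
    ‖a • x‖ = c * ‖x‖ := by
  refine (N.isLUB (a • x)).unique ?_
  have h := N.isLUB x
  have hne : (Set.range fun s => N.norm s x).Nonempty := h.nonempty
  constructor
  · rintro _ ⟨s, rfl⟩
    simp only [N.norm_smul, ha]
    exact mul_le_mul_of_nonneg_left (h.1 ⟨s, rfl⟩) hc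
  · intro b hb
    rcases hc.eq_or_lt with rfl | hc'
    · obtain ⟨_, s, rfl⟩ := hne
      have := hb ⟨s, rfl⟩
      simpa [N.norm_smul, ha] using this
    · rw [← le_div_iff₀' hc']
      refine h.2 ?_
      rintro _ ⟨s, rfl⟩
      rw [le_div_iff₀' hc']
      simpa [N.norm_smul, ha] using hb ⟨s, rfl⟩

lemma norm_one_le (N : NormFamily B R) : ‖(1 : R)‖ ≤ 1 := by
  refine (N.isLUB 1).2 ?_
  rintro _ ⟨s, rfl⟩
  rcases N.norm_one s with h | h <;> simp [h]

lemma norm_p_lt (N : NormFamily B R) : ‖(p : R)‖ < 1 := by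
  obtain ⟨c, hc, H⟩ := B.p_small
  refine lt_of_le_of_lt ((N.isLUB (p : R)).2 (?_ : max c 0 ∈ _)) (max_lt hc one_pos)
  rintro _ ⟨s, rfl⟩
  have e : (p : R) = (p : A) • (1 : R) := by rw [Algebra.smul_def]; simp
  simp only
  rw [e, N.norm_smul]
  rcases N.norm_one s with h | h
  · rw [h, mul_one]; exact (H s).trans (le_max_left _ _)
  · rw [h, mul_zero]; exact le_max_right _ _

lemma isNonarchimedean (N : NormFamily B R) : IsNonarchimedean (fun x : R => ‖x‖) := by
  intro x y
  refine (N.isLUB (x + y)).2 ?_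
  rintro _ ⟨s, rfl⟩
  exact (N.add_le s x y).trans (max_le_max ((N.isLUB x).1 ⟨s, rfl⟩) ((N.isLUB y).1 ⟨s, rfl⟩))

lemma isBounded_pow {y : R} {n : ℕ} (hn : 0 < n) (h1 : ‖(1 : R)‖ ≤ 1) (hy : ‖y ^ n‖ ≤ 1) :
    Bornology.IsBounded (Set.range fun m : ℕ => y ^ m) := by
  refine isBounded_iff_forall_norm_le.2 ⟨∑ r ∈ Finset.range n, ‖y ^ r‖, ?_⟩
  rintro _ ⟨m, rfl⟩
  simp only
  have hq : ∀ q : ℕ, ‖(y ^ n) ^ q‖ ≤ 1 := fun q => by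
    induction q with
    | zero => simpa using h1
    | succ q ih =>
      rw [pow_succ]
      exact (norm_mul_le _ _).trans (mul_le_one₀ ih (norm_nonneg _) hy)
  rw [← Nat.div_add_mod m n, pow_add, pow_mul]
  calc _ ≤ ‖(y ^ n) ^ (m / n)‖ * ‖y ^ (m % n)‖ := norm_mul_le _ _
    _ ≤ 1 * ‖y ^ (m % n)‖ := mul_le_mul_of_nonneg_right (hq _) (norm_nonneg _)
    _ = ‖y ^ (m % n)‖ := one_mul _
    _ ≤ _ := Finset.single_le_sum (f := fun r => ‖y ^ r‖) (fun i _ => norm_nonneg _)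
        (Finset.mem_range.2 (Nat.mod_lt _ hn))

lemma hasSpectralNorm (N : NormFamily B R) (hb : Bornology.IsBounded (powerBounded R : Set R)) :
    HasSpectralNorm p R := by
  have h1 : normRingSeminorm R 1 ≤ 1 := N.norm_one_le
  have hna : IsNonarchimedean (normRingSeminorm R) := N.isNonarchimedean
  let F := smoothingSeminorm (normRingSeminorm R) h1 hna
  have hF : ∀ x, F x = smoothingFun (normRingSeminorm R) x := fun _ => rfl
  refine ⟨F, fun x => apply_nonneg F x, map_zero F, fun x => map_neg_eq_map F x,
    isNonarchimedean_smoothingFun _ h1 hna, fun x y => map_mul_le_mul F x y,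
    smoothingFun_one_le _ h1, fun x n hn => isPowMul_smoothingFun _ h1 x hn,
    fun x => smoothingFun_le_self _ x, ?_,
    (smoothingFun_le_self _ _).trans_lt N.norm_p_lt⟩
  obtain ⟨π, hπ, c, hc0, hc1, hc⟩ := B.exists_unit
  obtain ⟨M, hM⟩ := isBounded_iff_forall_norm_le.1 hb
  let u : Rˣ := hπ.unit.map (algebraMap A R : A →* R)
  have hu : ∀ x : R, ‖(u : R) * x‖ = c * ‖x‖ := fun x => by
    have := N.norm_smul_eq hc0.le hc x
    rwa [Algebra.smul_def] at this
  have hu' : ∀ x : R, ‖((u⁻¹ : Rˣ) : R) * x‖ = c⁻¹ * ‖x‖ := fun x => by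
    have := hu (((u⁻¹ : Rˣ) : R) * x)
    rw [Units.mul_inv_cancel_left] at this
    rw [this, inv_mul_cancel_left₀ hc0.ne']
  have hz : ∀ (k : ℤ) (x : R), ‖((u ^ k : Rˣ) : R) * x‖ = c ^ k * ‖x‖ := fun k => by
    induction k using Int.induction_on with
    | zero => intro x; simp
    | succ i ih =>
      intro x
      rw [zpow_add_one, Units.val_mul, mul_assoc, ih, hu, zpow_add_one₀ hc0.ne', mul_assoc]
    | pred i ih =>
      intro x
      rw [zpow_sub_one, Units.val_mul, mul_assoc, ih, hu', zpow_sub_one₀ hc0.ne', mul_assoc]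
  have hM0 : 0 ≤ M := (norm_nonneg _).trans (hM 0 (powerBounded R).zero_mem)
  have key : ∀ (x : R) (k : ℤ), F x < c ^ k → ‖x‖ ≤ M * c ^ k := by
    intro x k hk
    rw [hF] at hk
    obtain ⟨n, hn⟩ := exists_lt_of_ciInf_lt hk
    have hck : 0 < c ^ k := zpow_pos hc0 k
    replace hn : ‖x ^ (n : ℕ)‖ ^ (1 / ((n : ℕ) : ℝ)) < c ^ k := hn
    have hxn : ‖x ^ (n : ℕ)‖ < (c ^ k) ^ (n : ℕ) := by
      have h2 := Real.rpow_lt_rpow (Real.rpow_nonneg (norm_nonneg _) _) hn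
        (show (0 : ℝ) < (n : ℕ) by exact_mod_cast n.pos)
      rw [← Real.rpow_mul (norm_nonneg _), Real.rpow_natCast] at h2
      rwa [one_div, inv_mul_cancel₀ (by exact_mod_cast n.ne_zero), Real.rpow_one] at h2
    let y : R := ((u ^ (-k) : Rˣ) : R) * x
    have hy : ‖y ^ (n : ℕ)‖ ≤ 1 := by
      have e : y ^ (n : ℕ) = ((u ^ (-k * (n : ℕ)) : Rˣ) : R) * x ^ (n : ℕ) := by
        simp only [y, mul_pow]
        rw [← Units.val_pow_eq_pow_val, ← zpow_natCast, ← zpow_mul]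
      rw [e, hz, zpow_mul, zpow_natCast, zpow_neg, inv_pow]
      exact (inv_mul_le_iff₀ (by positivity)).2 (by simpa using hxn.le)
    have hy' : ‖y‖ ≤ M := hM y (isBounded_pow n.pos N.norm_one_le hy)
    have : ‖y‖ = c ^ (-k) * ‖x‖ := hz _ _
    rw [this, zpow_neg, inv_mul_le_iff₀ hck] at hy'
    linarith
  refine ⟨M * c⁻¹, fun x => ?_⟩
  rcases (apply_nonneg F x).eq_or_lt with h0 | h0
  · have hk : ∀ k : ℕ, ‖x‖ ≤ M * c ^ k := fun k => by
      have := key x k (by rw [← h0]; exact zpow_pos hc0 _)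
      simpa using this
    have hl : Tendsto (fun k : ℕ => M * c ^ k) atTop (𝓝 0) := by
      simpa using (tendsto_pow_atTop_nhds_zero_of_lt_one hc0.le hc1).const_mul M
    rw [← h0, mul_zero]
    exact ge_of_tendsto hl (Eventually.of_forall hk)
  · obtain ⟨k, hk1, hk2⟩ := exists_mem_Ico_zpow h0 (one_lt_inv₀ hc0 |>.2 hc1)
    rw [inv_zpow'] at hk1 hk2
    have := key x _ hk2
    refine this.trans ?_
    rw [mul_assoc]
    refine mul_le_mul_of_nonneg_left ?_ hM0
    have e : c ^ (-(k + 1)) = c⁻¹ * c ^ (-k) := by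
      rw [neg_add, add_comm, zpow_add₀ hc0.ne', zpow_neg_one]
    rw [e]
    exact mul_le_mul_of_nonneg_left hk1 (by positivity)

/-- The tilt `R♭ = lim_{x ↦ x ^ p} R` of a perfectoid algebra `R`. -/
abbrev IsPerfectoid.tilt {N : NormFamily B R} (hR : N.IsPerfectoid) : Type _ :=
  BanachTilt (N.hasSpectralNorm hR.isBounded)

end NormFamily

end Family

section BaseField

universe u v

/-- `K₀` is a `p`-adic field: a complete discretely valued field of characteristic zero with
perfect residue field of characteristic `p`. -/
structure IsPadicField (p : ℕ) (K₀ : Type u) [NontriviallyNormedField K₀]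
    [IsUltrametricDist K₀] [CompleteSpace K₀] : Prop where
  charZero : CharZero K₀
  norm_p_lt : ‖(p : K₀)‖ < 1
  exists_uniformizer : ∃ π : K₀, ‖π‖ < 1 ∧ ∀ x : K₀, ‖x‖ < 1 → ‖x‖ ≤ ‖π‖
  perfect_residue : ∀ x : K₀, ‖x‖ ≤ 1 → ∃ y : K₀, ‖x - y ^ p‖ < 1

/-- `F` is a perfectoid field: complete, with non-discrete valuation of rank one, and with
surjective Frobenius on `F° / p`. -/
structure IsPerfectoidField (p : ℕ) (F : Type*) [NormedField F] : Prop where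
  complete : CompleteSpace F
  nondiscrete : ∀ r : ℝ, r < 1 → ∃ x : F, r < ‖x‖ ∧ ‖x‖ < 1
  frobenius_surjective : ∀ x : F, ‖x‖ ≤ 1 →
    ∃ y z : F, ‖y‖ ≤ 1 ∧ ‖z‖ ≤ 1 ∧ x - y ^ p = p * z

variable (K₀ : Type u) [NontriviallyNormedField K₀] [IsUltrametricDist K₀] [CompleteSpace K₀]

/-- An algebraic closure of `K₀`, with the unique extension of the absolute value. -/
def NormedAlgClosure : Type u := AlgebraicClosure K₀

noncomputable instance : NormedField (NormedAlgClosure K₀) :=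
  spectralNorm.normedField K₀ (AlgebraicClosure K₀)

noncomputable instance : NormedAlgebra K₀ (NormedAlgClosure K₀) :=
  spectralNorm.normedAlgebra K₀ (AlgebraicClosure K₀)

/-- The completion of the algebraic closure of `K₀`. -/
abbrev CompletedAlgClosure : Type u := UniformSpace.Completion (NormedAlgClosure K₀)

instance : IsUltrametricDist (CompletedAlgClosure K₀) := by
  refine IsUltrametricDist.isUltrametricDist_of_forall_norm_add_le_max_norm fun x y => ?_
  induction x, y using UniformSpace.Completion.induction_on₂ with
  | hp => exact isClosed_le (by fun_prop) (by fun_prop)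
  | ih x y =>
    rw [← UniformSpace.Completion.coe_add]
    simp only [UniformSpace.Completion.norm_coe]
    exact isNonarchimedean_spectralNorm (K := K₀) (L := AlgebraicClosure K₀) x y

lemma norm_natCast_completedAlgClosure (n : ℕ) : ‖(n : CompletedAlgClosure K₀)‖ = ‖(n : K₀)‖ := by
  rw [← map_natCast (algebraMap K₀ (CompletedAlgClosure K₀)), norm_algebraMap']

lemma completedAlgClosure_hasSpectralNorm {p : ℕ} (hp : ‖(p : K₀)‖ < 1) :
    IsSpectralNorm p (fun x : CompletedAlgClosure K₀ => ‖x‖) where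
  nonneg := norm_nonneg
  map_zero := norm_zero
  map_neg := norm_neg
  add_le := IsUltrametricDist.norm_add_le_max
  mul_le x y := (norm_mul x y).le
  map_one_le := norm_one.le
  map_pow x n _ := norm_pow x n
  le_norm _ := le_rfl
  norm_le := ⟨1, fun x => (one_mul _).ge⟩
  map_p_lt := by rwa [norm_natCast_completedAlgClosure]

variable {K₀} {Δ : Type v} [Fintype Δ] [Nonempty Δ]
variable (K : Δ → IntermediateField K₀ (CompletedAlgClosure K₀))

/-- The algebraic tensor product `K_1 ⊗ ⋯ ⊗ K_t` over `K₀`. -/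
def TensorRing : Type (max u v) := PiTensorProduct K₀ fun α => K α

noncomputable instance : CommRing (TensorRing K) :=
  inferInstanceAs (CommRing (PiTensorProduct K₀ fun α => K α))

noncomputable instance : Algebra K₀ (TensorRing K) :=
  inferInstanceAs (Algebra K₀ (PiTensorProduct K₀ fun α => K α))

/-- The elementary tensor `x_1 ⊗ ⋯ ⊗ x_t`. -/
noncomputable def elemTensor (x : ∀ α, K α) : TensorRing K := PiTensorProduct.tprod K₀ x

/-- The finite sums of elementary tensors `x_1 ⊗ ⋯ ⊗ x_t` with `|x_1| ⋯ |x_t| ≤ r`. -/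
noncomputable def tensorBall (r : ℝ) : AddSubmonoid (TensorRing K) :=
  AddSubmonoid.closure {t | ∃ x : ∀ α, K α, ∏ α, ‖x α‖ ≤ r ∧ elemTensor K x = t}

/-- `|x|_Δ`, the infimum of `max |x_1| ⋯ |x_t|` over the expressions
`x = ∑ x_1 ⊗ ⋯ ⊗ x_t`. -/
noncomputable def tensorNorm (x : TensorRing K) : ℝ :=
  sInf {r | 0 ≤ r ∧ x ∈ tensorBall K r}

variable {K}

lemma tensorBall_mono {r r' : ℝ} (h : r ≤ r') : tensorBall K r ≤ tensorBall K r' :=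
  AddSubmonoid.closure_mono fun _ ⟨x, hx, e⟩ => ⟨x, hx.trans h, e⟩

lemma elemTensor_mem (x : ∀ α, K α) : elemTensor K x ∈ tensorBall K (∏ α, ‖x α‖) :=
  AddSubmonoid.subset_closure ⟨x, le_rfl, rfl⟩

lemma elemTensor_mul (x y : ∀ α, K α) :
    elemTensor K x * elemTensor K y = elemTensor K (x * y) :=
  PiTensorProduct.tprod_mul_tprod x y

lemma smul_elemTensor (c : K₀) (x : ∀ α, K α) :
    ∃ y : ∀ α, K α, c • elemTensor K x = elemTensor K y ∧
      ∏ α, ‖y α‖ = ‖c‖ * ∏ α, ‖x α‖ := by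
  classical
  obtain ⟨i⟩ := ‹Nonempty Δ›
  refine ⟨Function.update x i (c • x i), ?_, ?_⟩
  · have := (PiTensorProduct.tprod K₀ (s := fun α => K α)).map_update_smul x i c (x i)
    rw [Function.update_eq_self] at this
    exact this.symm
  · rw [← Finset.mul_prod_erase _ _ (Finset.mem_univ i),
      ← Finset.mul_prod_erase _ (fun α => ‖x α‖) (Finset.mem_univ i), Function.update_self,
      norm_smul, mul_assoc]
    congr 2
    refine Finset.prod_congr rfl fun j hj => ?_
    rw [Function.update_of_ne (Finset.ne_of_mem_erase hj)]

lemma exists_mem_tensorBall (x : TensorRing K) : ∃ r, 0 ≤ r ∧ x ∈ tensorBall K r := by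
  refine PiTensorProduct.induction_on (motive := fun x => ∃ r, 0 ≤ r ∧ x ∈ tensorBall K r)
    x ?_ ?_
  · intro c x
    obtain ⟨y, hy, -⟩ := smul_elemTensor (K := K) c x
    exact ⟨_, Finset.prod_nonneg fun _ _ => norm_nonneg _, hy ▸ elemTensor_mem y⟩
  · rintro x y ⟨r, hr, hx⟩ ⟨r', hr', hy⟩
    exact ⟨max r r', le_max_of_le_left hr, add_mem (tensorBall_mono (le_max_left _ _) hx)
      (tensorBall_mono (le_max_right _ _) hy)⟩

lemma tensorBall_neg {r : ℝ} {x : TensorRing K} (hx : x ∈ tensorBall K r) :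
    -x ∈ tensorBall K r := by
  induction hx using AddSubmonoid.closure_induction with
  | mem t ht =>
    obtain ⟨y, hy, rfl⟩ := ht
    obtain ⟨z, hz, hz'⟩ := smul_elemTensor (K := K) (-1) y
    rw [neg_one_smul] at hz
    refine AddSubmonoid.subset_closure ⟨z, ?_, hz.symm⟩
    rw [hz', norm_neg, norm_one, one_mul]; exact hy
  | zero => rw [neg_zero]; exact zero_mem _
  | add a b _ _ ha hb => rw [neg_add]; exact add_mem ha hb

lemma tensorBall_mul {r r' : ℝ} (hr : 0 ≤ r) {x y : TensorRing K}
    (hx : x ∈ tensorBall K r) (hy : y ∈ tensorBall K r') : x * y ∈ tensorBall K (r * r') := by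
  induction hx using AddSubmonoid.closure_induction with
  | mem t ht =>
    obtain ⟨a, ha, rfl⟩ := ht
    induction hy using AddSubmonoid.closure_induction with
    | mem t ht =>
      obtain ⟨b, hb, rfl⟩ := ht
      refine AddSubmonoid.subset_closure ⟨a * b, ?_, (elemTensor_mul a b).symm⟩
      simp only [Pi.mul_apply, norm_mul, Finset.prod_mul_distrib]
      exact mul_le_mul ha hb (Finset.prod_nonneg fun _ _ => norm_nonneg _) hr
    | zero => rw [mul_zero]; exact zero_mem _
    | add a b _ _ ha hb => rw [mul_add]; exact add_mem ha hb
  | zero => rw [zero_mul]; exact zero_mem _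
  | add a b _ _ ha hb => rw [add_mul]; exact add_mem ha hb

lemma tensorNorm_le {r : ℝ} (hr : 0 ≤ r) {x : TensorRing K} (hx : x ∈ tensorBall K r) :
    tensorNorm K x ≤ r :=
  csInf_le ⟨0, fun _ h => h.1⟩ ⟨hr, hx⟩

lemma tensorNorm_nonneg (x : TensorRing K) : 0 ≤ tensorNorm K x :=
  Real.sInf_nonneg fun _ h => h.1

lemma mem_tensorBall_of_lt {r : ℝ} {x : TensorRing K} (hx : tensorNorm K x < r) :
    x ∈ tensorBall K r := by
  obtain ⟨r', ⟨-, h⟩, hr'⟩ := exists_lt_of_csInf_lt (exists_mem_tensorBall x) hx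
  exact tensorBall_mono hr'.le h

variable (K)

/-- `|·|_Δ` as a seminorm on the tensor product. -/
noncomputable def tensorSeminorm : RingSeminorm (TensorRing K) where
  toFun := tensorNorm K
  map_zero' := le_antisymm (tensorNorm_le le_rfl (zero_mem _)) (tensorNorm_nonneg _)
  add_le' x y := by
    refine le_of_forall_pos_le_add fun ε hε => ?_
    have hx := mem_tensorBall_of_lt (lt_add_of_pos_right (tensorNorm K x) (half_pos hε))
    have hy := mem_tensorBall_of_lt (lt_add_of_pos_right (tensorNorm K y) (half_pos hε))
    have hx0 := tensorNorm_nonneg x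
    have hy0 := tensorNorm_nonneg y
    exact tensorNorm_le (by linarith) (add_mem (tensorBall_mono (by linarith) hx)
      (tensorBall_mono (by linarith) hy))
  neg' x := by
    have key : ∀ x : TensorRing K, tensorNorm K (-x) ≤ tensorNorm K x := fun x => by
      refine le_of_forall_pos_le_add fun ε hε => ?_
      have hx0 := tensorNorm_nonneg x
      exact tensorNorm_le (by linarith)
        (tensorBall_neg (mem_tensorBall_of_lt (lt_add_of_pos_right _ hε)))
    exact le_antisymm (key x) (by simpa using key (-x))
  mul_le' x y := by
    have hx0 := tensorNorm_nonneg x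
    have hy0 := tensorNorm_nonneg y
    have hl : Tendsto (fun ε : ℝ => (tensorNorm K x + ε) * (tensorNorm K y + ε)) (𝓝[>] 0)
        (𝓝 (tensorNorm K x * tensorNorm K y)) := by
      have : Continuous fun ε : ℝ => (tensorNorm K x + ε) * (tensorNorm K y + ε) := by fun_prop
      simpa using (this.tendsto 0).mono_left nhdsWithin_le_nhds
    refine ge_of_tendsto hl ?_
    filter_upwards [self_mem_nhdsWithin] with ε hε
    rw [Set.mem_Ioi] at hε
    exact tensorNorm_le (by positivity) (tensorBall_mul (by linarith)
      (mem_tensorBall_of_lt (lt_add_of_pos_right _ hε))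
      (mem_tensorBall_of_lt (lt_add_of_pos_right _ hε)))

noncomputable instance : SeminormedCommRing (TensorRing K) where
  __ := (tensorSeminorm K).toSeminormedRing
  mul_comm := mul_comm

/-- The ring `K_Δ`, the completed tensor product of the `K_α` over `K₀`. -/
abbrev KDelta : Type (max u v) := UniformSpace.Completion (TensorRing K)

/-- The map `K_α → K_Δ`, `x ↦ 1 ⊗ ⋯ ⊗ x ⊗ ⋯ ⊗ 1`. -/
noncomputable def iota (α : Δ) : K α →+* KDelta K := by
  classical
  exact (UniformSpace.Completion.coeRingHom (α := TensorRing K)).comp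
    (PiTensorProduct.singleAlgHom (R := K₀) (A := fun α => K α) α).toRingHom

/-- An embedding family: a continuous embedding over `K₀` of each `K_α`. -/
abbrev EmbeddingFamily : Type (max u v) := ∀ α, K α →A[K₀] CompletedAlgClosure K₀

variable {K}

lemma norm_embedding (s : EmbeddingFamily K) (α : Δ) (x : K α) : ‖s α x‖ = ‖x‖ := by
  have key : ∀ x : K α, ‖s α x‖ ≤ ‖x‖ := by
    intro x
    let L : K α →L[K₀] CompletedAlgClosure K₀ := (s α).toContinuousLinearMap
    have hL : ∀ y, ‖s α y‖ ≤ (‖L‖ + 1) * ‖y‖ := fun y =>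
      (L.le_opNorm y).trans (by nlinarith [norm_nonneg y])
    have hpos : 0 < ‖L‖ + 1 := by positivity
    by_contra! hlt
    rcases (norm_nonneg x).eq_or_lt with h0 | h0
    · have := hL x
      rw [← h0, mul_zero] at this
      exact absurd (hlt.trans_le this) (by rw [← h0]; exact lt_irrefl _)
    · have h1 : 1 < ‖s α x‖ / ‖x‖ := (one_lt_div h0).2 hlt
      obtain ⟨n, hn⟩ := pow_unbounded_of_one_lt (‖L‖ + 1) h1
      rw [div_pow, lt_div_iff₀ (by positivity)] at hn
      have := hL (x ^ n)
      rw [map_pow, norm_pow, norm_pow] at this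
      exact absurd this (not_le.2 hn)
  refine le_antisymm (key x) ?_
  rcases eq_or_ne x 0 with rfl | hx
  · simp
  · have h := key x⁻¹
    rw [map_inv₀, norm_inv, norm_inv] at h
    exact (inv_le_inv₀ (norm_pos_iff.2 (by simpa using hx)) (norm_pos_iff.2 hx)).1 h

/-- The map `x_1 ⊗ ⋯ ⊗ x_t ↦ s_1(x_1) ⋯ s_t(x_t)` on the algebraic tensor product. -/
noncomputable def betaAlg (s : EmbeddingFamily K) : TensorRing K →ₐ[K₀] CompletedAlgClosure K₀ :=
  PiTensorProduct.liftAlgHom (R := K₀) (A := fun α => K α)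
    ((MultilinearMap.mkPiAlgebra K₀ Δ (CompletedAlgClosure K₀)).compLinearMap
      fun α => (s α : K α →ₐ[K₀] CompletedAlgClosure K₀).toLinearMap)
    (by simp) (fun x y => by simp [Finset.prod_mul_distrib])

lemma betaAlg_elemTensor (s : EmbeddingFamily K) (x : ∀ α, K α) :
    betaAlg s (elemTensor K x) = ∏ α, s α (x α) := by
  refine (PiTensorProduct.lift.tprod x).trans ?_
  simp

lemma norm_betaAlg_le (s : EmbeddingFamily K) (x : TensorRing K) : ‖betaAlg s x‖ ≤ ‖x‖ := by
  refine le_csInf (exists_mem_tensorBall x) ?_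
  rintro r ⟨hr, hx⟩
  induction hx using AddSubmonoid.closure_induction with
  | mem t ht =>
    obtain ⟨y, hy, rfl⟩ := ht
    rw [betaAlg_elemTensor, norm_prod]
    simpa only [norm_embedding] using hy
  | zero => simpa using hr
  | add a b _ _ ha hb =>
    rw [map_add]
    exact (IsUltrametricDist.norm_add_le_max _ _).trans (max_le ha hb)

lemma continuous_betaAlg (s : EmbeddingFamily K) :
    Continuous (betaAlg s : TensorRing K →+* CompletedAlgClosure K₀) :=
  AddMonoidHomClass.continuous_of_bound (betaAlg s : TensorRing K →+* CompletedAlgClosure K₀) 1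
    fun x => by rw [one_mul]; exact norm_betaAlg_le s x

/-- The homomorphism `β_s` on `K_Δ`, with values in the completed algebraic closure. -/
noncomputable def beta (s : EmbeddingFamily K) : KDelta K →+* CompletedAlgClosure K₀ :=
  UniformSpace.Completion.extensionHom (betaAlg s : TensorRing K →+* CompletedAlgClosure K₀)
    (continuous_betaAlg s)

lemma continuous_beta (s : EmbeddingFamily K) : Continuous (beta s) :=
  UniformSpace.Completion.continuous_extension

lemma beta_iota (s : EmbeddingFamily K) (α : Δ) (x : K α) : beta s (iota K α x) = s α x := by
  classical
  have h1 : beta s (iota K α x) = betaAlg s (elemTensor K (MonoidHom.mulSingle _ α x)) := by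
    refine (UniformSpace.Completion.extensionHom_coe _ (continuous_betaAlg s) _).trans ?_
    simp only [RingHom.coe_coe]
    congr 1
  rw [h1, betaAlg_elemTensor, Finset.prod_eq_single α]
  · simp
  · intro b _ hb
    simp [hb]
  · simp

/-- The field `K_s`, the completion of the compositum of the `s_α(K_α)`. -/
noncomputable def residueField (s : EmbeddingFamily K) : Subfield (CompletedAlgClosure K₀) :=
  (⨆ α, (s α : K α →+* CompletedAlgClosure K₀).fieldRange).topologicalClosure

lemma mem_residueField (s : EmbeddingFamily K) (α : Δ) (x : K α) : s α x ∈ residueField s :=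
  Subfield.le_topologicalClosure _
    ((le_iSup (fun α => (s α : K α →+* CompletedAlgClosure K₀).fieldRange) α) ⟨x, rfl⟩)

variable (K)

/-- Two embedding families are equivalent if they differ by a continuous isomorphism
`u : K_s ≃ K_{s'}`. -/
def embeddingSetoid : Setoid (EmbeddingFamily K) where
  r s s' := ∃ u : residueField s ≃+* residueField s', Continuous u ∧ Continuous u.symm ∧
    ∀ α (x : K α), (u ⟨s α x, mem_residueField s α x⟩ : CompletedAlgClosure K₀) = s' α x
  iseqv :=
    { refl := fun s => ⟨RingEquiv.refl _, continuous_id, continuous_id, fun _ _ => rfl⟩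
      symm := by
        rintro s s' ⟨u, h1, h2, h3⟩
        refine ⟨u.symm, h2, h1, fun α x => ?_⟩
        have : u ⟨s α x, mem_residueField s α x⟩ = ⟨s' α x, mem_residueField s' α x⟩ :=
          Subtype.ext (h3 α x)
        rw [← this, RingEquiv.symm_apply_apply]
      trans := by
        rintro s s' s'' ⟨u, h1, h2, h3⟩ ⟨u', h1', h2', h3'⟩
        refine ⟨u.trans u', h1'.comp h1, h2.comp h2', fun α x => ?_⟩
        have : u ⟨s α x, mem_residueField s α x⟩ = ⟨s' α x, mem_residueField s' α x⟩ :=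
          Subtype.ext (h3 α x)
        rw [RingEquiv.trans_apply, this, h3'] }

/-- The set `𝔖` of equivalence classes of embedding families. -/
def EmbeddingClass : Type (max u v) := Quotient (embeddingSetoid K)

variable {K}

/-- A representative of a class; `|β_s(·)|` does not depend on it. -/
noncomputable def EmbeddingClass.rep (s : EmbeddingClass K) : EmbeddingFamily K :=
  Quotient.out (s := embeddingSetoid K) s

/-- The multiplicative seminorm `x ↦ |φ(x)|` defined by a homomorphism to a normed field. -/
def normComap {A F : Type*} [CommRing A] [NormedField F] (φ : A →+* F) : MulRingSeminorm A where
  toFun x := ‖φ x‖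
  map_zero' := by simp
  add_le' x y := by rw [map_add]; exact norm_add_le _ _
  neg' x := by rw [map_neg, norm_neg]
  map_one' := by simp
  map_mul' x y := by rw [map_mul, norm_mul]

/-- The ring `K_Δ` with the seminorms `|x|_s = |β_s(x)|`, `s ∈ 𝔖`, and the pseudo-uniformizing
ideal generated by the `ϖ_α ∈ K_α`. -/
noncomputable def mixedBase {p : ℕ} (hK₀ : IsPadicField p K₀)
    (K : Δ → IntermediateField K₀ (CompletedAlgClosure K₀)) (ϖ : ∀ α, K α) :
    SeminormedBase p (KDelta K) where
  Idx := EmbeddingClass K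
  v s := normComap (beta s.rep)
  gens := Set.range fun α => iota K α (ϖ α)
  exists_unit := by
    obtain ⟨α⟩ := ‹Nonempty Δ›
    obtain ⟨x, hx0, hx1⟩ := NormedField.exists_norm_lt_one K₀
    have hx : x ≠ 0 := norm_pos_iff.1 hx0
    refine ⟨iota K α (algebraMap K₀ (K α) x), ?_, ‖x‖, hx0, hx1, fun s => ?_⟩
    · exact ((isUnit_iff_ne_zero.2 hx).map (algebraMap K₀ (K α))).map (iota K α)
    · change ‖beta s.rep _‖ = ‖x‖
      rw [beta_iota, norm_embedding, norm_algebraMap']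
  p_small := by
    refine ⟨‖(p : K₀)‖, hK₀.norm_p_lt, fun s => ?_⟩
    change ‖beta s.rep _‖ ≤ _
    rw [map_natCast, norm_natCast_completedAlgClosure]

/-- A family of pseudo-uniformizers `ϖ_α ∈ K_α` with `|p| ≤ |ϖ_α| < 1`. -/
def IsPseudoUniformizing (p : ℕ) (K : Δ → IntermediateField K₀ (CompletedAlgClosure K₀))
    (ϖ : ∀ α, K α) : Prop :=
  ∀ α, ‖(p : K₀)‖ ≤ ‖ϖ α‖ ∧ ‖ϖ α‖ < 1

variable (K) in
/-- The ring `O_{K,Δ}`, the completed tensor product of the rings of integers of the `K_α`, as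
the closed subring of `K_Δ` which they generate. -/
noncomputable def integralKDelta : Subring (KDelta K) :=
  (Subring.closure {z | ∃ α, ∃ x : K α, ‖x‖ ≤ 1 ∧ iota K α x = z}).topologicalClosure

lemma iota_mem_integralKDelta (α : Δ) {x : K α} (hx : ‖x‖ ≤ 1) :
    iota K α x ∈ integralKDelta K :=
  Subring.le_topologicalClosure _ (Subring.subset_closure ⟨α, x, hx, rfl⟩)

lemma norm_beta_le_one (s : EmbeddingFamily K) {z : KDelta K} (hz : z ∈ integralKDelta K) :
    ‖beta s z‖ ≤ 1 := by
  have hcl : IsClosed {z | ‖beta s z‖ ≤ 1} :=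
    isClosed_le (continuous_norm.comp (continuous_beta s)) continuous_const
  refine closure_minimal (fun z hz => ?_) hcl hz
  change ‖beta s z‖ ≤ 1
  induction hz using Subring.closure_induction with
  | mem z hz =>
    obtain ⟨α, x, hx, rfl⟩ := hz
    rwa [beta_iota, norm_embedding]
  | zero => simp
  | one => simp
  | add a b _ _ ha hb =>
    rw [map_add]
    exact (IsUltrametricDist.norm_add_le_max _ _).trans (max_le ha hb)
  | neg a _ ha => rwa [map_neg, norm_neg]
  | mul a b _ _ ha hb =>
    rw [map_mul, norm_mul]
    exact mul_le_one₀ ha (norm_nonneg _) hb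

/-- The pseudo-uniformizing ideal `I_ϖ` of `O_{K,Δ}`. -/
noncomputable def integralIdeal (ϖ : ∀ α, K α) : Ideal (integralKDelta K) :=
  Ideal.span {z | ∃ α, iota K α (ϖ α) = z}

lemma norm_beta_integralIdeal {p : ℕ} {ϖ : ∀ α, K α} (hϖ : IsPseudoUniformizing p K ϖ) :
    ∃ c : ℝ, 0 ≤ c ∧ c < 1 ∧ ∀ (s : EmbeddingFamily K) (z : integralKDelta K),
      z ∈ integralIdeal ϖ → ‖beta s z‖ ≤ c := by
  obtain ⟨α₀, h₀⟩ := Finite.exists_max fun α => ‖ϖ α‖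
  refine ⟨‖ϖ α₀‖, norm_nonneg _, (hϖ α₀).2, fun s z hz => ?_⟩
  induction hz using Submodule.span_induction with
  | mem z hz =>
    obtain ⟨α, h⟩ := hz
    rw [← h, beta_iota, norm_embedding]
    exact h₀ α
  | zero => simp
  | add a b _ _ ha hb =>
    rw [Subring.coe_add, map_add]
    exact (IsUltrametricDist.norm_add_le_max _ _).trans (max_le ha hb)
  | smul a b _ hb =>
    rw [smul_eq_mul, Subring.coe_mul, map_mul, norm_mul]
    exact (mul_le_of_le_one_left (norm_nonneg _) (norm_beta_le_one s a.2)).trans hb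

variable (K) in
/-- The family of the inclusions. -/
noncomputable def inclusionFamily : EmbeddingFamily K := fun α =>
  { (K α).val with cont := continuous_subtype_val }

lemma charP_integral_quotient {p : ℕ} [hp : Fact p.Prime] (hK₀ : IsPadicField p K₀)
    {ϖ : ∀ α, K α} (hϖ : IsPseudoUniformizing p K ϖ) :
    CharP (integralKDelta K ⧸ integralIdeal ϖ) p := by
  obtain ⟨c, -, hc1, H⟩ := norm_beta_integralIdeal hϖ
  have hne : integralIdeal ϖ ≠ ⊤ := fun h => by
    have := H (inclusionFamily K) 1 (h ▸ Submodule.mem_top)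
    rw [Subring.coe_one, map_one, norm_one] at this
    exact absurd this (not_le.2 hc1)
  have : Nontrivial (integralKDelta K ⧸ integralIdeal ϖ) := Ideal.Quotient.nontrivial_iff.2 hne
  refine (CharP.charP_iff_prime_eq_zero hp.out).2 ?_
  obtain ⟨α⟩ := ‹Nonempty Δ›
  have := hK₀.charZero
  have hp0 : ‖(p : K₀)‖ ≠ 0 := norm_ne_zero_iff.2 (by exact_mod_cast hp.out.ne_zero)
  have hϖ0 : ϖ α ≠ 0 := norm_pos_iff.1 (lt_of_lt_of_le
    (lt_of_le_of_ne (norm_nonneg _) hp0.symm) (hϖ α).1)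
  have hpn : ‖(p : K α)‖ = ‖(p : K₀)‖ := by
    rw [← map_natCast (algebraMap K₀ (K α)), norm_algebraMap']
  have hu : ‖(ϖ α)⁻¹ * (p : K α)‖ ≤ 1 := by
    rw [norm_mul, norm_inv, hpn, inv_mul_le_iff₀ (norm_pos_iff.2 hϖ0), mul_one]
    exact (hϖ α).1
  rw [← map_natCast (Ideal.Quotient.mk (integralIdeal ϖ)), Ideal.Quotient.eq_zero_iff_mem]
  have e : (p : integralKDelta K) = ⟨_, iota_mem_integralKDelta α hu⟩ *
      ⟨_, iota_mem_integralKDelta α (hϖ α).2.le⟩ := by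
    refine Subtype.ext ?_
    rw [Subring.coe_mul, ← map_mul, mul_right_comm, inv_mul_cancel₀ hϖ0, one_mul, map_natCast]
    simp
  rw [e]
  exact Ideal.mul_mem_left _ _ (Ideal.subset_span ⟨α, rfl⟩)

/-- The tilt `lim_{x ↦ x ^ p} O_{K,Δ} / I_ϖ` of `O_{K,Δ}`. -/
def IntegralTilt {p : ℕ} (_hK₀ : IsPadicField p K₀) {ϖ : ∀ α, K α}
    (_hϖ : IsPseudoUniformizing p K ϖ) : Type (max u v) :=
  Perfection (integralKDelta K ⧸ integralIdeal ϖ) p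

section Equal

variable {p : ℕ} [hp : Fact p.Prime] (hK₀ : IsPadicField p K₀)

noncomputable instance {ϖ : ∀ α, K α} (hϖ : IsPseudoUniformizing p K ϖ) :
    CommRing (IntegralTilt hK₀ hϖ) :=
  haveI := charP_integral_quotient hK₀ hϖ
  inferInstanceAs (CommRing (Perfection (integralKDelta K ⧸ integralIdeal ϖ) p))

instance {ϖ : ∀ α, K α} (hϖ : IsPseudoUniformizing p K ϖ) : CharP (IntegralTilt hK₀ hϖ) p :=
  haveI := charP_integral_quotient hK₀ hϖ
  inferInstanceAs (CharP (Perfection (integralKDelta K ⧸ integralIdeal ϖ) p) p)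

variable (K₀) in
lemma hasSpectralNorm_C (hK₀ : IsPadicField p K₀) : HasSpectralNorm p (CompletedAlgClosure K₀) :=
  ⟨_, completedAlgClosure_hasSpectralNorm K₀ hK₀.norm_p_lt⟩

lemma tiltClose_beta (hK₀ : IsPadicField p K₀) {ϖ : ∀ α, K α} (hϖ : IsPseudoUniformizing p K ϖ) (s : EmbeddingFamily K)
    (a b : ℕ → integralKDelta K) (hab : ∀ m, Ideal.Quotient.mk (integralIdeal ϖ) (a m) =
      Ideal.Quotient.mk (integralIdeal ϖ) (b m)) :
    TiltClose p (fun x : CompletedAlgClosure K₀ => ‖x‖) (fun m => beta s (a m))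
      (fun m => beta s (b m)) := by
  obtain ⟨c, hc, hc1, H⟩ := norm_beta_integralIdeal hϖ
  refine ⟨1, c, le_rfl, hc, hc1, fun m => ?_⟩
  have h1 : tiltScale p 1 m = 1 := Real.one_rpow _
  rw [h1, mul_one]
  refine ⟨norm_beta_le_one s (a m).2, norm_beta_le_one s (b m).2, ?_⟩
  have := H s (a m - b m) (Ideal.Quotient.eq.1 (hab m))
  simpa using this

/-- Lifts to `O_{K,Δ}` of the components of an element of the tilt. -/
noncomputable def IntegralTilt.lift {ϖ : ∀ α, K α} {hϖ : IsPseudoUniformizing p K ϖ}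
    (x : IntegralTilt hK₀ hϖ) (m : ℕ) : integralKDelta K :=
  Function.surjInv Ideal.Quotient.mk_surjective (x.1 m)

lemma IntegralTilt.mk_lift {ϖ : ∀ α, K α} {hϖ : IsPseudoUniformizing p K ϖ}
    (x : IntegralTilt hK₀ hϖ) (m : ℕ) :
    Ideal.Quotient.mk (integralIdeal ϖ) (IntegralTilt.lift hK₀ x m) = x.1 m :=
  Function.surjInv_eq _ _

lemma IntegralTilt.coherent {ϖ : ∀ α, K α} {hϖ : IsPseudoUniformizing p K ϖ}
    (s : EmbeddingFamily K) (x : IntegralTilt hK₀ hϖ) :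
    TiltCoherent p (fun x : CompletedAlgClosure K₀ => ‖x‖)
      (fun m => beta s (IntegralTilt.lift hK₀ x m)) := by
  have := tiltClose_beta hK₀ hϖ s (fun m => IntegralTilt.lift hK₀ x (m + 1) ^ p)
    (fun m => IntegralTilt.lift hK₀ x m) fun m => by
      rw [map_pow, IntegralTilt.mk_lift, IntegralTilt.mk_lift]
      exact x.2 m
  simpa only [TiltCoherent, Subring.coe_pow, map_pow] using this

/-- The component of index `n` of the image of `x` is `lim_m β_s(x̃_{n + m}) ^ (p ^ m)`. -/
noncomputable def betaFlatFun {ϖ : ∀ α, K α} (hϖ : IsPseudoUniformizing p K ϖ)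
    (s : EmbeddingFamily K) (x : IntegralTilt hK₀ hϖ) :
    BanachTilt (hasSpectralNorm_C K₀ hK₀) :=
  BanachTilt.ofSeq _ (fun m => beta s (IntegralTilt.lift hK₀ x m))
    ⟨_, completedAlgClosure_hasSpectralNorm K₀ hK₀.norm_p_lt, IntegralTilt.coherent hK₀ s x⟩

lemma betaFlatFun_close {ϖ : ∀ α, K α} (hϖ : IsPseudoUniformizing p K ϖ)
    (s : EmbeddingFamily K) (x : IntegralTilt hK₀ hϖ) (a : ℕ → integralKDelta K)
    (ha : ∀ m, Ideal.Quotient.mk (integralIdeal ϖ) (a m) = x.1 m) :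
    TiltClose p (fun x : CompletedAlgClosure K₀ => ‖x‖) (betaFlatFun hK₀ hϖ s x).1
      (fun m => beta s (a m)) :=
  (BanachTilt.close_ofSeq (completedAlgClosure_hasSpectralNorm K₀ hK₀.norm_p_lt)
    (IntegralTilt.coherent hK₀ s x) _).trans
    (completedAlgClosure_hasSpectralNorm K₀ hK₀.norm_p_lt)
    (tiltClose_beta hK₀ hϖ s _ _ fun m => (IntegralTilt.mk_lift hK₀ x m).trans (ha m).symm)

/-- The homomorphism `β♭_s` from the tilt of `O_{K,Δ}` to the tilt of the completed algebraic
closure of `K₀`. -/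
noncomputable def betaFlat {ϖ : ∀ α, K α} (hϖ : IsPseudoUniformizing p K ϖ)
    (s : EmbeddingFamily K) :
    IntegralTilt hK₀ hϖ →+* BanachTilt (hasSpectralNorm_C K₀ hK₀) where
  toFun := betaFlatFun hK₀ hϖ s
  map_one' := by
    have hf := completedAlgClosure_hasSpectralNorm K₀ hK₀.norm_p_lt
    refine BanachTilt.eq_of_close hf ?_
    have h1 := betaFlatFun_close hK₀ hϖ s 1 (fun _ => 1) fun m => map_one _
    simp only [Subring.coe_one, map_one] at h1
    exact h1
  map_zero' := by
    have hf := completedAlgClosure_hasSpectralNorm K₀ hK₀.norm_p_lt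
    refine BanachTilt.eq_of_close hf ?_
    have h1 := betaFlatFun_close hK₀ hϖ s 0 (fun _ => 0) fun m => map_zero _
    simp only [Subring.coe_zero, map_zero] at h1
    exact h1
  map_mul' x y := by
    have hf := completedAlgClosure_hasSpectralNorm K₀ hK₀.norm_p_lt
    refine BanachTilt.eq_of_close hf ?_
    have h1 := betaFlatFun_close hK₀ hϖ s (x * y)
      (fun m => IntegralTilt.lift hK₀ x m * IntegralTilt.lift hK₀ y m) fun m => by
        rw [map_mul, IntegralTilt.mk_lift, IntegralTilt.mk_lift]; rfl
    simp only [Subring.coe_mul, map_mul] at h1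
    exact h1.trans hf (TiltClose.symm hf (TiltClose.mul hf
      (betaFlatFun_close hK₀ hϖ s x _ (IntegralTilt.mk_lift hK₀ x))
      (betaFlatFun_close hK₀ hϖ s y _ (IntegralTilt.mk_lift hK₀ y))))
  map_add' x y := by
    have hf := completedAlgClosure_hasSpectralNorm K₀ hK₀.norm_p_lt
    refine BanachTilt.eq_of_close hf ?_
    have h1 := betaFlatFun_close hK₀ hϖ s (x + y)
      (fun m => IntegralTilt.lift hK₀ x m + IntegralTilt.lift hK₀ y m) fun m => by
        rw [map_add, IntegralTilt.mk_lift, IntegralTilt.mk_lift]; rfl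
    simp only [Subring.coe_add, map_add] at h1
    exact h1.trans hf (TiltClose.symm hf ((BanachTilt.add_close hf _ _).trans hf
      (TiltClose.add hf (betaFlatFun_close hK₀ hϖ s x _ (IntegralTilt.mk_lift hK₀ x))
      (betaFlatFun_close hK₀ hϖ s y _ (IntegralTilt.mk_lift hK₀ y)))))

/-- The norm `|x|_♭ = |x♯|` on the tilt of the completed algebraic closure of `K₀`. -/
noncomputable def flatNorm : MulRingSeminorm (BanachTilt (hasSpectralNorm_C K₀ hK₀)) where
  toFun x := ‖x.sharp‖
  map_zero' := norm_zero
  map_one' := norm_one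
  map_mul' x y := norm_mul _ _
  add_le' x y := by
    have hf := completedAlgClosure_hasSpectralNorm K₀ hK₀.norm_p_lt
    have hl := (tiltLim_tendsto hf
      ((BanachTilt.coherent hf x).add hf (BanachTilt.coherent hf y)) 0).norm
    have hpow : ∀ (z : BanachTilt (hasSpectralNorm_C K₀ hK₀)) (m : ℕ),
        ‖z.1 m‖ ^ p ^ m = ‖z.sharp‖ := fun z m => by
      rw [← norm_pow]
      congr 1
      induction m with
      | zero => simp [BanachTilt.sharp]
      | succ m ih => rw [pow_succ' p m, pow_mul, z.2 m, ih]
    refine le_of_tendsto hl (Eventually.of_forall fun m => ?_)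
    rw [zero_add, norm_pow]
    have h1 : ‖x.1 m + y.1 m‖ ≤ max ‖x.1 m‖ ‖y.1 m‖ := IsUltrametricDist.norm_add_le_max _ _
    refine (pow_le_pow_left₀ (norm_nonneg _) h1 _).trans ?_
    rcases max_choice ‖x.1 m‖ ‖y.1 m‖ with h | h <;> rw [h, hpow]
    · exact le_add_of_nonneg_right (norm_nonneg _)
    · exact le_add_of_nonneg_left (norm_nonneg _)
  neg' x := by
    have hm : ∀ y z : BanachTilt (hasSpectralNorm_C K₀ hK₀),
        ‖(y * z).sharp‖ = ‖y.sharp‖ * ‖z.sharp‖ := fun y z => norm_mul _ _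
    have h1 : ‖(-1 : BanachTilt (hasSpectralNorm_C K₀ hK₀)).sharp‖ = 1 := by
      have h2 := hm (-1) (-1)
      rw [neg_mul_neg, one_mul] at h2
      have h3 : ‖(1 : BanachTilt (hasSpectralNorm_C K₀ hK₀)).sharp‖ = 1 := norm_one
      rw [h3] at h2
      nlinarith [norm_nonneg (-1 : BanachTilt (hasSpectralNorm_C K₀ hK₀)).sharp]
    rw [← neg_one_mul, hm, h1, one_mul]

/-- A family of compatible systems `(ϖ_α, ϖ_α ^ (1 / p), ϖ_α ^ (1 / p ^ 2), …)` of `p`-power roots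
of pseudo-uniformizers. -/
structure RootSystem (p : ℕ) (K : Δ → IntermediateField K₀ (CompletedAlgClosure K₀)) where
  root : ∀ α, ℕ → K α
  root_pow : ∀ α n, root α (n + 1) ^ p = root α n
  pseudoUniformizing : IsPseudoUniformizing p K fun α => root α 0

lemma RootSystem.norm_lt (r : RootSystem p K) (α : Δ) (n : ℕ) : ‖r.root α n‖ < 1 := by
  induction n with
  | zero => exact (r.pseudoUniformizing α).2
  | succ n ih =>
    rw [← r.root_pow, norm_pow] at ih
    by_contra! h
    exact absurd (one_le_pow₀ h) (not_le.2 ih)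

/-- The element `ϖ_α♭` of the tilt of `O_{K,Δ}`. -/
noncomputable def RootSystem.flat (r : RootSystem p K) (α : Δ) :
    IntegralTilt hK₀ r.pseudoUniformizing :=
  ⟨fun n => Ideal.Quotient.mk _ ⟨_, iota_mem_integralKDelta α (r.norm_lt α n).le⟩, fun n => by
    rw [← map_pow]
    congr 1
    refine Subtype.ext ?_
    rw [Subring.coe_pow, ← map_pow, r.root_pow]⟩

lemma RootSystem.betaFlat_flat (r : RootSystem p K) (s : EmbeddingFamily K) (α : Δ) :
    (betaFlat hK₀ r.pseudoUniformizing s (r.flat hK₀ α)).1 = fun n => s α (r.root α n) := by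
  have hf := completedAlgClosure_hasSpectralNorm K₀ hK₀.norm_p_lt
  refine eq_of_tiltClose hf (betaFlat hK₀ r.pseudoUniformizing s (r.flat hK₀ α)).2
    (fun n => by rw [← map_pow, r.root_pow]) ?_
  have := betaFlatFun_close hK₀ r.pseudoUniformizing s (r.flat hK₀ α)
    (fun n => ⟨_, iota_mem_integralKDelta α (r.norm_lt α n).le⟩) fun m => rfl
  simp only [beta_iota] at this
  exact this

/-- The ring `K_Δ♭`, obtained from the tilt of `O_{K,Δ}` by inverting the `ϖ_α♭`. -/
abbrev KDeltaFlat (r : RootSystem p K) : Type (max u v) :=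
  Localization (Submonoid.closure (Set.range (r.flat hK₀)))

lemma RootSystem.norm_pos (hK₀ : IsPadicField p K₀) (r : RootSystem p K) (α : Δ) (n : ℕ) : r.root α n ≠ 0 := by
  have := hK₀.charZero
  have hp0 : ‖(p : K₀)‖ ≠ 0 := norm_ne_zero_iff.2 (by exact_mod_cast hp.out.ne_zero)
  induction n with
  | zero =>
    exact norm_pos_iff.1 (lt_of_lt_of_le (lt_of_le_of_ne (norm_nonneg _) hp0.symm)
      (r.pseudoUniformizing α).1)
  | succ n ih =>
    rintro h
    rw [← r.root_pow, h, zero_pow hp.out.ne_zero] at ih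
    exact ih rfl

/-- The extension of `β♭_s` to `K_Δ♭`. -/
noncomputable def betaFlatLoc (r : RootSystem p K) (s : EmbeddingFamily K) :
    KDeltaFlat hK₀ r →+* BanachTilt (hasSpectralNorm_C K₀ hK₀) :=
  IsLocalization.lift (M := Submonoid.closure (Set.range (r.flat hK₀)))
    (g := betaFlat hK₀ r.pseudoUniformizing s) (by
      rintro ⟨y, hy⟩
      simp only
      induction hy using Submonoid.closure_induction with
      | mem y hy =>
        obtain ⟨α, rfl⟩ := hy
        refine IsUnit.of_mul_eq_one ⟨fun n => (s α (r.root α n))⁻¹, fun n => by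
          rw [inv_pow, ← map_pow, r.root_pow]⟩ (Subtype.ext (funext fun n => ?_))
        change (betaFlat hK₀ r.pseudoUniformizing s (r.flat hK₀ α)).1 n * _ = (1 : _)
        rw [r.betaFlat_flat hK₀]
        refine mul_inv_cancel₀ fun h => RootSystem.norm_pos hK₀ r α n ?_
        exact (map_eq_zero (s α : K α →+* CompletedAlgClosure K₀)).1 h
      | one => rw [map_one]; exact isUnit_one
      | mul a b _ _ ha hb => rw [map_mul]; exact ha.mul hb)

/-- The ring `K_Δ♭` with the seminorms `|x|_s = |β♭_s(x)|_♭`, `s ∈ 𝔖`, and the pseudo-uniformizing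
ideal generated by the `ϖ_α♭`. -/
noncomputable def equalBase (r : RootSystem p K) : SeminormedBase p (KDeltaFlat hK₀ r) where
  Idx := EmbeddingClass K
  v s :=
    { toFun := fun x => flatNorm hK₀ (betaFlatLoc hK₀ r s.rep x)
      map_zero' := by rw [map_zero, map_zero]
      add_le' := fun x y => by rw [map_add]; exact map_add_le_add _ _ _
      neg' := fun x => by rw [map_neg, map_neg_eq_map]
      map_one' := by rw [map_one, map_one]
      map_mul' := fun x y => by rw [map_mul, map_mul] }
  gens := Set.range fun α => algebraMap _ (KDeltaFlat hK₀ r) (r.flat hK₀ α)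
  exists_unit := by
    obtain ⟨α⟩ := ‹Nonempty Δ›
    refine ⟨algebraMap _ (KDeltaFlat hK₀ r) (r.flat hK₀ α),
      IsLocalization.map_units (KDeltaFlat hK₀ r)
        (⟨_, Submonoid.subset_closure ⟨α, rfl⟩⟩ : Submonoid.closure (Set.range (r.flat hK₀))),
      ‖r.root α 0‖, norm_pos_iff.2 (RootSystem.norm_pos hK₀ r α 0), r.norm_lt α 0, fun s => ?_⟩
    change flatNorm hK₀ (betaFlatLoc hK₀ r s.rep _) = _
    rw [betaFlatLoc, IsLocalization.lift_eq]
    change ‖(betaFlat hK₀ r.pseudoUniformizing s.rep (r.flat hK₀ α)).1 0‖ = _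
    rw [r.betaFlat_flat hK₀, norm_embedding]
  p_small := by
    refine ⟨0, one_pos, fun s => ?_⟩
    change flatNorm hK₀ (betaFlatLoc hK₀ r s.rep _) ≤ 0
    rw [← map_natCast (algebraMap (IntegralTilt hK₀ r.pseudoUniformizing) (KDeltaFlat hK₀ r)),
      CharP.cast_eq_zero, map_zero, map_zero, map_zero]

end Equal

end BaseField

/-! Passing from `R` to its tilt is elementary: `p`-power roots of an element are quasi-inverted by
means of a quasi-inverse of the element itself. The substance is the converse.

Let `f` be a spectral norm on `R`, and let the tilt `T` carry the norm `x ↦ f (x♯)`, for which it is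
complete and perfect of characteristic `p`. If `T` is von Neumann regular, it has no infinite
orthogonal family of nonzero idempotents, since a series `∑ π ^ i * e i` would have no quasi-inverse
(`exists_idempotent_eq_zero`). As `R` and `T` have the same idempotents, it suffices to find
quasi-inverses in `e R` for `e` primitive. Then `e T` is a field, and the crux is that its norm is
multiplicative (`apply_mul_apply_inv`). Granted this, a nonzero element of `e R` is scaled to norm
in `(c, 1]` and approximated up to `c` by some `g♯`. The inverse of `g` in `e T` has norm exactly `f
(g♯)⁻¹ < c⁻¹`, so multiplying the element by `(g⁻¹)♯` gives `e` times a unit `1 + δ`. Without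
multiplicativity the inverse could be too large for this. The statement on fields follows, a field
being a von Neumann regular ring with exactly two idempotents.

For multiplicativity, let `A` be a perfect field, complete for a power-multiplicative norm, with `f
x * f x⁻¹ > 1` for some `x`. The unit ball is integrally closed, hence an intersection of valuation
rings. So a scaled power `y` of `x` is larger than `1` at some `V₁` and smaller than `π` at some
`V₀`. An infinite product of inverses `(h n)⁻¹` is built which has size one at `V₀`, hence is not
zero, and is smaller at `V₁` than every power of `π`, hence is not invertible. The natural factor `1
+ u ^ (p ^ d)`, with `u = y / π ^ (1 / p ^ (n + 1))`, may be far too small where `u` has size one.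
It is replaced by a `p ^ k`-th root of a normalized product of translates `1 + u + c`, with `c` in
an `𝔽_p`-space spanned by powers of some `ϖ`. This product is additive (`spanProd_add`), at each
stage at most one of its `p` branches is small (`le_spanProd_valuation`), and compactness bounds the
smallest factor from below (`exists_inv_add_sum_le`). That bound enters only once, so the `p ^ k`-th
root reduces it to a single factor `π`. -/

/-! ### Additive polynomials attached to spans of powers, and their valuations. -/

section SpanProd

/-- The product of `s + c` over the `𝔽_p`-linear combinations `c` of `ϖ ^ (j + 1), …, ϖ ^ (j + l)`. -/
def spanProd (p : ℕ) {A : Type*} [CommRing A] (ϖ : A) : ℕ → ℕ → A → A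
  | 0, _, s => s
  | l + 1, j, s => ∏ a ∈ Finset.range p, spanProd p ϖ l (j + 1) (s + a * ϖ ^ (j + 1))

/-- This is the homogenization of `T ^ p - T = ∏ (T - a)` over `𝔽_p`, evaluated at `T = X / Y`. -/
lemma prod_range_add_natCast_mul {p : ℕ} [hp : Fact p.Prime] {A : Type*} [Field A] [CharP A p]
    (X Y : A) : ∏ a ∈ Finset.range p, (X + a * Y) = X ^ p - X * Y ^ (p - 1) := by
  rcases eq_or_ne Y 0 with rfl | hY
  · have : p - 1 ≠ 0 := by have := hp.out.two_le; omega
    simp [zero_pow this]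
  let _ := ZMod.algebra A p
  have key : ∏ a : ZMod p, (Polynomial.X - Polynomial.C a) =
      (Polynomial.X ^ p - Polynomial.X : Polynomial (ZMod p)) := by
    have hroots := FiniteField.roots_X_pow_card_sub_X (ZMod p)
    rw [ZMod.card] at hroots
    have hdeg := FiniteField.X_pow_card_sub_X_natDegree_eq (ZMod p) hp.out.one_lt
    have hm : (Polynomial.X ^ p - Polynomial.X : Polynomial (ZMod p)).Monic :=
      Polynomial.monic_X_pow_sub (by simpa using hp.out.one_lt)
    have := Polynomial.prod_multiset_X_sub_C_of_monic_of_roots_card_eq hm (by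
      rw [hroots, hdeg]; simp [ZMod.card])
    rw [hroots] at this
    exact this
  have h2 := congrArg (Polynomial.aeval (X / Y)) key
  simp only [map_prod, map_sub, Polynomial.aeval_X, Polynomial.aeval_C, map_pow] at h2
  have h3 : ∏ a : ZMod p, (X / Y - algebraMap (ZMod p) A a) =
      ∏ a ∈ Finset.range p, (X / Y + (a : A)) := by
    rw [← Equiv.prod_comp (Equiv.neg (ZMod p)), ← Fin.prod_univ_eq_prod_range (fun a => X / Y + (a : A))]
    -- With `p` a successor, `ZMod p` unfolds to `Fin p` and the two products match term by term.
    obtain ⟨q, rfl⟩ : ∃ q, p = q + 1 := ⟨p - 1, by have := hp.out.two_le; omega⟩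
    refine Finset.prod_congr rfl fun a _ => ?_
    simp only [Equiv.neg_apply, map_neg, sub_neg_eq_add]
    congr 1
  rw [h3] at h2
  calc ∏ a ∈ Finset.range p, (X + a * Y) = ∏ a ∈ Finset.range p, (Y * (X / Y + a)) :=
        Finset.prod_congr rfl fun a _ => by field_simp
    _ = Y ^ p * ((X / Y) ^ p - X / Y) := by
        rw [Finset.prod_mul_distrib, h2, Finset.prod_const, Finset.card_range]
    _ = _ := by
        obtain ⟨q, rfl⟩ : ∃ q, p = q + 1 := ⟨p - 1, by have := hp.out.two_le; omega⟩
        rw [Nat.add_sub_cancel, mul_sub, div_pow, mul_div_cancel₀ _ (pow_ne_zero _ hY), pow_succ Y]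
        field_simp

variable {p : ℕ} [hp : Fact p.Prime] {A : Type*} [Field A] [CharP A p] (ϖ : A)

/-- A polynomial whose zeros form an `𝔽_p`-space is additive. If `F` is the additive map of the
previous stage, the next one is `F s ^ p - F s * F (ϖ ^ (j + 1)) ^ (p - 1)`, additive because
Frobenius is. -/
lemma spanProd_add (l j : ℕ) (x y : A) :
    spanProd p ϖ l j (x + y) = spanProd p ϖ l j x + spanProd p ϖ l j y := by
  induction l generalizing j x y with
  | zero => rfl
  | succ l ih =>
    let F : A →+ A := AddMonoidHom.mk' (spanProd p ϖ l (j + 1)) (ih (j + 1))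
    have hF : ∀ s, spanProd p ϖ (l + 1) j s =
        F s ^ p - F s * F (ϖ ^ (j + 1)) ^ (p - 1) := fun s => by
      rw [← prod_range_add_natCast_mul]
      refine Finset.prod_congr rfl fun a _ => ?_
      change F (s + a * ϖ ^ (j + 1)) = _
      rw [map_add, ← nsmul_eq_mul, map_nsmul, nsmul_eq_mul]
    rw [hF, hF, hF, map_add, add_pow_char]
    ring

variable {Γ : Type*} [LinearOrderedCommGroupWithZero Γ] (v : Valuation A Γ)

-- Frobenius fixes the casts, so their value `γ` satisfies `γ ^ p = γ`. The digits of the spans are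
-- therefore invisible to valuations, except for being zero or not.
include p in
lemma Valuation.map_natCast_eq_zero_or_one (a : ℕ) : v (a : A) = 0 ∨ v (a : A) = 1 := by
  have h : (a : A) ^ p = a := map_natCast (frobenius A p) a
  have h2 : v (a : A) ^ p = v (a : A) := by rw [← map_pow, h]
  by_contra! H
  have h3 : v (a : A) ^ (p - 1) = 1 := by
    obtain ⟨q, rfl⟩ : ∃ q, p = q + 1 := ⟨p - 1, by have := hp.out.two_le; omega⟩
    rw [pow_succ] at h2
    exact mul_right_cancel₀ H.1 (by rw [Nat.add_sub_cancel, h2, one_mul])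
  exact H.2 ((pow_eq_one_iff_left (by have := hp.out.two_le; omega)).1 h3)

include p in
lemma Valuation.map_natCast_mul_le (a : ℕ) (x : A) : v (a * x) ≤ v x := by
  rw [map_mul]
  rcases v.map_natCast_eq_zero_or_one (p := p) a with h | h <;> simp [h]

variable {ϖ v}

lemma spanProd_valuation_le {γ : Γ} (hϖ : v ϖ ≤ 1) (l j : ℕ) (s : A) (hs : v s ≤ γ)
    (hj : v (ϖ ^ (j + 1)) ≤ γ) : v (spanProd p ϖ l j s) ≤ γ ^ p ^ l := by
  induction l generalizing j s with
  | zero => simpa [spanProd] using hs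
  | succ l ih =>
    rw [spanProd, map_prod, pow_succ p, pow_mul]
    refine (Finset.prod_le_prod' fun a _ => ih (j + 1) _ ?_ ?_).trans_eq
      (by rw [Finset.prod_const, Finset.card_range])
    · exact (v.map_add _ _).trans (max_le hs ((v.map_natCast_mul_le (p := p) a _).trans hj))
    · rw [pow_succ, map_mul]
      exact (mul_le_of_le_one_right' hϖ).trans hj

/-- The translations involve only `ϖ ^ (j + 1)` and higher powers, strictly smaller than `s`, so
each of the `p ^ l` factors has the size of `s`. -/
lemma spanProd_valuation_eq (hϖ : v ϖ < 1) (l j : ℕ) (s : A) (hs : v (ϖ ^ j) ≤ v s) (h0 : ϖ ≠ 0) :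
    v (spanProd p ϖ l j s) = v s ^ p ^ l := by
  have hlt : ∀ j, v (ϖ ^ (j + 1)) < v (ϖ ^ j) := fun j => by
    rw [pow_succ, map_mul]
    exact mul_lt_of_lt_one_right (by simp [zero_lt_iff, h0]) hϖ
  induction l generalizing j s with
  | zero => simp [spanProd]
  | succ l ih =>
    have hs' : ∀ a : ℕ, v (s + a * ϖ ^ (j + 1)) = v s := fun a =>
      v.map_add_eq_of_lt_left (((v.map_natCast_mul_le (p := p) a _).trans_lt (hlt j)).trans_le hs)
    rw [spanProd, map_prod, pow_succ p, pow_mul, Finset.prod_congr rfl fun a _ =>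
      ih (j + 1) _ ((hlt j).le.trans (hs.trans_eq (hs' a).symm))]
    simp only [hs', Finset.prod_const, Finset.card_range]

/-- Among the `p` branches of a stage at most one is smaller than `ϖ ^ (j + 1)`, since two such
would have a small difference, whereas this difference has the size of `ϖ ^ (j + 1)`. The other
branches are bounded by `spanProd_valuation_eq`. What matters is that `γ` enters with exponent one,
whatever the number `p ^ l` of factors. -/
lemma le_spanProd_valuation (hϖ : v ϖ < 1) (h0 : ϖ ≠ 0) {γ : Γ} (hγ : γ ≤ 1) (l j : ℕ) (s : A)
    (hs : ∀ a : ℕ → ℕ, (∀ i, a i < p) →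
      γ ≤ v (s + ∑ i ∈ Finset.range l, a i * ϖ ^ (j + i + 1))) :
    γ * v ϖ ^ ((j + 2) * p ^ l) ≤ v (spanProd p ϖ l j s) := by
  induction l generalizing j s with
  | zero =>
    have := hs (fun _ => 0) fun _ => hp.out.pos
    simp only [Finset.range_zero, Finset.sum_empty, add_zero] at this
    exact (mul_le_of_le_one_right' (pow_le_one' hϖ.le _)).trans this
  | succ l ih =>
    have hih : ∀ b < p, γ * v ϖ ^ ((j + 3) * p ^ l) ≤
        v (spanProd p ϖ l (j + 1) (s + b * ϖ ^ (j + 1))) := fun b hb => by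
      refine ih (j + 1) _ fun a ha => ?_
      -- The digit `b` of this stage is put in front of the digits of the later ones.
      refine (hs (fun i => i.casesOn b a) fun i => by cases i <;> simp [hb, ha]).trans_eq ?_
      rw [Finset.sum_range_succ']
      simp only [Nat.add_zero]
      congr 1
      rw [add_assoc, add_comm (b * ϖ ^ (j + 1))]
      congr 2
      refine Finset.sum_congr rfl fun i _ => ?_
      congr 2; ring
    have hex : ∃ b < p, ∀ a ∈ (Finset.range p).erase b,
        v ϖ ^ ((j + 1) * p ^ l) ≤ v (spanProd p ϖ l (j + 1) (s + a * ϖ ^ (j + 1))) := by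
      have hbig : ∀ a : ℕ, v (ϖ ^ (j + 1)) ≤ v (s + a * ϖ ^ (j + 1)) →
          v ϖ ^ ((j + 1) * p ^ l) ≤ v (spanProd p ϖ l (j + 1) (s + a * ϖ ^ (j + 1))) :=
        fun a ha => by
          rw [spanProd_valuation_eq hϖ l (j + 1) _ ha h0, pow_mul, ← map_pow]
          exact pow_le_pow_left' ha _
      by_cases H : ∃ b < p, v (s + b * ϖ ^ (j + 1)) < v (ϖ ^ (j + 1))
      · obtain ⟨b, hb, hlt⟩ := H
        refine ⟨b, hb, fun a ha => hbig a ?_⟩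
        rw [Finset.mem_erase, Finset.mem_range] at ha
        by_contra! hlt'
        have h1 := (v.map_sub _ _).trans_lt (max_lt hlt' hlt)
        have e : s + a * ϖ ^ (j + 1) - (s + b * ϖ ^ (j + 1)) = ((a : A) - b) * ϖ ^ (j + 1) := by
          ring
        rw [e, map_mul] at h1
        have h2 : v ((a : A) - b) = 1 := by
          have hne : ((a : A) - b) ≠ 0 := fun h => ha.1 (by
            have := (CharP.natCast_eq_natCast A p).1 (sub_eq_zero.1 h)
            exact Nat.ModEq.eq_of_lt_of_lt this ha.2 hb)
          have hcast : ((a : A) - b) = ((a + (p - b) : ℕ) : A) := by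
            rw [Nat.cast_add, Nat.cast_sub hb.le, CharP.cast_eq_zero A p]; ring
          rw [hcast] at hne ⊢
          exact (v.map_natCast_eq_zero_or_one (p := p) _).resolve_left (by simpa using hne)
        rw [h2, one_mul] at h1
        exact lt_irrefl _ h1
      -- No branch is small, so any index may play the exceptional role.
      · push Not at H
        exact ⟨0, hp.out.pos, fun a ha => hbig a
          (H a (Finset.mem_range.1 (Finset.mem_of_mem_erase ha)))⟩
    obtain ⟨b, hb, H⟩ := hex
    rw [spanProd, map_prod, ← Finset.mul_prod_erase _ _ (Finset.mem_range.2 hb)]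
    have h2 := Finset.prod_le_prod' H
    rw [Finset.prod_const, Finset.card_erase_of_mem (Finset.mem_range.2 hb),
      Finset.card_range, ← pow_mul] at h2
    refine le_trans ?_ (mul_le_mul' (hih b hb) h2)
    rw [mul_assoc, ← pow_add]
    refine mul_le_mul_right (pow_le_pow_right_of_le_one' hϖ.le ?_) _
    obtain ⟨q, hq⟩ : ∃ q, p = q + 2 := ⟨p - 2, by have := hp.out.two_le; omega⟩
    have : (j + 3) * p ^ l + (j + 1) * p ^ l * (p - 1) = p ^ l * (j + 3 + (j + 1) * (p - 1)) := by
      ring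
    rw [this, pow_succ]
    -- The left side is `(j + 1) * p + 2`, so `2 ≤ p` is exactly what makes the constant `j + 2`
    -- reproduce itself.
    have : j + 3 + (j + 1) * (p - 1) ≤ (j + 2) * p := by
      rw [hq]; simp only [Nat.add_succ_sub_one]; nlinarith
    calc _ ≤ p ^ l * ((j + 2) * p) := Nat.mul_le_mul_left _ this
      _ = _ := by ring

end SpanProd

/-! ### Complete power-multiplicative norms and their unit balls. -/

/-- `f` is a power-multiplicative nonarchimedean norm for which `A` is complete. -/
structure IsCompletePowMulNorm {A : Type*} [CommRing A] (f : A → ℝ) : Prop where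
  nonneg : ∀ x, 0 ≤ f x
  apply_zero : f 0 = 0
  eq_zero : ∀ x, f x = 0 → x = 0
  apply_neg : ∀ x, f (-x) = f x
  add_le : ∀ x y, f (x + y) ≤ max (f x) (f y)
  mul_le : ∀ x y, f (x * y) ≤ f x * f y
  apply_pow : ∀ x (n : ℕ), 1 ≤ n → f (x ^ n) = f x ^ n
  complete : ∀ u : ℕ → A, (∀ ε > 0, ∃ N, ∀ n ≥ N, f (u (n + 1) - u n) < ε) →
    ∃ x, ∀ ε > 0, ∃ N, ∀ n ≥ N, f (u n - x) < ε

namespace IsCompletePowMulNorm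

section Ring

variable {A : Type*} [CommRing A] {f : A → ℝ} (hf : IsCompletePowMulNorm f)
include hf

lemma sum_le {ι : Type*} (s : Finset ι) (g : ι → A) {B : ℝ}
    (hB : 0 ≤ B) (hg : ∀ i ∈ s, f (g i) ≤ B) : f (∑ i ∈ s, g i) ≤ B := by
  classical
  induction s using Finset.induction_on with
  | empty => simpa [hf.apply_zero] using hB
  | insert a s ha ih =>
    rw [Finset.sum_insert ha]
    exact (hf.add_le _ _).trans (max_le (hg _ (Finset.mem_insert_self _ _))
      (ih fun i hi => hg i (Finset.mem_insert_of_mem hi)))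

lemma apply_one_le : f 1 ≤ 1 := by
  have h := hf.apply_pow 1 2 one_le_two
  rw [one_pow] at h
  nlinarith [sq_nonneg (f 1 - 1)]

lemma natCast_le (n : ℕ) : f (n : A) ≤ 1 := by
  induction n with
  | zero => simp [hf.apply_zero]
  | succ n ih => push_cast; exact (hf.add_le _ _).trans (max_le ih hf.apply_one_le)

/-- `A` as a complete normed ring. -/
abbrev toNormedCommRing : NormedCommRing A :=
  { RingNorm.toNormedRing
      { toFun := f
        map_zero' := hf.apply_zero
        add_le' := fun x y => (hf.add_le x y).trans
          (max_le_add_of_nonneg (hf.nonneg x) (hf.nonneg y))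
        neg' := hf.apply_neg
        mul_le' := hf.mul_le
        eq_zero_of_map_eq_zero' := hf.eq_zero }, ‹CommRing A› with }

lemma completeSpace : @CompleteSpace A (hf.toNormedCommRing).toUniformSpace := by
  let _ := hf.toNormedCommRing
  refine Metric.complete_of_cauchySeq_tendsto fun u hu => ?_
  obtain ⟨x, hx⟩ := hf.complete u fun ε hε => by
    obtain ⟨N, hN⟩ := Metric.cauchySeq_iff.1 hu ε hε
    exact ⟨N, fun n hn => by
      have := hN (n + 1) (by omega) n hn
      rwa [dist_eq_norm] at this⟩
  refine ⟨x, Metric.tendsto_atTop.2 fun ε hε => ?_⟩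
  obtain ⟨N, hN⟩ := hx ε hε
  exact ⟨N, fun n hn => by rw [dist_eq_norm]; exact hN n hn⟩

end Ring

section Field

variable {A : Type*} [Field A] {f : A → ℝ} (hf : IsCompletePowMulNorm f)
include hf

lemma apply_one : f 1 = 1 := by
  have h := hf.apply_pow 1 2 one_le_two
  rw [one_pow] at h
  have h2 : f 1 ≠ 0 := fun h0 => one_ne_zero (hf.eq_zero 1 h0)
  rw [sq] at h
  exact (mul_left_cancel₀ h2 (h.symm.trans (mul_one _).symm))

/-- The subring of the elements of norm at most one. -/
def unitBall : Subring A where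
  carrier := {x | f x ≤ 1}
  mul_mem' {x y} hx hy := (hf.mul_le x y).trans (mul_le_one₀ hx (hf.nonneg y) hy)
  one_mem' := hf.apply_one_le
  add_mem' {x y} hx hy := (hf.add_le x y).trans (max_le hx hy)
  zero_mem' := hf.apply_zero.trans_le zero_le_one
  neg_mem' {x} hx := (hf.apply_neg x).trans_le hx

lemma mem_unitBall {x : A} : x ∈ hf.unitBall ↔ f x ≤ 1 := Iff.rfl

/-- An integral equation of degree `n` for `x` with `f x > 1` would give `f x ^ n ≤ f x ^ (n - 1)`.
The point is that an integrally closed subring is cut out by the valuation rings containing it,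
through which `f` will be tested. -/
lemma isIntegrallyClosedIn_unitBall : IsIntegrallyClosedIn hf.unitBall A := by
  refine Subring.isIntegrallyClosedIn_iff.2 fun x ⟨P, hP, hx⟩ => ?_
  by_contra! H
  rw [hf.mem_unitBall, not_le] at H
  rw [← Polynomial.aeval_def, hP.as_sum, map_add, map_sum] at hx
  simp only [map_pow, Polynomial.aeval_X, map_mul, Polynomial.aeval_C] at hx
  set n := P.natDegree with hn
  rcases Nat.eq_zero_or_pos n with h0 | hpos
  · simp [h0] at hx
  have h1 : f (x ^ n) ≤ f x ^ (n - 1) := by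
    rw [eq_neg_of_add_eq_zero_left hx, hf.apply_neg]
    refine hf.sum_le _ _ (by positivity) fun i hi => ?_
    rw [Finset.mem_range] at hi
    refine (hf.mul_le _ _).trans ((mul_le_of_le_one_left (hf.nonneg _) (P.coeff i).2).trans ?_)
    rcases Nat.eq_zero_or_pos i with rfl | hi0
    · rw [pow_zero]; exact hf.apply_one_le.trans (one_le_pow₀ H.le)
    · rw [hf.apply_pow _ _ hi0]; exact pow_le_pow_right₀ H.le (by omega)
  rw [hf.apply_pow _ _ hpos] at h1
  exact absurd h1 (not_le.2 (pow_lt_pow_right₀ H (by omega)))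

end Field

end IsCompletePowMulNorm

/-! ### Scaling units, and comparison of the norm with valuations. -/

/-- `b` is a unit which scales the norm `f`. -/
def IsScalingUnit {A : Type*} [Field A] (f : A → ℝ) (b : A) : Prop :=
  b ≠ 0 ∧ ∀ x, f (b * x) = f b * f x

section Field

variable {A : Type*} [Field A] {f : A → ℝ}

namespace IsScalingUnit

lemma pos {b : A} (hb : IsScalingUnit f b) (hf : IsCompletePowMulNorm f) : 0 < f b :=
  lt_of_le_of_ne (hf.nonneg b) fun h => hb.1 (hf.eq_zero _ h.symm)

lemma map_inv_mul (hf : IsCompletePowMulNorm f) {b : A} (hb : IsScalingUnit f b)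
    (x : A) : f (b⁻¹ * x) = (f b)⁻¹ * f x := by
  have := hb.2 (b⁻¹ * x)
  rw [mul_inv_cancel_left₀ hb.1] at this
  rw [this, inv_mul_cancel_left₀ (hb.pos hf).ne']

lemma pow (hf : IsCompletePowMulNorm f) {b : A} (hb : IsScalingUnit f b) (n : ℕ) :
    IsScalingUnit f (b ^ n) := by
  refine ⟨pow_ne_zero _ hb.1, ?_⟩
  have key : ∀ n x, f (b ^ n * x) = f b ^ n * f x := fun n => by
    induction n with
    | zero => simp
    | succ n ih => intro x; rw [pow_succ, mul_assoc, ih, hb.2, pow_succ, mul_assoc]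
  intro x
  have := key n 1
  rw [mul_one, hf.apply_one, mul_one] at this
  rw [key, this]

lemma of_pow (hf : IsCompletePowMulNorm f) {b : A} {n : ℕ} (hn : 1 ≤ n)
    (hb : IsScalingUnit f (b ^ n)) : IsScalingUnit f b := by
  refine ⟨fun h => hb.1 (by rw [h, zero_pow (by omega)]), fun x => ?_⟩
  have h := hb.2 (x ^ n)
  rw [← mul_pow, hf.apply_pow _ _ hn, hf.apply_pow _ _ hn, hf.apply_pow _ _ hn, ← mul_pow] at h
  exact (pow_left_inj₀ (hf.nonneg _) (mul_nonneg (hf.nonneg _) (hf.nonneg _)) (by omega)).1 h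

end IsScalingUnit

namespace IsCompletePowMulNorm

lemma valuation_le (hf : IsCompletePowMulNorm f) {V : ValuationSubring A} (hV : hf.unitBall ≤ V.toSubring)
    {b : A} (hb : IsScalingUnit f b) {x : A} (h : f x ≤ f b) : V.valuation x ≤ V.valuation b := by
  have h1 : b⁻¹ * x ∈ hf.unitBall := by
    rw [hf.mem_unitBall, hb.map_inv_mul hf, inv_mul_le_iff₀ (hb.pos hf), mul_one]; exact h
  have h2 := (V.valuation_le_one_iff _).2 (hV h1)
  rwa [map_mul, map_inv₀, inv_mul_le_iff₀ (by simpa [zero_lt_iff] using hb.1), mul_one] at h2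

/-- The element `b⁻¹ * x` lies outside the unit ball, and integral closedness supplies a valuation
ring that misses it. -/
lemma exists_valuation_lt (hf : IsCompletePowMulNorm f) {b : A} (hb : IsScalingUnit f b) {x : A} (h : f b < f x) :
    ∃ V : ValuationSubring A, hf.unitBall ≤ V.toSubring ∧ V.valuation b < V.valuation x := by
  have := hf.isIntegrallyClosedIn_unitBall
  have h1 : b⁻¹ * x ∉ hf.unitBall := by
    rw [hf.mem_unitBall, hb.map_inv_mul hf, inv_mul_le_iff₀ (hb.pos hf), mul_one, not_le]; exact h
  obtain ⟨V, hV, hx⟩ := Subring.exists_le_valuationSubring_of_isIntegrallyClosedIn h1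
  refine ⟨V, hV, ?_⟩
  rw [← V.valuation_le_one_iff, not_le, map_mul, map_inv₀,
    lt_inv_mul_iff₀ (by simpa [zero_lt_iff] using hb.1), mul_one] at hx
  exact hx

/-- A valuation ring containing the unit ball may have any rank, and `b` may be a unit in it. This
cannot happen if some `x` has value greater than one: `b ^ n * x` is in the unit ball for large `n`,
but would have value greater than one. -/
lemma valuation_lt_one (hf : IsCompletePowMulNorm f) {V : ValuationSubring A} (hV : hf.unitBall ≤ V.toSubring)
    {b : A} (hb : IsScalingUnit f b) (hb1 : f b < 1) {x : A} (hx : 1 < V.valuation x) :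
    V.valuation b < 1 := by
  by_contra! H
  obtain ⟨n, hn⟩ := exists_pow_lt_of_lt_one (show 0 < (f x + 1)⁻¹ by
    have := hf.nonneg x; positivity) hb1
  have h1 : b ^ n * x ∈ hf.unitBall := by
    have h2 : f b ^ n * f x ≤ 1 := by
      have h3 := hf.nonneg x
      calc f b ^ n * f x ≤ (f x + 1)⁻¹ * (f x + 1) :=
            mul_le_mul hn.le (by linarith) h3 (by positivity)
        _ = 1 := inv_mul_cancel₀ (by positivity)
    rw [hf.mem_unitBall, (hb.pow hf n).2]
    rcases Nat.eq_zero_or_pos n with rfl | hn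
    · simpa [hf.apply_one] using h2
    · rwa [hf.apply_pow _ _ hn]
  have h2 := (V.valuation_le_one_iff _).2 (hV h1)
  rw [map_mul, map_pow] at h2
  exact absurd (h2.trans_lt (hx.trans_le (le_mul_of_one_le_left' (one_le_pow₀ H)))) (lt_irrefl _)

/-- If `s` is not the negative of a power series in `ϖ` with coefficients `0, …, p - 1` and
without constant coefficient, then it stays away from these series. -/
lemma exists_inv_add_sum_le (hf : IsCompletePowMulNorm f) (p : ℕ) {ϖ : A} (hϖ : f ϖ < 1) (s : A)
    (hs : ∀ c : A, f c ≤ f ϖ → s + c ≠ 0) :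
    ∃ M : ℝ, ∀ (l : ℕ) (a : ℕ → ℕ), (∀ i, a i < p) →
      f (s + ∑ i ∈ Finset.range l, a i * ϖ ^ (i + 1))⁻¹ ≤ M := by
  let _ := hf.toNormedCommRing
  have := hf.completeSpace
  have hterm : ∀ (i : ℕ) (a : ℕ → Fin p), ‖((a i : ℕ) : A) * ϖ ^ (i + 1)‖ ≤ f ϖ ^ (i + 1) :=
    fun i a => by
      refine (hf.mul_le _ _).trans ?_
      rw [hf.apply_pow _ _ (by omega)]
      exact mul_le_of_le_one_left (pow_nonneg (hf.nonneg _) _) (hf.natCast_le _)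
  have hsum : Summable fun i : ℕ => f ϖ ^ (i + 1) :=
    (summable_nat_add_iff 1).2 (summable_geometric_of_lt_one (hf.nonneg _) hϖ)
  -- The series are parametrized by the compact space of digit sequences, and depend continuously on
  -- the digits because the convergence is uniform.
  let S : (ℕ → Fin p) → A := fun a => ∑' i, ((a i : ℕ) : A) * ϖ ^ (i + 1)
  have hS : Continuous S := by
    refine continuous_tsum (fun i => ?_) hsum hterm
    have : Continuous fun k : Fin p => ((k : ℕ) : A) * ϖ ^ (i + 1) := continuous_of_discreteTopology
    exact this.comp (continuous_apply i)
  have hSle : ∀ a, f (S a) ≤ f ϖ := fun a => by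
    have h1 : Tendsto (fun n => ∑ i ∈ Finset.range n, ((a i : ℕ) : A) * ϖ ^ (i + 1)) atTop
        (𝓝 (S a)) := (Summable.of_norm_bounded hsum (hterm · a)).hasSum.tendsto_sum_nat
    refine le_of_tendsto h1.norm (Eventually.of_forall fun n => ?_)
    refine hf.sum_le _ _ (hf.nonneg _) fun i _ => (hterm i a).trans ?_
    exact pow_le_of_le_one (hf.nonneg _) hϖ.le (by omega)
  -- Inversion is continuous at the units of a complete normed ring. By `hs` and `hSle` every value
  -- `s + S a` is a unit, so the norm of the inverse is bounded on a compact space.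
  have hcont : Continuous fun a => ‖Ring.inverse (s + S a)‖ := by
    refine continuous_norm.comp (continuous_iff_continuousAt.2 fun a => ?_)
    have hu : IsUnit (s + S a) := isUnit_iff_ne_zero.2 (hs _ (hSle a))
    have := NormedRing.inverse_continuousAt hu.unit
    exact ContinuousAt.comp (f := fun a => s + S a) this (by fun_prop)
  obtain ⟨M, hM⟩ := (isCompact_range hcont).bddAbove
  refine ⟨M, fun l a ha => ?_⟩
  -- Padding by zero digits turns the finite sum into one of the series.
  let a' : ℕ → Fin p := fun i => if i < l then ⟨a i, ha i⟩ else ⟨0, (Nat.zero_le _).trans_lt (ha 0)⟩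
  have h1 : S a' = ∑ i ∈ Finset.range l, a i * ϖ ^ (i + 1) := by
    refine (tsum_eq_sum (s := Finset.range l) fun i hi => ?_).trans
      (Finset.sum_congr rfl fun i hi => ?_)
    · have : ¬ i < l := by simpa using hi
      simp [a', this]
    · have : i < l := by simpa using hi
      simp [a', this]
  have h2 := hM ⟨a', rfl⟩
  simp only [h1, Ring.inverse_eq_inv] at h2
  exact h2

end IsCompletePowMulNorm

end Field

/-! ### Construction of one factor of the infinite product. -/

section Field

variable {A : Type*} [Field A] {f : A → ℝ}

lemma IsScalingUnit.one (hf : IsCompletePowMulNorm f) : IsScalingUnit f (1 : A) :=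
  ⟨one_ne_zero, fun x => by rw [hf.apply_one, one_mul, one_mul]⟩

namespace IsCompletePowMulNorm

lemma valuation_le_one (hf : IsCompletePowMulNorm f) {V : ValuationSubring A}
    (hV : hf.unitBall ≤ V.toSubring) {x : A} (hx : f x ≤ 1) : V.valuation x ≤ 1 :=
  (V.valuation_le_one_iff _).2 (hV hx)

/-- Only valuations at which `π` has value less than one need testing: a ring separating `x` from
`b` gives `b⁻¹ * x` a value above one, so `valuation_lt_one` applies to it. -/
lemma le_of_forall_valuation_le (hf : IsCompletePowMulNorm f) {b π : A} (hπ : IsScalingUnit f π)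
    (hπ1 : f π < 1) (hb : IsScalingUnit f b) {x : A}
    (h : ∀ V : ValuationSubring A, hf.unitBall ≤ V.toSubring → V.valuation π < 1 →
      V.valuation x ≤ V.valuation b) : f x ≤ f b := by
  by_contra! hlt
  obtain ⟨V, hV, h'⟩ := exists_valuation_lt hf hb hlt
  refine absurd (h V hV (valuation_lt_one hf hV hπ hπ1 (x := b⁻¹ * x) ?_)) (not_le.2 h')
  rw [map_mul, map_inv₀, lt_inv_mul_iff₀ (by simpa [zero_lt_iff] using hb.1), mul_one]
  exact h'

lemma exists_root {p : ℕ} (hperf : ∀ x : A, ∃ y, y ^ p = x) (k : ℕ) (x : A) :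
    ∃ y, y ^ p ^ k = x := by
  induction k with
  | zero => exact ⟨x, by simp⟩
  | succ k ih =>
    obtain ⟨y, rfl⟩ := ih
    obtain ⟨z, rfl⟩ := hperf y
    exact ⟨z, by rw [pow_succ', pow_mul]⟩

/-- A substitute of degree `p ^ d` for `1 + u ^ (p ^ d)` with a controlled behaviour
at the valuations for which `u` has size one. -/
lemma exists_step (hf : IsCompletePowMulNorm f) {p : ℕ} [hp : Fact p.Prime] [CharP A p]
    (hperf : ∀ x : A, ∃ y, y ^ p = x) {π : A} (hπ : IsScalingUnit f π) (hπ1 : f π < 1)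
    {n d : ℕ} (hn : 1 ≤ n) {ρ : A} (hρ : ρ ^ p ^ d = π) {u : A}
    (hu : ∃ V : ValuationSubring A, hf.unitBall ≤ V.toSubring ∧ 1 < V.valuation u) :
    ∃ h : A, ∀ V : ValuationSubring A, hf.unitBall ≤ V.toSubring → V.valuation π < 1 →
      (V.valuation u < 1 → V.valuation h = 1) ∧
      (V.valuation u ≤ V.valuation ρ ^ n → V.valuation (h - 1) ≤ V.valuation π ^ n) ∧
      (V.valuation u ≤ 1 → V.valuation (h - 1) ≤ 1) ∧
      (1 < V.valuation u → V.valuation h = V.valuation u ^ p ^ d) ∧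
      V.valuation π ^ (2 * n + 1) ≤ V.valuation h := by
  have hpd : 1 ≤ p ^ d := Nat.one_le_iff_ne_zero.2 (pow_ne_zero _ hp.out.ne_zero)
  have hρs : IsScalingUnit f ρ := IsScalingUnit.of_pow hf hpd (hρ ▸ hπ)
  have hρ1 : f ρ < 1 := by
    rw [← hρ, hf.apply_pow _ _ hpd] at hπ1
    by_contra! H
    exact absurd (one_le_pow₀ H) (not_le.2 hπ1)
  -- This choice gives `ϖ ^ (p ^ d) = π ^ n`, which converts estimates in `ϖ` at degree `p ^ d` into
  -- powers of `π`.
  set ϖ := ρ ^ n with hϖdef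
  have hϖs : IsScalingUnit f ϖ := hρs.pow hf n
  have hϖ1 : f ϖ < 1 := by
    rw [hϖdef, hf.apply_pow _ _ hn]
    exact pow_lt_one₀ (hf.nonneg _) hρ1 (by omega)
  -- At a valuation where `u` exceeds one, the bounded element `1 + c` cannot cancel `u`.
  have hs : ∀ c : A, f c ≤ f ϖ → 1 + u + c ≠ 0 := fun c hc h0 => by
    obtain ⟨V, hV, hu⟩ := hu
    have h1 : V.valuation c ≤ 1 := hf.valuation_le_one hV (hc.trans hϖ1.le)
    have h2 : V.valuation (1 + c) < V.valuation u :=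
      ((V.valuation.map_add 1 c).trans (max_le (map_one _).le h1)).trans_lt hu
    have e : u = -(1 + c) := by linear_combination h0
    rw [e, Valuation.map_neg] at h2
    exact lt_irrefl _ h2
  obtain ⟨M, hM⟩ := hf.exists_inv_add_sum_le p hϖ1 (1 + u) hs
  -- The bound `M` serves sums of every length, so `k` can be fixed first and the length `k + d`
  -- afterwards, without circularity.
  obtain ⟨k, hk⟩ := exists_pow_lt_of_lt_one (show 0 < (|M| + 1)⁻¹ by positivity) hπ1
  have hpk : p ^ k ≠ 0 := pow_ne_zero _ hp.out.ne_zero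
  have hbM : f (π ^ p ^ k) * M ≤ 1 := by
    rw [hf.apply_pow _ _ (Nat.one_le_iff_ne_zero.2 hpk)]
    have h1 : f π ^ p ^ k ≤ (|M| + 1)⁻¹ := (pow_le_pow_of_le_one (hf.nonneg _) hπ1.le
      (Nat.lt_pow_self hp.out.one_lt).le).trans hk.le
    calc f π ^ p ^ k * M ≤ f π ^ p ^ k * (|M| + 1) :=
          mul_le_mul_of_nonneg_left (by linarith [le_abs_self M]) (pow_nonneg (hf.nonneg _) _)
      _ ≤ (|M| + 1)⁻¹ * (|M| + 1) := mul_le_mul_of_nonneg_right h1 (by positivity)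
      _ = 1 := inv_mul_cancel₀ (by positivity)
  have hb : ∀ V : ValuationSubring A, hf.unitBall ≤ V.toSubring → ∀ a : ℕ → ℕ, (∀ i, a i < p) →
      V.valuation π ^ p ^ k ≤
        V.valuation (1 + u + ∑ i ∈ Finset.range (k + d), a i * ϖ ^ (0 + i + 1)) := by
    intro V hV a ha
    simp only [zero_add]
    set x := 1 + u + ∑ i ∈ Finset.range (k + d), a i * ϖ ^ (i + 1)
    have hx : f (π ^ p ^ k * x⁻¹) ≤ 1 := by
      rw [(hπ.pow hf _).2]
      exact (mul_le_mul_of_nonneg_left (hM _ a ha) (hf.nonneg _)).trans hbM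
    have hx0 : x ≠ 0 := by
      refine hs _ (hf.sum_le _ _ (hf.nonneg _) fun i _ => ?_)
      refine (hf.mul_le _ _).trans ((mul_le_of_le_one_left (hf.nonneg _) (hf.natCast_le _)).trans ?_)
      rw [hf.apply_pow _ _ (by omega)]
      exact pow_le_of_le_one (hf.nonneg _) hϖ1.le (by omega)
    have := hf.valuation_le_one hV hx
    rwa [map_mul, map_inv₀, mul_inv_le_iff₀ (by simpa [zero_lt_iff] using hx0), one_mul,
      map_pow] at this
  let G := spanProd p ϖ (k + d) 0
  have hϖV : ∀ V : ValuationSubring A, V.valuation π < 1 → V.valuation ϖ < 1 := fun V hV => by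
    rw [← hρ, map_pow] at hV
    rw [hϖdef, map_pow]
    refine pow_lt_one₀ zero_le ?_ (by omega)
    by_contra! H
    exact absurd (one_le_pow₀ H) (not_le.2 hV)
  have hG1 : ∀ V : ValuationSubring A, V.valuation π < 1 → V.valuation (G 1) = 1 := fun V hV => by
    rw [spanProd_valuation_eq (hϖV V hV) _ _ _ (by simp) hϖs.1, map_one, one_pow]
  have hG10 : G 1 ≠ 0 := by
    obtain ⟨V, hV, hu⟩ := hu
    intro h0
    have := hG1 V (hf.valuation_lt_one hV hπ hπ1 hu)
    simp [h0] at this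
  -- The product has degree `p ^ (k + d)`. The `p ^ k`-th root brings this down to `p ^ d`, and
  -- turns the lower bound `π ^ (p ^ k)` for the factors into `π`. Dividing by `G 1`, of value one
  -- where `π` is small, normalizes `h` to be close to `1` when `u` is small.
  obtain ⟨h, hh⟩ := exists_root hperf k (G (1 + u) * (G 1)⁻¹)
  -- Additivity of `G` and of Frobenius gives `h - 1` the same shape as `h`, with `u` in place of `1
  -- + u`.
  have hh1 : (h - 1) ^ p ^ k = G u * (G 1)⁻¹ := by
    rw [sub_pow_char_pow, hh, one_pow]
    simp only [G, spanProd_add]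
    simp only [G] at hG10
    field_simp
    ring
  refine ⟨h, fun V hV hπV => ?_⟩
  have e1 : V.valuation h ^ p ^ k = V.valuation (G (1 + u)) := by
    rw [← map_pow, hh, map_mul, map_inv₀, hG1 V hπV, inv_one, mul_one]
  have e2 : V.valuation (h - 1) ^ p ^ k = V.valuation (G u) := by
    rw [← map_pow, hh1, map_mul, map_inv₀, hG1 V hπV, inv_one, mul_one]
  have hϖpow : V.valuation ϖ ^ p ^ d = V.valuation π ^ n := by
    rw [hϖdef, map_pow, ← hρ, map_pow, ← pow_mul, ← pow_mul, mul_comm]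
  have hGe : 1 ≤ V.valuation (1 + u) → V.valuation h = V.valuation (1 + u) ^ p ^ d := fun H => by
    have := spanProd_valuation_eq (p := p) (hϖV V hπV) (k + d) 0 (1 + u) (by simpa using H) hϖs.1
    rw [← pow_left_inj₀ zero_le zero_le hpk, e1]
    refine this.trans ?_
    rw [← pow_mul, ← pow_add, add_comm k]
  refine ⟨fun H => ?_, fun H => ?_, fun H => ?_, fun H => ?_, ?_⟩
  · have : V.valuation (1 + u) = 1 := by
      rw [Valuation.map_add_eq_of_lt_left _ (by simpa using H), map_one]
    rw [hGe this.ge, this, one_pow]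
  · rw [← pow_le_pow_iff_left₀ zero_le zero_le hpk, e2, ← hϖpow]
    refine (spanProd_valuation_le (p := p) (γ := V.valuation ϖ) (hϖV V hπV).le (k + d) 0 u
      (by rwa [hϖdef, map_pow]) (by simp)).trans_eq ?_
    rw [← pow_mul, ← pow_add, add_comm]
  · rw [← pow_le_pow_iff_left₀ zero_le zero_le hpk, e2, one_pow]
    refine (spanProd_valuation_le (p := p) (γ := 1) (hϖV V hπV).le (k + d) 0 u H
      (by simpa using (hϖV V hπV).le)).trans_eq (one_pow _)
  · have : V.valuation (1 + u) = V.valuation u :=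
      Valuation.map_add_eq_of_lt_right _ (by simpa using H)
    rw [hGe (by rw [this]; exact H.le), this]
  · rw [← pow_le_pow_iff_left₀ zero_le zero_le hpk, e1]
    refine le_trans ?_ (le_spanProd_valuation (p := p) (hϖV V hπV) hϖs.1
      (pow_le_one' hπV.le (p ^ k)) (k + d) 0 (1 + u) (hb V hV))
    refine le_of_eq ?_
    -- With `ϖ ^ (p ^ d) = π ^ n`, the loss `ϖ ^ (2 * p ^ (k + d))` equals `π ^ (2 * n * p ^ k)`.
    -- Together with `π ^ (p ^ k)` this is the `p ^ k`-th power of `π ^ (2 * n + 1)`.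
    have e3 : (0 + 2) * p ^ (k + d) = p ^ d * (2 * p ^ k) := by rw [pow_add]; ring
    rw [e3, pow_mul, hϖpow, ← pow_mul, ← pow_mul, ← pow_add]
    congr 1; ring

end IsCompletePowMulNorm

end Field

/-! ### The infinite product, and multiplicativity of the norm on perfect fields. -/

section Field

variable {A : Type*} [Field A] {f : A → ℝ}

lemma IsScalingUnit.inv (hf : IsCompletePowMulNorm f) {b : A} (hb : IsScalingUnit f b) :
    IsScalingUnit f b⁻¹ ∧ f b⁻¹ = (f b)⁻¹ := by
  have h1 : f b⁻¹ = (f b)⁻¹ := by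
    simpa [hf.apply_one] using hb.map_inv_mul hf 1
  exact ⟨⟨inv_ne_zero hb.1, fun x => by rw [hb.map_inv_mul hf, h1]⟩, h1⟩

lemma IsScalingUnit.apply_pow (hf : IsCompletePowMulNorm f) (b : A) (n : ℕ) :
    f (b ^ n) = f b ^ n := by
  rcases Nat.eq_zero_or_pos n with rfl | hn
  · simp [hf.apply_one]
  · exact hf.apply_pow b n hn

lemma IsScalingUnit.zpow (hf : IsCompletePowMulNorm f) {b : A} (hb : IsScalingUnit f b) (n : ℤ) :
    IsScalingUnit f (b ^ n) ∧ f (b ^ n) = f b ^ n := by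
  obtain ⟨n, rfl | rfl⟩ := n.eq_nat_or_neg
  · simp only [zpow_natCast]
    exact ⟨hb.pow hf n, IsScalingUnit.apply_pow hf b n⟩
  · simp only [zpow_neg, zpow_natCast]
    rw [← IsScalingUnit.apply_pow hf b n]
    exact (hb.pow hf n).inv hf

namespace IsCompletePowMulNorm

lemma exists_compatible_roots {p : ℕ} (hperf : ∀ x : A, ∃ y, y ^ p = x) (π : A) :
    ∃ r : ℕ → A, r 0 = π ∧ (∀ n, r (n + 1) ^ p = r n) ∧ ∀ n m, r (n + m) ^ p ^ m = r n := by
  choose g hg using hperf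
  have h1 : ∀ n, (g^[n + 1] π) ^ p = g^[n] π := fun n => by
    rw [Function.iterate_succ_apply', hg]
  refine ⟨fun n => g^[n] π, rfl, h1, fun n m => ?_⟩
  induction m with
  | zero => simp
  | succ m ih => rw [pow_succ', pow_mul, ← add_assoc, h1, ih]

/-- Along an element whose size varies, one could construct a nonzero element which is not
invertible. -/
lemma false_of_valuation_lt (hf : IsCompletePowMulNorm f) {p : ℕ} [hp : Fact p.Prime] [CharP A p]
    (hperf : ∀ x : A, ∃ y, y ^ p = x) {π : A} (hπ : IsScalingUnit f π) (hπ1 : f π < 1) {y : A}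
    {V₀ V₁ : ValuationSubring A} (hV₀ : hf.unitBall ≤ V₀.toSubring)
    (hV₁ : hf.unitBall ≤ V₁.toSubring) (hy₀ : V₀.valuation y < V₀.valuation π)
    (hy₁ : 1 < V₁.valuation y) : False := by
  obtain ⟨r, hr0, hrp, hr⟩ := exists_compatible_roots hperf π
  have hp1 : ∀ n, 1 ≤ p ^ n := fun n => Nat.one_le_iff_ne_zero.2 (pow_ne_zero _ hp.out.ne_zero)
  have hrπ : ∀ n, r n ^ p ^ n = π := fun n => by simpa [hr0] using hr 0 n
  have hrs : ∀ n, IsScalingUnit f (r n) := fun n =>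
    IsScalingUnit.of_pow hf (hp1 n) ((hrπ n).symm ▸ hπ)
  have hr1 : ∀ n, f (r n) < 1 := fun n => by
    by_contra! H
    rw [← hrπ n, hf.apply_pow _ _ (hp1 n)] at hπ1
    exact absurd (one_le_pow₀ H) (not_le.2 hπ1)
  -- Here `r m` is a `p ^ m`-th root of `π`, and the thresholds `r (n + 1)` increase with `n`. The
  -- exponent is `4 * n + 9 = (n + 2) + (3 * n + 7)`: where `y` is at least `r (n + 2)`, the first
  -- summand turns `r (n + 2)` into `π`, and the second makes `(h n)⁻¹` at most `π ^ (3 * n + 7)`.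
  -- This gain has to beat the possible losses `π ^ (2 * (n + 1) + 1)` of the factors.
  have hstep := fun n => hf.exists_step hperf hπ hπ1 (n := n + 1) (d := 4 * n + 9) (by omega)
    (hrπ (4 * n + 9)) (u := y * (r (n + 1))⁻¹) ⟨V₁, hV₁, by
      have h1 := hf.valuation_le_one hV₁ (hr1 (n + 1)).le
      rw [map_mul, map_inv₀, lt_mul_inv_iff₀ (by simpa [zero_lt_iff] using (hrs (n + 1)).1),
        one_mul]
      exact h1.trans_lt hy₁⟩
  choose h hh using hstep
  let z : ℕ → A := fun n => ∏ i ∈ Finset.range n, (h i)⁻¹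
  have hz : ∀ n, z (n + 1) = z n * (h n)⁻¹ := fun n => Finset.prod_range_succ _ _
  have hVr : ∀ V : ValuationSubring A, V.valuation π < 1 → ∀ n, V.valuation (r n) < 1 :=
    fun V hV n => by
      by_contra! H
      rw [← hrπ n, map_pow] at hV
      exact absurd (one_le_pow₀ H) (not_le.2 hV)
  have hVpos : ∀ (V : ValuationSubring A) (n : ℕ), 0 < V.valuation (r n) := fun V n => by
    simpa [zero_lt_iff] using (hrs n).1
  have hπpos : ∀ (V : ValuationSubring A), 0 < V.valuation π := fun V => by
    simpa [zero_lt_iff] using hπ.1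
  have hrlt : ∀ V : ValuationSubring A, V.valuation π < 1 → ∀ n,
      V.valuation (r n) < V.valuation (r (n + 1)) := fun V hV n => by
    rw [← hrp n, map_pow]
    exact pow_lt_self_of_lt_one₀ (hVpos V _) (hVr V hV _) hp.out.one_lt
  have hrmono : ∀ V : ValuationSubring A, V.valuation π < 1 →
      Monotone fun n => V.valuation (r n) := fun V hV =>
    monotone_nat_of_le_succ fun n => (hrlt V hV n).le
  have hhpos : ∀ V : ValuationSubring A, hf.unitBall ≤ V.toSubring → V.valuation π < 1 →
      ∀ n, 0 < V.valuation (h n) := fun V hV hπV n =>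
    (pow_pos (hπpos V) _).trans_le (hh n V hV hπV).2.2.2.2
  have hu : ∀ V : ValuationSubring A, ∀ n, V.valuation (y * (r n)⁻¹) =
      V.valuation y * (V.valuation (r n))⁻¹ := fun V n => by rw [map_mul, map_inv₀]
  -- the size of `z n` at the valuations for which `y` is large
  have hA : ∀ V : ValuationSubring A, hf.unitBall ≤ V.toSubring → V.valuation π < 1 → ∀ n,
      V.valuation (r (n + 2)) ≤ V.valuation y →
      V.valuation (z (n + 1)) ≤ V.valuation π ^ (3 * n + 7) := by
    intro V hV hπV n hn
    have hui : ∀ i ≤ n, 1 < V.valuation (y * (r (i + 1))⁻¹) := fun i hi => by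
      rw [hu, lt_mul_inv_iff₀ (hVpos V _), one_mul]
      exact ((hrmono V hπV (by omega : i + 1 ≤ n + 1)).trans_lt (hrlt V hπV _)).trans_le hn
    have h1 : V.valuation (z n) ≤ 1 := by
      simp only [z, map_prod, map_inv₀]
      refine Finset.prod_le_one' fun i hi => inv_le_one_of_one_le₀ ?_
      have hi' := hui i (Finset.mem_range.1 hi).le
      rw [(hh i V hV hπV).2.2.2.1 hi']
      exact one_le_pow₀ hi'.le
    -- Since `r (n + 1) = r (n + 2) ^ p` and `y` is at least `r (n + 2)`, the quotient is at least
    -- `r (n + 2) ^ (1 - p)`, and `2 ≤ p`.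
    have h2 : (V.valuation (r (n + 2)))⁻¹ ≤ V.valuation (y * (r (n + 1))⁻¹) := by
      rw [hu, ← hrp (n + 1), map_pow, le_mul_inv_iff₀ (pow_pos (hVpos V _) _)]
      obtain ⟨q, hq⟩ : ∃ q, p = q + 2 := ⟨p - 2, by have := hp.out.two_le; omega⟩
      rw [hq, pow_succ', inv_mul_cancel_left₀ (hVpos V _).ne', pow_succ]
      exact (mul_le_of_le_one_left' (pow_le_one' (hVr V hπV _).le _)).trans hn
    have h3 : (V.valuation (h n))⁻¹ ≤ V.valuation π ^ (3 * n + 7) := by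
      rw [(hh n V hV hπV).2.2.2.1 (hui n le_rfl)]
      refine (inv_anti₀ (pow_pos (inv_pos.2 (hVpos V _)) _) (pow_le_pow_left' h2 _)).trans ?_
      rw [inv_pow, inv_inv]
      have : 4 * n + 9 = (n + 2) + (3 * n + 7) := by ring
      rw [this, pow_add, pow_mul, ← map_pow, hrπ]
      exact pow_le_pow_right_of_le_one' hπV.le (Nat.lt_pow_self hp.out.one_lt).le
    rw [hz, map_mul, map_inv₀]
    exact (mul_le_of_le_one_left' h1).trans h3
  have hh1 : ∀ V : ValuationSubring A, hf.unitBall ≤ V.toSubring → V.valuation π < 1 → ∀ n,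
      V.valuation y < V.valuation (r (n + 1)) → V.valuation (h n) = 1 := fun V hV hπV n hn =>
    (hh n V hV hπV).1 (by rwa [hu, mul_inv_lt_iff₀ (hVpos V _), one_mul])
  -- The factor `h (n + 1)` may be small here, by at most `π ^ (2 * n + 5)`; the gain `π ^ (3 * n +
  -- 7)` leaves `π ^ (n + 2)`.
  have hA' : ∀ V : ValuationSubring A, hf.unitBall ≤ V.toSubring → V.valuation π < 1 → ∀ n,
      V.valuation (r (n + 2)) ≤ V.valuation y →
      V.valuation (z (n + 2)) ≤ V.valuation π ^ (n + 2) := by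
    intro V hV hπV n hn
    rw [hz, map_mul, map_inv₀, mul_inv_le_iff₀ (hhpos V hV hπV _)]
    refine (hA V hV hπV n hn).trans (le_trans ?_
      (mul_le_mul_right (hh (n + 1) V hV hπV).2.2.2.2 _))
    rw [← pow_add]
    exact pow_le_pow_right_of_le_one' hπV.le (by omega)
  -- The constant `3 = 2 * 1 + 1` is the possible loss of the factor `h 0`. Any later loss is
  -- covered by `hA'`.
  have hB : ∀ V : ValuationSubring A, hf.unitBall ≤ V.toSubring → V.valuation π < 1 → ∀ n,
      V.valuation (z n) * V.valuation π ^ 3 ≤ 1 := by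
    intro V hV hπV n
    have h3 : V.valuation π ^ 3 ≤ 1 := pow_le_one' hπV.le _
    induction n with
    | zero => simpa [z] using h3
    | succ n ih =>
      rcases lt_or_ge (V.valuation y) (V.valuation (r (n + 1))) with H | H
      · rwa [hz, map_mul, map_inv₀, hh1 V hV hπV n H, inv_one, mul_one]
      · cases n with
        | zero =>
          rw [hz, map_mul, map_inv₀]
          have := (hh 0 V hV hπV).2.2.2.2
          simp only [z, Finset.range_zero, Finset.prod_empty, map_one, one_mul]
          rwa [inv_mul_le_iff₀ (hhpos V hV hπV _), mul_one]
        | succ n => exact mul_le_one' ((hA' V hV hπV n H).trans (pow_le_one' hπV.le _)) h3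
  -- The partial products are Cauchy for three different reasons. If `y` is at most `r (n + 2)`, the
  -- new factor is close to `1`; between `r (n + 2)` and `r (n + 3)`, the product is already small;
  -- from `r (n + 3)` on, it is small enough to absorb division by the new factor.
  have hC : ∀ V : ValuationSubring A, hf.unitBall ≤ V.toSubring → V.valuation π < 1 → ∀ n,
      V.valuation (π ^ 3 * (z (n + 2 + 1) - z (n + 2))) ≤ V.valuation (π ^ (n + 2)) := by
    intro V hV hπV n
    have hpos := hhpos V hV hπV (n + 2)
    have h0 : h (n + 2) ≠ 0 := fun h0 => by simp [h0] at hpos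
    have e : z (n + 2 + 1) - z (n + 2) = -(z (n + 2) * (h (n + 2) - 1) * (h (n + 2))⁻¹) := by
      rw [hz]; field_simp; ring
    have h3 : V.valuation π ^ 3 ≤ 1 := pow_le_one' hπV.le _
    rw [e, mul_neg, Valuation.map_neg, map_mul, map_mul, map_mul, map_pow, map_pow, map_inv₀]
    rcases lt_or_ge (V.valuation y) (V.valuation (r (n + 3))) with H | H
    · rw [hh1 V hV hπV _ H, inv_one, mul_one]
      rcases lt_or_ge (V.valuation (r (n + 2))) (V.valuation y) with H' | H'
      · have h1 : V.valuation (h (n + 2) - 1) ≤ 1 := (V.valuation.map_sub _ _).trans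
          (max_le (hh1 V hV hπV _ H).le (map_one _).le)
        calc _ ≤ 1 * (V.valuation π ^ (n + 2) * 1) :=
              mul_le_mul' h3 (mul_le_mul' (hA' V hV hπV n H'.le) h1)
          _ = _ := by rw [one_mul, mul_one]
      · have h1 : V.valuation (h (n + 2) - 1) ≤ V.valuation π ^ (n + 2 + 1) := by
          refine (hh (n + 2) V hV hπV).2.1 ?_
          rw [hu, mul_inv_le_iff₀ (hVpos V _)]
          refine H'.trans ?_
          rw [← hrp (n + 2), map_pow]
          obtain ⟨q, hq⟩ : ∃ q, p = q + 2 := ⟨p - 2, by have := hp.out.two_le; omega⟩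
          have h5 : V.valuation (r (n + 2 + 1)) ^ p ≤
              V.valuation (r (n + 2 + 1)) * V.valuation (r (n + 2 + 1)) := by
            rw [← sq]
            exact pow_le_pow_right_of_le_one' (hVr V hπV _).le hp.out.two_le
          refine h5.trans (mul_le_mul_left ?_ _)
          -- The root `ρ` of this stage is `r (4 * (n + 2) + 9)`, so `r (n + 3)` is its power of
          -- exponent `p ^ (3 * n + 14)`, which exceeds the needed `n + 3`.
          have h6 := hr (n + 2 + 1) (3 * n + 14)
          rw [← h6, map_pow, show n + 2 + 1 + (3 * n + 14) = 4 * (n + 2) + 9 by ring]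
          exact pow_le_pow_right_of_le_one' (hVr V hπV _).le
            ((by omega : n + 2 + 1 ≤ 3 * n + 14).trans (Nat.lt_pow_self hp.out.one_lt).le)
        calc _ = V.valuation (z (n + 2)) * V.valuation π ^ 3 * V.valuation (h (n + 2) - 1) := by
              rw [← mul_assoc, mul_comm (V.valuation π ^ 3)]
          _ ≤ 1 * V.valuation π ^ (n + 2 + 1) := mul_le_mul' (hB V hV hπV _) h1
          _ ≤ _ := by
            rw [one_mul]; exact pow_le_pow_right_of_le_one' hπV.le (by omega)
    · have h1 : V.valuation (h (n + 2) - 1) * V.valuation π ^ (2 * (n + 2 + 1) + 1) ≤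
          V.valuation (h (n + 2)) := by
        have h4 := (hh (n + 2) V hV hπV).2.2.2.2
        refine (mul_le_mul_left (V.valuation.map_sub _ _) _).trans ?_
        rw [map_one]
        rcases max_choice (V.valuation (h (n + 2))) 1 with h5 | h5 <;> rw [h5]
        · exact mul_le_of_le_one_right' (pow_le_one' hπV.le _)
        · rwa [one_mul]
      refine (mul_le_of_le_one_left' h3).trans ?_
      rw [mul_inv_le_iff₀ hpos]
      refine le_trans ?_ (mul_le_mul_right h1 _)
      calc _ ≤ V.valuation π ^ (3 * (n + 1) + 7) * V.valuation (h (n + 2) - 1) :=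
            mul_le_mul_left (hA V hV hπV (n + 1) H) _
        _ ≤ V.valuation π ^ (n + 2 + (2 * (n + 2 + 1) + 1)) * V.valuation (h (n + 2) - 1) :=
            mul_le_mul_left (pow_le_pow_right_of_le_one' hπV.le (by omega)) _
        _ = _ := by rw [pow_add, mul_assoc, mul_comm (V.valuation π ^ (2 * (n + 2 + 1) + 1))]
  have hπ0 := hπ.pos hf
  have hCf : ∀ n, f (z (n + 2 + 1) - z (n + 2)) ≤ (f π ^ 3)⁻¹ * f π ^ (n + 2) := fun n => by
    have := le_of_forall_valuation_le hf hπ hπ1 (hπ.pow hf (n + 2)) (fun V hV hπV => hC V hV hπV n)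
    rw [(hπ.pow hf 3).2, IsScalingUnit.apply_pow hf, IsScalingUnit.apply_pow hf] at this
    rwa [← div_eq_inv_mul, le_div_iff₀' (by positivity)]
  have hlim : Tendsto (fun n : ℕ => (f π ^ 3)⁻¹ * f π ^ n) atTop (𝓝 0) := by
    simpa using (tendsto_pow_atTop_nhds_zero_of_lt_one hπ0.le hπ1).const_mul (f π ^ 3)⁻¹
  obtain ⟨x, hx⟩ := hf.complete z fun ε hε => by
    obtain ⟨N, hN⟩ := eventually_atTop.1 (hlim.eventually_lt_const hε)
    refine ⟨N + 2, fun n hn => ?_⟩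
    obtain ⟨m, rfl⟩ : ∃ m, n = m + 2 := ⟨n - 2, by omega⟩
    exact (hCf m).trans_lt (hN _ (by omega))
  have hy0 : y ≠ 0 := fun h0 => by simp [h0] at hy₁
  have hπV₁ := valuation_lt_one hf hV₁ hπ hπ1 hy₁
  have hπV₀ : V₀.valuation π < 1 := valuation_lt_one hf hV₀ hπ hπ1 (x := π * y⁻¹) (by
    rwa [map_mul, map_inv₀, lt_mul_inv_iff₀ (by simpa [zero_lt_iff] using hy0), one_mul])
  -- At `V₀` the element `y` is below every threshold, so all partial products have value exactly
  -- one and cannot tend to zero in norm.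
  have hx0 : x ≠ 0 := fun h0 => by
    obtain ⟨N, hN⟩ := hx (f π) hπ0
    have h1 := hN N le_rfl
    rw [h0, sub_zero] at h1
    have h2 := valuation_le hf hV₀ hπ h1.le
    have h3 : V₀.valuation (z N) = 1 := by
      simp only [z, map_prod, map_inv₀]
      refine Finset.prod_eq_one fun i _ => ?_
      rw [hh1 V₀ hV₀ hπV₀ i (hy₀.trans_le ?_), inv_one]
      rw [← hr0]
      exact hrmono V₀ hπV₀ (Nat.zero_le _)
    exact absurd (h3.symm.trans_le h2) (not_le.2 hπV₀)
  -- Invertibility of `x` bounds it below at `V₁` by `π ^ m`, whereas approximation by a late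
  -- partial product bounds it above by `π ^ (m + 1)`.
  obtain ⟨m, hm⟩ := exists_pow_lt_of_lt_one (show 0 < (f x⁻¹ + 1)⁻¹ by
    have := hf.nonneg x⁻¹; positivity) hπ1
  have h1 : V₁.valuation π ^ m ≤ V₁.valuation x := by
    have h2 : f (π ^ m * x⁻¹) ≤ 1 := by
      have h3 := hf.nonneg x⁻¹
      rw [(hπ.pow hf m).2, IsScalingUnit.apply_pow hf]
      calc f π ^ m * f x⁻¹ ≤ (f x⁻¹ + 1)⁻¹ * (f x⁻¹ + 1) :=
            mul_le_mul hm.le (by linarith) h3 (by positivity)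
        _ = 1 := inv_mul_cancel₀ (by positivity)
    have := hf.valuation_le_one hV₁ h2
    rwa [map_mul, map_inv₀, mul_inv_le_iff₀ (by simpa [zero_lt_iff] using hx0), one_mul,
      map_pow] at this
  obtain ⟨N, hN⟩ := hx (f (π ^ (m + 1))) ((hπ.pow hf _).pos hf)
  have h2 := valuation_le hf hV₁ (hπ.pow hf (m + 1)) (hN (N + m + 1) (by omega)).le
  have h3 := hA V₁ hV₁ hπV₁ (N + m) ((hVr V₁ hπV₁ _).le.trans hy₁.le)
  have h4 : V₁.valuation x ≤ V₁.valuation π ^ (m + 1) := by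
    have e : x = z (N + m + 1) - (z (N + m + 1) - x) := by ring
    rw [e]
    refine (V₁.valuation.map_sub _ _).trans (max_le (h3.trans ?_) (h2.trans_eq (map_pow _ _ _)))
    exact pow_le_pow_right_of_le_one' hπV₁.le (by omega)
  exact absurd (h1.trans h4) (not_le.2 (pow_lt_pow_right_of_lt_one₀ (hπpos V₁) hπV₁ (by omega)))

/-- A complete power-multiplicative norm on a perfect field of characteristic `p`, with a
topologically nilpotent scaling unit, is multiplicative. -/
theorem apply_mul_apply_inv (hf : IsCompletePowMulNorm f) {p : ℕ} [hp : Fact p.Prime] [CharP A p]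
    (hperf : ∀ x : A, ∃ y, y ^ p = x) {π : A} (hπ : IsScalingUnit f π) (hπ1 : f π < 1) {x : A}
    (hx : x ≠ 0) : f x * f x⁻¹ = 1 := by
  refine le_antisymm ?_ ?_
  swap
  · rw [← hf.apply_one, ← mul_inv_cancel₀ hx]; exact hf.mul_le _ _
  by_contra! H
  have hπ0 := hπ.pos hf
  -- A gap of two factors `π` is created: one is used up by rounding to an integral power of `π`,
  -- the other separates `y` from `π` at `V₀`.
  obtain ⟨k, hk⟩ := pow_unbounded_of_one_lt ((f π)⁻¹ ^ 2) H
  rw [mul_pow, ← IsScalingUnit.apply_pow hf, ← IsScalingUnit.apply_pow hf, inv_pow x] at hk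
  set w := x ^ k
  have hw : w ≠ 0 := pow_ne_zero _ hx
  have hb : 0 < f w⁻¹ := lt_of_le_of_ne (hf.nonneg _) fun h => inv_ne_zero hw (hf.eq_zero _ h.symm)
  obtain ⟨n, hn1, hn2⟩ := exists_mem_Ico_zpow (show 0 < (f w⁻¹ * f π)⁻¹ by positivity)
    ((one_lt_inv₀ hπ0).2 hπ1)
  have hn3 : (f π)⁻¹ ^ (n + 1) < f w := by
    rw [zpow_add_one₀ (inv_pos.2 hπ0).ne']
    refine (mul_le_mul_of_nonneg_right hn1 (inv_pos.2 hπ0).le).trans_lt ?_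
    rw [mul_inv, mul_assoc, ← sq, inv_mul_lt_iff₀ hb, mul_comm]
    exact hk
  obtain ⟨hs, hs'⟩ := hπ.zpow hf (n + 1)
  obtain ⟨ht, ht'⟩ := hs
  have hinv := (hπ.zpow hf (n + 1)).1.inv hf
  rw [inv_zpow] at hn3 hn2
  have h1 : f 1 < f (π ^ (n + 1) * w) := by
    rw [ht', hs', hf.apply_one, ← div_lt_iff₀' (zpow_pos hπ0 _), one_div]
    exact hn3
  have h2 : f π⁻¹ < f (π ^ (n + 1) * w)⁻¹ := by
    rw [mul_inv, hinv.1.2, hinv.2, hs', (hπ.inv hf).2, ← div_lt_iff₀ hb]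
    rwa [mul_inv, mul_comm] at hn2
  obtain ⟨V₁, hV₁, hy₁⟩ := exists_valuation_lt hf (IsScalingUnit.one hf) h1
  obtain ⟨V₀, hV₀, hy₀⟩ := exists_valuation_lt hf (hπ.inv hf).1 h2
  rw [map_one] at hy₁
  rw [map_inv₀, map_inv₀, inv_lt_inv₀ (by simpa [zero_lt_iff] using hπ.1)
    (by rw [zero_lt_iff, ne_eq, map_eq_zero]; exact mul_ne_zero ht hw)] at hy₀
  exact false_of_valuation_lt hf hperf hπ hπ1 hV₀ hV₁ hy₀ hy₁

end IsCompletePowMulNorm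

end Field

/-! ### The tilt as a complete perfect ring of characteristic `p`. -/

section TiltNorm

variable {p : ℕ} [hp : Fact p.Prime] {R : Type*} [NormedCommRing R] [CompleteSpace R] {f : R → ℝ}

namespace IsSpectralNorm

lemma eq_zero (hf : IsSpectralNorm p f) {x : R} (hx : f x = 0) : x = 0 := by
  obtain ⟨M, hM⟩ := hf.norm_le
  have := hM x
  rw [hx, mul_zero] at this
  exact norm_le_zero_iff.1 this

/-- The given norm need not be less than one at `x`, but it is at a high power of `-x`, and `1 + x`
divides `1 - (-x) ^ (n + 1)`. -/
lemma isUnit_one_add (hf : IsSpectralNorm p f) {x : R} (hx : f x < 1) : IsUnit (1 + x) := by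
  obtain ⟨M, hM⟩ := hf.norm_le
  obtain ⟨n, hn⟩ := exists_pow_lt_of_lt_one (show 0 < (|M| + 1)⁻¹ by positivity) hx
  have h1 : ‖(-x) ^ (n + 1)‖ < 1 := by
    have h0 := hf.nonneg x
    refine (hM _).trans_lt ?_
    rw [hf.map_pow _ _ (by omega), hf.map_neg]
    have h2 : f x ^ (n + 1) ≤ f x ^ n := pow_le_pow_of_le_one h0 hx.le (by omega)
    calc M * f x ^ (n + 1) ≤ |M| * f x ^ n :=
          mul_le_mul (le_abs_self M) h2 (by positivity) (abs_nonneg _)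
      _ ≤ |M| * (|M| + 1)⁻¹ := mul_le_mul_of_nonneg_left hn.le (abs_nonneg _)
      _ < (|M| + 1) * (|M| + 1)⁻¹ := mul_lt_mul_of_pos_right (by linarith) (by positivity)
      _ = 1 := mul_inv_cancel₀ (by positivity)
  refine isUnit_of_dvd_unit ?_ (isUnit_one_sub_of_norm_lt_one h1)
  have := sub_dvd_pow_sub_pow 1 (-x) (n + 1)
  rwa [one_pow, sub_neg_eq_add] at this

lemma coherent_of_le (hf : IsSpectralNorm p f) {a : ℕ → R} {C e : ℝ} (hC : 1 ≤ C) (he : 0 ≤ e)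
    (he1 : e < 1) (ha : ∀ m, f (a m) ≤ tiltScale p C m)
    (h : ∀ m, f (a (m + 1) ^ p - a m) ≤ e * tiltScale p C m) : TiltCoherent p f a := by
  refine ⟨C, e, hC, he, he1, fun m => ⟨?_, ha m, h m⟩⟩
  rw [← tiltScale_pow_succ hC m]
  exact (hf.pow_le _ _).trans (pow_le_pow_left₀ (hf.nonneg _) (ha _) _)

/-- Taking `p ^ m`-th powers does not worsen the error of a coherent sequence, and an ultrametric
telescoping sum does not add errors up. The explicit constants, the same for all sequences of a
given size, are what the completeness proof needs. -/
lemma tiltLim_sub_le (hf : IsSpectralNorm p f) {a : ℕ → R} {C e : ℝ} (hC : 1 ≤ C) (he : 0 ≤ e)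
    (he1 : e < 1) (ha : ∀ m, f (a m) ≤ tiltScale p C m)
    (h : ∀ m, f (a (m + 1) ^ p - a m) ≤ e * tiltScale p C m) (n : ℕ) :
    f (tiltLim p a n - a n) ≤ e * tiltScale p C n := by
  have hs : 0 ≤ tiltScale p C n := zero_le_one.trans (tiltScale_one_le hC n)
  have step : ∀ m, f (a (n + m) ^ p ^ m - a n) ≤ e * tiltScale p C n := by
    intro m
    induction m with
    | zero => simpa [hf.map_zero] using mul_nonneg he hs
    | succ m ih =>
      have hc := max_le he1.le hf.map_p_lt.le
      have h1 := hf.pow_sub_pow_iter he (le_max_left _ _) hc (le_max_right e (f (p : R)))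
        (h (n + m)) (ha (n + m)) m
      rw [tiltScale_pow hC, ← pow_mul, ← pow_succ', add_assoc] at h1
      rw [← sub_add_sub_cancel _ (a (n + m) ^ p ^ m)]
      refine (hf.add_le _ _).trans (max_le (h1.trans ?_) ih)
      exact mul_le_mul_of_nonneg_right
        (mul_le_of_le_one_right he (pow_le_one₀ (he.trans (le_max_left _ _)) hc)) hs
  exact le_of_tendsto ((hf.continuous.tendsto _).comp
    ((tiltLim_tendsto hf (hf.coherent_of_le hC he he1 ha h) n).sub_const (a n)))
    (Eventually.of_forall step)

end IsSpectralNorm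

namespace BanachTilt

variable {h : HasSpectralNorm p R}

lemma val_pow (x : BanachTilt h) (n m : ℕ) : (x ^ n).1 m = x.1 m ^ n := by
  induction n with
  | zero => rw [pow_zero, pow_zero]; rfl
  | succ n ih => rw [pow_succ, pow_succ, ← ih]; rfl

lemma val_mul (x y : BanachTilt h) (m : ℕ) : (x * y).1 m = x.1 m * y.1 m := rfl

lemma val_pow_pow (x : BanachTilt h) (n m : ℕ) : x.1 (n + m) ^ p ^ m = x.1 n := by
  induction m with
  | zero => simp
  | succ m ih => rw [pow_succ' p m, pow_mul, ← add_assoc, x.2, ih]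

lemma apply_val_pow (hf : IsSpectralNorm p f) (x : BanachTilt h) (m : ℕ) :
    f (x.1 m) ^ p ^ m = f (x.1 0) := by
  rw [← hf.map_pow _ _ (Nat.one_le_iff_ne_zero.2 (pow_ne_zero _ hp.out.ne_zero))]
  have := val_pow_pow x 0 m
  rw [zero_add] at this
  rw [this]

lemma apply_val_le (hf : IsSpectralNorm p f) {x : BanachTilt h} {C : ℝ} (hC : 1 ≤ C)
    (hx : f (x.1 0) ≤ C) (m : ℕ) : f (x.1 m) ≤ tiltScale p C m :=
  le_tiltScale (hf.nonneg _) hC ((apply_val_pow hf x m).trans_le hx)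

/-- The addition of the tilt is close to the componentwise addition. -/
lemma add_sub_le (hf : IsSpectralNorm p f) {x y : BanachTilt h} {C : ℝ} (hC : 1 ≤ C)
    (hx : f (x.1 0) ≤ C) (hy : f (y.1 0) ≤ C) (m : ℕ) :
    f ((x + y).1 m - (x.1 m + y.1 m)) ≤ f (p : R) * tiltScale p C m := by
  refine hf.tiltLim_sub_le hC (hf.nonneg _) hf.map_p_lt (fun m => (hf.add_le _ _).trans
    (max_le (apply_val_le hf hC hx m) (apply_val_le hf hC hy m))) (fun m => ?_) m
  have := hf.add_pow_error zero_le_one le_rfl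
    (by simpa using apply_val_le hf hC hx (m + 1)) (apply_val_le hf hC hy (m + 1))
  rw [sub_sub, x.2, y.2, one_mul, tiltScale_pow_succ hC] at this
  exact this

lemma sub_sub_le (hf : IsSpectralNorm p f) {x y : BanachTilt h} {C : ℝ} (hC : 1 ≤ C)
    (hxy : f ((x - y).1 0) ≤ C) (hy : f (y.1 0) ≤ C) (m : ℕ) :
    f ((x.1 m - y.1 m) - (x - y).1 m) ≤ f (p : R) * tiltScale p C m := by
  have := add_sub_le hf hC hxy hy m
  rw [sub_add_cancel] at this
  rwa [sub_sub, add_comm (y.1 m)]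

lemma apply_add_le (hf : IsSpectralNorm p f) (x y : BanachTilt h) :
    f ((x + y).1 0) ≤ max (f (x.1 0)) (f (y.1 0)) := by
  have hl := (hf.continuous.tendsto _).comp
    (tiltLim_tendsto hf ((coherent hf x).add hf (coherent hf y)) 0)
  refine le_of_tendsto hl (Eventually.of_forall fun m => ?_)
  simp only [Function.comp_apply, zero_add]
  refine (hf.pow_le _ _).trans ((pow_le_pow_left₀ (hf.nonneg _) (hf.add_le _ _) _).trans ?_)
  rcases max_choice (f (x.1 m)) (f (y.1 m)) with h | h <;> rw [h, apply_val_pow hf]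
  · exact le_max_left _ _
  · exact le_max_right _ _

lemma apply_neg (hf : IsSpectralNorm p f) (x : BanachTilt h) : f ((-x).1 0) = f (x.1 0) := by
  have h1 : f ((-x).1 0) ^ 2 = f (x.1 0) ^ 2 := by
    rw [← hf.map_pow _ _ one_le_two, ← hf.map_pow _ _ one_le_two, ← val_pow, ← val_pow, neg_sq]
  exact (pow_left_inj₀ (hf.nonneg _) (hf.nonneg _) two_ne_zero).1 h1

lemma apply_sub_le (hf : IsSpectralNorm p f) (x y : BanachTilt h) :
    f ((x - y).1 0) ≤ max (f (x.1 0)) (f (y.1 0)) := by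
  rw [sub_eq_add_neg, ← apply_neg hf y]; exact apply_add_le hf x (-y)

lemma ext_zero (hf : IsSpectralNorm p f) {x : BanachTilt h} (hx : f (x.1 0) = 0) : x = 0 := by
  refine Subtype.ext (funext fun m => hf.eq_zero ?_)
  have := apply_val_pow hf x m
  rw [hx] at this
  exact eq_zero_of_pow_eq_zero this

lemma exists_sub_lt (hf : IsSpectralNorm p f) {u : ℕ → BanachTilt h}
    (hu : ∀ ε > 0, ∃ N, ∀ n ≥ N, f ((u (n + 1) - u n).1 0) < ε) {ε : ℝ} (hε : 0 < ε) :
    ∃ N, ∀ n ≥ N, ∀ m ≥ N, f ((u n - u m).1 0) < ε := by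
  obtain ⟨N, hN⟩ := hu ε hε
  have key : ∀ k, f ((u (N + k) - u N).1 0) < ε := fun k => by
    induction k with
    | zero =>
      rw [add_zero, sub_self]
      exact (hf.map_zero.trans_lt hε : f ((0 : BanachTilt h).1 0) < ε)
    | succ k ih =>
      rw [← sub_add_sub_cancel (u (N + (k + 1))) (u (N + k)) (u N)]
      exact (apply_add_le hf _ _).trans_lt (max_lt (hN (N + k) (by omega)) ih)
  refine ⟨N, fun n hn m hm => ?_⟩
  rw [← sub_sub_sub_cancel_right (u n) (u m) (u N)]
  refine (apply_sub_le hf _ _).trans_lt (max_lt ?_ ?_)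
  · simpa [Nat.add_sub_cancel' hn] using key (n - N)
  · simpa [Nat.add_sub_cancel' hm] using key (m - N)

/-- A diagonal argument: the limit is the tilt element attached to the `m`-th components of `u (j
m)`, where `j m` is so late that these components have stabilized up to a factor `q < 1`. An error
`q` in component `m` becomes `q ^ (p ^ m)` in component `0`. -/
lemma complete (hf : IsSpectralNorm p f) (u : ℕ → BanachTilt h)
    (hu : ∀ ε > 0, ∃ N, ∀ n ≥ N, f ((u (n + 1) - u n).1 0) < ε) :
    ∃ x : BanachTilt h, ∀ ε > 0, ∃ N, ∀ n ≥ N, f ((u n - x).1 0) < ε := by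
  -- The base `1 / 2` is an arbitrary number in `(0, 1)`; its exponent `p ^ m` disappears on passing
  -- to the `m`-th component.
  have hthr := fun m : ℕ => exists_sub_lt hf hu (show (0 : ℝ) < (1 / 2) ^ p ^ m by positivity)
  choose t ht using hthr
  -- Summing the thresholds makes them monotone.
  let j : ℕ → ℕ := fun m => ∑ i ∈ Finset.range (m + 1), t i
  have hj : Monotone j := fun a b hab => Finset.sum_le_sum_of_subset (by
    intro i hi; simp only [Finset.mem_range] at *; omega)
  have htj : ∀ m, t m ≤ j m := fun m =>
    Finset.single_le_sum (f := t) (fun _ _ => Nat.zero_le _) (Finset.self_mem_range_succ m)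
  have hj' : ∀ m, ∀ n ≥ j m, ∀ n' ≥ j m, f ((u n - u n').1 0) ≤ (1 / 2) ^ p ^ m :=
    fun m n hn n' hn' => (ht m n ((htj m).trans hn) n' ((htj m).trans hn')).le
  set C : ℝ := max 1 (f ((u (j 0)).1 0)) with hCdef
  have hC : 1 ≤ C := le_max_left _ _
  have huC : ∀ n ≥ j 0, f ((u n).1 0) ≤ C := fun n hn => by
    rw [← sub_add_cancel (u n) (u (j 0))]
    refine (apply_add_le hf _ _).trans (max_le_max ((hj' 0 n hn _ le_rfl).trans ?_) le_rfl)
    norm_num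
  set q : ℝ := max (f (p : R)) (1 / 2)
  have hq0 : 0 ≤ q := le_max_of_le_left (hf.nonneg _)
  have hq1 : q < 1 := max_lt hf.map_p_lt (by norm_num)
  have hts : ∀ m, 1 ≤ tiltScale p C m := tiltScale_one_le hC
  have hD : ∀ m, ∀ n ≥ j m, ∀ n' ≥ j m, f ((u n).1 m - (u n').1 m) ≤ q * tiltScale p C m := by
    intro m n hn n' hn'
    have h1 := hj' m n hn n' hn'
    have h2 : f ((u n - u n').1 m) ≤ 1 / 2 := by
      rw [← apply_val_pow hf _ m] at h1
      exact le_of_pow_le_pow_left₀ (pow_ne_zero _ hp.out.ne_zero) (by norm_num) h1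
    have h3 : f ((u n - u n').1 0) ≤ C :=
      h1.trans ((pow_le_one₀ (by norm_num) (by norm_num)).trans hC)
    have h4 := sub_sub_le hf hC h3 (huC n' ((hj (Nat.zero_le m)).trans hn')) m
    rw [← sub_add_cancel ((u n).1 m - (u n').1 m) ((u n - u n').1 m)]
    refine (hf.add_le _ _).trans (max_le (h4.trans ?_) (h2.trans ?_))
    · exact mul_le_mul_of_nonneg_right (le_max_left _ _) (zero_le_one.trans (hts m))
    · exact (le_max_right (f (p : R)) _).trans (le_mul_of_one_le_right hq0 (hts m))
  let a : ℕ → R := fun m => (u (j m)).1 m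
  have ha : ∀ m, f (a m) ≤ tiltScale p C m := fun m =>
    apply_val_le hf hC (huC _ (hj (Nat.zero_le m))) m
  have ha' : ∀ m, f (a (m + 1) ^ p - a m) ≤ q * tiltScale p C m := fun m => by
    simp only [a]
    rw [(u (j (m + 1))).2 m]
    exact hD m _ (hj (Nat.le_succ m)) _ le_rfl
  let x : BanachTilt h := ofSeq h a ⟨f, hf, hf.coherent_of_le hC hq0 hq1 ha ha'⟩
  have hx : ∀ m, f (x.1 m - a m) ≤ q * tiltScale p C m := hf.tiltLim_sub_le hC hq0 hq1 ha ha'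
  have hxC : f (x.1 0) ≤ C := by
    rw [← sub_add_cancel (x.1 0) (a 0)]
    have h0 : tiltScale p C 0 = C := tiltScale_zero
    have h1 := hx 0
    have h2 := ha 0
    rw [h0] at h1 h2
    exact (hf.add_le _ _).trans (max_le (h1.trans (mul_le_of_le_one_left
      (zero_le_one.trans hC) hq1.le)) h2)
  have hmain : ∀ m, ∀ n ≥ j m, f ((u n - x).1 0) ≤ q ^ p ^ m * C := by
    intro m n hn
    have hn0 := (hj (Nat.zero_le m)).trans hn
    have h1 := sub_sub_le hf hC ((apply_sub_le hf _ _).trans (max_le (huC n hn0) hxC)) hxC m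
    have h2 : f ((u n - x).1 m) ≤ q * tiltScale p C m := by
      have e : (u n - x).1 m = -(((u n).1 m - x.1 m) - (u n - x).1 m) +
          (((u n).1 m - a m) - (x.1 m - a m)) := by ring
      rw [e]
      refine (hf.add_le _ _).trans (max_le ?_ ((hf.sub_le _ _).trans
        (max_le (hD m n hn _ le_rfl) (hx m))))
      rw [hf.map_neg]
      exact h1.trans (mul_le_mul_of_nonneg_right (le_max_left _ _) (zero_le_one.trans (hts m)))
    rw [← apply_val_pow hf _ m]
    refine (pow_le_pow_left₀ (hf.nonneg _) h2 _).trans_eq ?_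
    have h3 := tiltScale_pow (p := p) hC 0 m
    rw [zero_add, tiltScale_zero] at h3
    rw [mul_pow, h3]
  refine ⟨x, fun ε hε => ?_⟩
  obtain ⟨m, hm⟩ := exists_pow_lt_of_lt_one (show 0 < ε / C by positivity) hq1
  refine ⟨j m, fun n hn => (hmain m n hn).trans_lt ?_⟩
  rw [← lt_div_iff₀ (by positivity)]
  exact (pow_le_pow_of_le_one hq0 hq1.le (Nat.lt_pow_self hp.out.one_lt).le).trans_lt hm

/-- The tilt is complete for the norm `x ↦ f (x♯)`. -/
lemma isCompletePowMulNorm (hf : IsSpectralNorm p f) :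
    IsCompletePowMulNorm fun x : BanachTilt h => f (x.1 0) where
  nonneg x := hf.nonneg _
  apply_zero := hf.map_zero
  eq_zero x hx := ext_zero hf hx
  apply_neg := apply_neg hf
  add_le := apply_add_le hf
  mul_le x y := hf.mul_le _ _
  apply_pow x n hn := by rw [val_pow, hf.map_pow _ _ hn]
  complete := complete hf

/-- Every component of the tilt element `k` differs from `k` by at most `f p`. Thus each component
of `p` has size at most `f p < 1`, and component `0` is the `p ^ m`-th power of component `m` for
every `m`. -/
lemma natCast_p_eq_zero (hf : IsSpectralNorm p f) : (p : BanachTilt h) = 0 := by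
  have hN := isCompletePowMulNorm (h := h) hf
  have hts : ∀ m, tiltScale p 1 m = 1 := fun m => Real.one_rpow _
  have key : ∀ k m : ℕ, f ((k : BanachTilt h).1 m - k) ≤ f (p : R) := fun k m => by
    induction k with
    | zero =>
      rw [Nat.cast_zero, Nat.cast_zero, sub_zero]
      exact hf.map_zero.trans_le (hf.nonneg _)
    | succ k ih =>
      have h1 := add_sub_le hf le_rfl (hN.natCast_le k) hN.apply_one_le m
      rw [hts, mul_one] at h1
      have e : ((k + 1 : ℕ) : BanachTilt h).1 m - ((k + 1 : ℕ) : R) =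
          (((k : BanachTilt h) + 1).1 m - ((k : BanachTilt h).1 m + (1 : BanachTilt h).1 m)) +
            ((k : BanachTilt h).1 m - k) := by
        have : (1 : BanachTilt h).1 m = 1 := rfl
        rw [Nat.cast_succ, this]; push_cast; ring
      rw [e]
      exact (hf.add_le _ _).trans (max_le h1 ih)
  refine ext_zero hf (le_antisymm ?_ (hf.nonneg _))
  refine ge_of_tendsto (tendsto_pow_atTop_nhds_zero_of_lt_one (hf.nonneg _) hf.map_p_lt)
    (Eventually.of_forall fun m => ?_)
  rw [← apply_val_pow hf _ m]
  have h1 : f ((p : BanachTilt h).1 m) ≤ f (p : R) := by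
    rw [← sub_add_cancel ((p : BanachTilt h).1 m) (p : R)]
    exact (hf.add_le _ _).trans (max_le (key p m) le_rfl)
  exact (pow_le_pow_left₀ (hf.nonneg _) h1 _).trans (pow_le_pow_of_le_one (hf.nonneg _)
    hf.map_p_lt.le (Nat.lt_pow_self hp.out.one_lt).le)

lemma exists_pow_eq (x : BanachTilt h) : ∃ y, y ^ p = x := by
  let y : BanachTilt h := ⟨fun n => x.1 (n + 1), fun n => x.2 (n + 1)⟩
  exact ⟨y, Subtype.ext (funext fun n => (val_pow y p n).trans (x.2 n))⟩

/-- The constant sequence attached to an idempotent. -/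
def ofIdempotent (h : HasSpectralNorm p R) {e : R} (he : IsIdempotentElem e) : BanachTilt h :=
  ⟨fun _ => e, fun _ => he.pow_eq hp.out.ne_zero⟩

lemma isIdempotentElem_ofIdempotent {e : R} (he : IsIdempotentElem e) :
    IsIdempotentElem (ofIdempotent h he) :=
  Subtype.ext (funext fun _ => he)

lemma isIdempotentElem_val {e : BanachTilt h} (he : IsIdempotentElem e) (m : ℕ) :
    IsIdempotentElem (e.1 m) :=
  congrFun (congrArg Subtype.val he) m

/-- An idempotent equals its `p`-powers, so idempotents of the tilt are constant sequences; with
`ofIdempotent` this identifies them with those of `R`. -/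
lemma val_eq_of_isIdempotentElem {e : BanachTilt h} (he : IsIdempotentElem e) (m : ℕ) :
    e.1 m = e.1 0 := by
  have h1 := val_pow_pow e 0 m
  rw [zero_add, (isIdempotentElem_val he m).pow_eq (pow_ne_zero _ hp.out.ne_zero)] at h1
  exact h1

/-- Iterating approximate `p`-th roots of `r` yields a coherent sequence starting at `r`. The tilt
element it defines stays within `c` of it. -/
lemma exists_sharp_sub_le (hf : IsSpectralNorm p f) {c : ℝ} (hc : 0 ≤ c) (hc1 : c < 1)
    (hfrob : ∀ r, f r ≤ 1 → ∃ r', f r' ≤ 1 ∧ f (r' ^ p - r) ≤ c) (r : R) (hr : f r ≤ 1) :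
    ∃ g : BanachTilt h, f (g.1 0 - r) ≤ c := by
  choose! φ hφ1 hφ2 using hfrob
  let a : ℕ → R := fun n => φ^[n] r
  have ha : ∀ n, f (a n) ≤ 1 := fun n => by
    induction n with
    | zero => exact hr
    | succ n ih => simp only [a, Function.iterate_succ_apply']; exact hφ1 _ ih
  have hts : ∀ m, tiltScale p 1 m = 1 := fun m => Real.one_rpow _
  have ha1 : ∀ m, f (a m) ≤ tiltScale p 1 m := fun m => by rw [hts]; exact ha m
  have ha2 : ∀ m, f (a (m + 1) ^ p - a m) ≤ c * tiltScale p 1 m := fun m => by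
    rw [hts, mul_one]
    simp only [a, Function.iterate_succ_apply']
    exact hφ2 _ (ha m)
  refine ⟨ofSeq h a ⟨f, hf, hf.coherent_of_le le_rfl hc hc1 ha1 ha2⟩, ?_⟩
  have := hf.tiltLim_sub_le le_rfl hc hc1 ha1 ha2 0
  rwa [hts, mul_one] at this

end BanachTilt

end TiltNorm

/-! ### Idempotents in complete von Neumann regular rings. -/

section VonNeumannRegular

/-- A commutative ring is a field if and only if it is von Neumann regular and has exactly two
idempotents. -/
lemma isField_iff_isVonNeumannRegular {A : Type*} [CommRing A] :
    IsField A ↔ IsVonNeumannRegular A ∧ (0 : A) ≠ 1 ∧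
      ∀ e : A, IsIdempotentElem e → e = 0 ∨ e = 1 := by
  constructor
  · intro h
    let _ := h.toField
    refine ⟨fun x => ?_, zero_ne_one, fun e he => IsIdempotentElem.iff_eq_zero_or_one.1 he⟩
    by_cases hx : x = 0
    · exact ⟨0, by rw [hx]; ring⟩
    · obtain ⟨y, hy⟩ := h.mul_inv_cancel hx
      exact ⟨y, by rw [sq, mul_assoc, hy, mul_one]⟩
  · rintro ⟨h, h01, he⟩
    refine ⟨⟨0, 1, h01⟩, mul_comm, fun {x} hx => ?_⟩
    obtain ⟨y, hy⟩ := h x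
    refine ⟨y, (he (x * y) ?_).resolve_left fun h0 => hx ?_⟩
    · show x * y * (x * y) = x * y
      linear_combination y * hy
    · rw [← hy, sq, mul_assoc, h0, mul_zero]

namespace IsCompletePowMulNorm

variable {A : Type*} [CommRing A] {f : A → ℝ}

lemma apply_idempotent (hf : IsCompletePowMulNorm f) {e : A} (he : IsIdempotentElem e)
    (he0 : e ≠ 0) : f e = 1 := by
  have h1 := hf.apply_pow e 2 one_le_two
  rw [he.pow_eq two_ne_zero] at h1
  have h2 : f e ≠ 0 := fun h => he0 (hf.eq_zero _ h)
  have h3 : f e * (f e - 1) = 0 := by linear_combination -h1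
  linarith [(mul_eq_zero.1 h3).resolve_left h2]

lemma apply_pow_mul {π : A} {c : ℝ} (hπ : ∀ x, f (π * x) = c * f x) (n : ℕ) (x : A) :
    f (π ^ n * x) = c ^ n * f x := by
  induction n with
  | zero => simp
  | succ n ih => rw [pow_succ', mul_assoc, hπ, ih, pow_succ', mul_assoc]

/-- A complete von Neumann regular ring has no infinite orthogonal family of idempotents. -/
lemma exists_idempotent_eq_zero (hf : IsCompletePowMulNorm f) (hA : IsVonNeumannRegular A)
    {π : A} {c : ℝ} (hc : 0 < c) (hc1 : c < 1) (hπ : ∀ x, f (π * x) = c * f x)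
    {e : ℕ → A} (he : ∀ i, IsIdempotentElem (e i)) (ho : ∀ i j, i ≠ j → e i * e j = 0) :
    ∃ i, e i = 0 := by
  by_contra! h0
  have he1 : ∀ i, f (e i) = 1 := fun i => hf.apply_idempotent (he i) (h0 i)
  have htend := tendsto_pow_atTop_nhds_zero_of_lt_one hc.le hc1
  -- The element `x = ∑ π ^ i * e i` acts as `π ^ i` on the factor of `e i`.
  obtain ⟨x, hx⟩ := hf.complete (fun n => ∑ i ∈ Finset.range n, π ^ i * e i) fun ε hε => by
    obtain ⟨N, hN⟩ := eventually_atTop.1 (htend.eventually_lt_const hε)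
    refine ⟨N, fun n hn => ?_⟩
    rw [Finset.sum_range_succ, add_sub_cancel_left, apply_pow_mul hπ, he1, mul_one]
    exact hN n hn
  have hex : ∀ i, e i * x = π ^ i * e i := fun i => by
    refine (sub_eq_zero.1 (hf.eq_zero _ (le_antisymm (le_of_forall_pos_lt_add fun ε hε => ?_)
      (hf.nonneg _)))).symm
    obtain ⟨N, hN⟩ := hx ε hε
    have h1 := hN (max N (i + 1)) (le_max_left _ _)
    have h2 : π ^ i * e i - e i * x =
        e i * (∑ j ∈ Finset.range (max N (i + 1)), π ^ j * e j - x) := by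
      rw [mul_sub, Finset.mul_sum, Finset.sum_eq_single i]
      · linear_combination -π ^ i * (he i).eq
      · intro j _ hj
        rw [mul_left_comm, ho i j hj.symm, mul_zero]
      · intro h
        exact absurd (Finset.mem_range.2 (lt_of_lt_of_le (Nat.lt_succ_self i)
          (le_max_right N (i + 1)))) h
    rw [h2, zero_add]
    refine (hf.mul_le _ _).trans_lt ?_
    rwa [he1, one_mul]
  obtain ⟨y, hy⟩ := hA x
  -- On the factor of `e i` a quasi-inverse must invert `π ^ i`, so its norm is at least `c ^ (-i)`
  -- for every `i`.
  have hbound : ∀ i, 1 ≤ c ^ i * f y := fun i => by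
    have h1 : π ^ i * (π ^ i * (e i * y)) = π ^ i * e i := by
      have h2 := hex i
      have h3 := (he i).eq
      calc π ^ i * (π ^ i * (e i * y)) = (π ^ i * e i) * (π ^ i * e i) * y := by
            linear_combination -π ^ i * π ^ i * y * h3
        _ = (e i * x) * (e i * x) * y := by rw [h2]
        _ = e i * x := by linear_combination (e i) * hy + x ^ 2 * y * h3
        _ = π ^ i * e i := h2
    have h2 := congrArg f h1
    rw [apply_pow_mul hπ, apply_pow_mul hπ, apply_pow_mul hπ, he1] at h2
    have h3 : c ^ i * f (e i * y) = 1 := mul_left_cancel₀ (pow_pos hc i).ne' h2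
    rw [← h3]
    refine mul_le_mul_of_nonneg_left ((hf.mul_le _ _).trans ?_) (pow_pos hc i).le
    rw [he1, one_mul]
  have := ge_of_tendsto (htend.mul_const (f y)) (Eventually.of_forall hbound)
  linarith

/-- The corner ring of a primitive idempotent in a perfect complete von Neumann regular ring
has a multiplicative norm. -/
lemma exists_mul_eq_idempotent (hf : IsCompletePowMulNorm f) (hA : IsVonNeumannRegular A)
    {p : ℕ} [hp : Fact p.Prime] (hp0 : (p : A) = 0) (hperf : ∀ x : A, ∃ y, y ^ p = x)
    {π : A} {c : ℝ} (hc : 0 < c) (hc1 : c < 1) (hπ : ∀ x, f (π * x) = c * f x)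
    {e : A} (he : IsIdempotentElem e) (he0 : e ≠ 0)
    (hprim : ∀ g : A, IsIdempotentElem g → e * g = g → g = 0 ∨ g = e)
    {x : A} (hex : e * x = x) (hx : x ≠ 0) : ∃ y, x * y = e ∧ f x * f y = 1 := by
  have hmem : ∀ z : he.Corner, e * z.1 = z.1 := fun z => ((Subsemigroup.mem_corner_iff he).1 z.2).1
  let mk : ∀ z : A, he.Corner := fun z => ⟨e * z, (Subsemigroup.mem_corner_iff he).2
    ⟨by rw [← mul_assoc, he.eq], by rw [mul_comm, ← mul_assoc, he.eq]⟩⟩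
  -- The corner inherits regularity, and primitivity of `e` leaves it only the two trivial
  -- idempotents.
  have hfield : IsField he.Corner := by
    refine isField_iff_isVonNeumannRegular.2 ⟨fun z => ?_, fun h => he0 (congrArg Subtype.val h).symm,
      fun g hg => ?_⟩
    · obtain ⟨y, hy⟩ := hA z.1
      refine ⟨mk y, Subtype.ext ?_⟩
      rw [sq]
      show z.1 * z.1 * (e * y) = z.1
      linear_combination e * hy + hmem z
    · rcases hprim g.1 (congrArg Subtype.val hg) (hmem g) with h | h
      · exact Or.inl (Subtype.ext h)
      · exact Or.inr (Subtype.ext h)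
  let _ : Field he.Corner := hfield.toField
  have hpow : ∀ (z : he.Corner) (n : ℕ), 1 ≤ n → (z ^ n).1 = z.1 ^ n := fun z n hn => by
    induction n, hn using Nat.le_induction with
    | base => rw [pow_one, pow_one]
    | succ n _ ih => rw [pow_succ, pow_succ, ← ih]; rfl
  have hF : IsCompletePowMulNorm fun z : he.Corner => f z.1 :=
    { nonneg := fun z => hf.nonneg _
      apply_zero := hf.apply_zero
      eq_zero := fun z hz => Subtype.ext (hf.eq_zero _ hz)
      apply_neg := fun z => hf.apply_neg _
      add_le := fun z z' => hf.add_le _ _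
      mul_le := fun z z' => hf.mul_le _ _
      apply_pow := fun z n hn => by rw [hpow z n hn, hf.apply_pow _ _ hn]
      complete := fun u hu => by
        obtain ⟨z, hz⟩ := hf.complete (fun n => (u n).1) hu
        refine ⟨mk z, fun ε hε => ?_⟩
        obtain ⟨N, hN⟩ := hz ε hε
        refine ⟨N, fun n hn => ?_⟩
        show f ((u n).1 - e * z) < ε
        rw [← hmem (u n), ← mul_sub]
        refine (hf.mul_le _ _).trans_lt ?_
        rw [hf.apply_idempotent he he0, one_mul]
        exact hN n hn }
  have hcast : ∀ n : ℕ, ((n : he.Corner)).1 = n * e := fun n => by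
    induction n with
    | zero => rw [Nat.cast_zero, Nat.cast_zero, zero_mul]; rfl
    | succ n ih =>
      rw [Nat.cast_succ, Nat.cast_succ, add_mul, one_mul, ← ih]; rfl
  have : CharP he.Corner p := by
    refine (CharP.charP_iff_prime_eq_zero hp.out).2 (Subtype.ext ?_)
    rw [hcast, hp0, zero_mul]; rfl
  have hperf' : ∀ z : he.Corner, ∃ y, y ^ p = z := fun z => by
    obtain ⟨y, hy⟩ := hperf z.1
    refine ⟨mk y, Subtype.ext ?_⟩
    rw [hpow _ _ hp.out.one_le]
    show (e * y) ^ p = z.1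
    rw [mul_pow, he.pow_eq hp.out.ne_zero, hy, hmem]
  have hfπ : f (e * π) = c := by
    rw [mul_comm, hπ, hf.apply_idempotent he he0, mul_one]
  have hπ' : IsScalingUnit (fun z : he.Corner => f z.1) (mk π) := by
    refine ⟨fun h => hc.ne' ?_, fun z => ?_⟩
    · rw [← hfπ, ← hf.apply_zero]; exact congrArg f (congrArg Subtype.val h)
    · show f (e * π * z.1) = f (e * π) * f z.1
      rw [mul_comm e, mul_assoc, hmem, hπ, mul_comm π, hfπ]
  let x' : he.Corner := ⟨x, (Subsemigroup.mem_corner_iff he).2 ⟨hex, by rw [mul_comm, hex]⟩⟩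
  have hx' : x' ≠ 0 := fun h => hx (congrArg Subtype.val h)
  have hinv : x' * x'⁻¹ = 1 := mul_inv_cancel₀ hx'
  exact ⟨(x'⁻¹).1, congrArg Subtype.val hinv,
    hF.apply_mul_apply_inv hperf' hπ' (by show f (e * π) < 1; rwa [hfπ]) hx'⟩

end IsCompletePowMulNorm

/-- Quasi-inverses glue along orthogonal idempotents. -/
lemma exists_sq_mul_eq_of_sub {A : Type*} [CommRing A] {e g : A} (he : IsIdempotentElem e)
    (hg : IsIdempotentElem g) (hge : e * g = g)
    (h1 : ∀ r, ∃ y, (g * r) ^ 2 * y = g * r) (h2 : ∀ r, ∃ y, ((e - g) * r) ^ 2 * y = (e - g) * r)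
    (r : A) : ∃ y, (e * r) ^ 2 * y = e * r := by
  obtain ⟨y, hy⟩ := h1 r
  obtain ⟨z, hz⟩ := h2 r
  have h3 : (e - g) * (e - g) = e - g := by linear_combination he.eq - 2 * hge + hg.eq
  have h4 : g * (e - g) = 0 := by linear_combination hge - hg.eq
  refine ⟨g * y + (e - g) * z, ?_⟩
  have h5 : e * r = g * r + (e - g) * r := by ring
  rw [h5]
  linear_combination g * hy + (e - g) * hz + r * hg.eq + r * h3 +
    (2 * g * r ^ 2 * y + 2 * (e - g) * r ^ 2 * z + (e - g) * r ^ 2 * y + g * r ^ 2 * z) * h4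

/-- In the absence of infinite orthogonal families of nonzero idempotents, quasi-inverses need
only exist on the factors of primitive idempotents. -/
lemma isVonNeumannRegular_of_primitive {A : Type*} [CommRing A]
    (hfin : ∀ e : ℕ → A, (∀ i, IsIdempotentElem (e i)) → (∀ i j, i ≠ j → e i * e j = 0) →
      ∃ i, e i = 0)
    (hprim : ∀ e : A, IsIdempotentElem e → e ≠ 0 →
      (∀ g, IsIdempotentElem g → e * g = g → g = 0 ∨ g = e) →
      ∀ r, ∃ y, (e * r) ^ 2 * y = e * r) : IsVonNeumannRegular A := by
  by_contra hA
  -- These are the idempotents on whose factor quasi-inverses fail to exist. One of them is never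
  -- primitive, and if it splits, one of its two parts is again of this kind by
  -- `exists_sq_mul_eq_of_sub`.
  let B : Type _ := {e : A // IsIdempotentElem e ∧ ¬∀ r, ∃ y, (e * r) ^ 2 * y = e * r}
  have step : ∀ e : B, ∃ e' : B, e.1 * e'.1 = e'.1 ∧ e'.1 ≠ e.1 := by
    rintro ⟨e, he, hbad⟩
    have he0 : e ≠ 0 := by rintro rfl; exact hbad fun r => ⟨0, by ring⟩
    have := mt (hprim e he he0) hbad
    push Not at this
    obtain ⟨g, hg, hge, hg0, hg1⟩ := this
    by_cases h1 : ∀ r, ∃ y, (g * r) ^ 2 * y = g * r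
    · refine ⟨⟨e - g, ?_, fun h2 => hbad (exists_sq_mul_eq_of_sub he hg hge h1 h2)⟩, ?_, ?_⟩
      · show (e - g) * (e - g) = e - g
        linear_combination he.eq - 2 * hge + hg.eq
      · show e * (e - g) = e - g
        linear_combination he.eq - hge
      · simpa using hg0
    · exact ⟨⟨g, hg, h1⟩, hge, hg1⟩
  choose φ hφ1 hφ2 using step
  let e₀ : B := ⟨1, IsIdempotentElem.one, fun h => hA fun x => by simpa using h x⟩
  -- A strictly decreasing chain of idempotents starting at `1`; its consecutive differences are
  -- nonzero and orthogonal.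
  let E : ℕ → A := fun n => (φ^[n] e₀).1
  have hid : ∀ n, E n * E n = E n := fun n => (φ^[n] e₀).2.1
  have hsucc : ∀ n, E n * E (n + 1) = E (n + 1) := fun n => by
    simp only [E, Function.iterate_succ_apply']; exact hφ1 _
  have hle : ∀ n m, n ≤ m → E n * E m = E m := fun n m hnm => by
    induction m, hnm using Nat.le_induction with
    | base => exact hid n
    | succ m _ ih => rw [← hsucc m, ← mul_assoc, ih]
  have hlt : ∀ i j, i < j → (E i - E (i + 1)) * (E j - E (j + 1)) = 0 := fun i j hij => by
    linear_combination hle i j hij.le - hle i (j + 1) (by omega) - hle (i + 1) j hij +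
      hle (i + 1) (j + 1) (by omega)
  obtain ⟨i, hi⟩ := hfin (fun n => E n - E (n + 1))
    (fun n => by
      show (E n - E (n + 1)) * (E n - E (n + 1)) = E n - E (n + 1)
      linear_combination hid n - 2 * hsucc n + hid (n + 1))
    (fun i j hij => by
      rcases lt_or_gt_of_ne hij with h | h
      · exact hlt i j h
      · rw [mul_comm]; exact hlt j i h)
  have h := hφ2 (φ^[i] e₀)
  rw [← Function.iterate_succ_apply' φ i e₀] at h
  exact h (sub_eq_zero.1 hi).symm

end VonNeumannRegular

/-! ### Transfer of regularity between a ring and its tilt. -/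

section TiltEquivalence

variable {p : ℕ} [hp : Fact p.Prime] {R : Type*} [NormedCommRing R] [CompleteSpace R] {f : R → ℝ}
  {h : HasSpectralNorm p R}

namespace BanachTilt

/-- On the part where `a = x♯` is invertible, the inverse of its `p ^ n`-th root `x_n` is `x_n ^ (p
^ n - 1) * a⁻¹`. This formula makes sense with a quasi-inverse of `a` in place of `a⁻¹`, and
involves only one choice for all `n`. -/
lemma isVonNeumannRegular (hf : IsSpectralNorm p f) (hR : IsVonNeumannRegular R) :
    IsVonNeumannRegular (BanachTilt h) := by
  intro x
  obtain ⟨y, hy⟩ := hR (x.1 0)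
  set a := x.1 0 with ha
  have hpos : ∀ n, 0 < p ^ n := fun n => pow_pos hp.out.pos n
  have hx0 : ∀ n, x.1 n ^ p ^ n = a := fun n => by
    have := val_pow_pow x 0 n
    rwa [zero_add] at this
  -- Unlike `y`, this quasi-inverse satisfies also `a * z ^ 2 = z`, which is what makes the sequence
  -- `v` compatible with `p`-th powers.
  set z := a * y * y with hz
  have haz : a * z = a * y := by linear_combination y * hy
  have hzz : a * z * z = z := by
    rw [haz]; linear_combination y * y * hy
  have hzp : ∀ k, a ^ k * z ^ (k + 1) = z := fun k => by
    induction k with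
    | zero => simp
    | succ k ih =>
      calc a ^ (k + 1) * z ^ (k + 1 + 1) = a * (a ^ k * z ^ (k + 1)) * z := by ring
        _ = z := by rw [ih, hzz]
  let v : BanachTilt h := ⟨fun n => x.1 n ^ (p ^ n - 1) * z, fun n => by
    rw [mul_pow, ← pow_mul, mul_comm _ p, pow_mul, x.2 n]
    have h1 : p ^ (n + 1) - 1 = (p ^ n - 1) + p ^ n * (p - 1) := by
      have h3 : p ^ n ≤ p ^ n * p := Nat.le_mul_of_pos_right _ hp.out.pos
      have h2 := hpos n
      rw [Nat.mul_sub, mul_one, pow_succ]; omega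
    rw [h1, pow_add, pow_mul, hx0, mul_assoc]
    have h2 := hzp (p - 1)
    rw [Nat.sub_add_cancel hp.out.one_le] at h2
    rw [h2]⟩
  refine ⟨v, Subtype.ext (funext fun n => ?_)⟩
  rw [val_mul, val_pow]
  show x.1 n ^ 2 * (x.1 n ^ (p ^ n - 1) * z) = x.1 n
  have h1 : x.1 n ^ (p ^ n - 1) * x.1 n = a := by
    rw [← pow_succ, Nat.sub_add_cancel (hpos n), hx0]
  have h2 : x.1 n ^ 2 * (x.1 n ^ (p ^ n - 1) * z) - x.1 n = -(x.1 n * (1 - a * y)) := by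
    linear_combination x.1 n * z * h1 + x.1 n * haz
  refine sub_eq_zero.1 (hf.eq_zero ?_)
  rw [h2, hf.map_neg]
  -- The defect `x_n * (1 - a * y)` vanishes because its `p ^ n`-th power is `a * (1 - a * y) = 0`
  -- and the norm is power-multiplicative.
  refine pow_eq_zero_iff (hpos n).ne' |>.1 ?_
  rw [← hf.map_pow _ _ (hpos n), mul_pow, hx0]
  have h3 : IsIdempotentElem (1 - a * y) := by
    show (1 - a * y) * (1 - a * y) = 1 - a * y
    linear_combination y * hy
  rw [h3.pow_eq (hpos n).ne', mul_sub, mul_one, ← mul_assoc, ← sq, hy, sub_self, hf.map_zero]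

/-- An element of the tilt which scales the norm. -/
lemma exists_scaling (hf : IsSpectralNorm p f) {c c' : ℝ} (hc : 0 ≤ c) (hc1 : c < 1)
    (hfrob : ∀ r, f r ≤ 1 → ∃ r', f r' ≤ 1 ∧ f (r' ^ p - r) ≤ c) {w : Rˣ} (hcc' : c < c')
    (hc' : c' < 1) (hw : ∀ x, f (w * x) = c' * f x) :
    ∃ π : BanachTilt h, ∀ x : BanachTilt h, f ((π * x).1 0) = c' * f (x.1 0) := by
  have hc0 : 0 < c' := hc.trans_lt hcc'
  have hw1 : f (w : R) ≤ 1 := by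
    rw [← mul_one (w : R), hw]
    exact mul_le_one₀ hc'.le (hf.nonneg _) hf.map_one_le
  obtain ⟨g, hg⟩ := exists_sharp_sub_le (h := h) hf hc hc1 hfrob w hw1
  refine ⟨g, fun x => ?_⟩
  rw [val_mul]
  have h1 : f ((g.1 0 - w) * x.1 0) ≤ c * f (x.1 0) :=
    (hf.mul_le _ _).trans (mul_le_mul_of_nonneg_right hg (hf.nonneg _))
  rcases (hf.nonneg (x.1 0)).eq_or_lt with h0 | h0
  · rw [← h0, mul_zero, hf.eq_zero h0.symm, mul_zero, hf.map_zero]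
  -- The approximation error `c` is strictly below the scale `c'` of `w`, so replacing `w` by `g♯`
  -- changes no size.
  have h2 : f ((g.1 0 - w) * x.1 0) < f (w * x.1 0) := by
    rw [hw]; exact h1.trans_lt (mul_lt_mul_of_pos_right hcc' h0)
  rw [← hw]
  have h3 : g.1 0 * x.1 0 = (g.1 0 - w) * x.1 0 + w * x.1 0 := by ring
  refine le_antisymm ?_ ?_
  · rw [h3]; exact (hf.add_le _ _).trans (max_le h2.le le_rfl)
  · have h4 : (w : R) * x.1 0 = g.1 0 * x.1 0 - (g.1 0 - w) * x.1 0 := by ring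
    have h5 := hf.sub_le (g.1 0 * x.1 0) ((g.1 0 - w) * x.1 0)
    rw [← h4] at h5
    exact (le_max_iff.1 h5).resolve_right h2.not_ge

end BanachTilt

namespace IsSpectralNorm

lemma apply_idempotent_le (hf : IsSpectralNorm p f) {e : R} (he : IsIdempotentElem e) :
    f e ≤ 1 := by
  have h1 := hf.map_pow e 2 one_le_two
  rw [he.pow_eq two_ne_zero] at h1
  nlinarith [sq_nonneg (f e - 1)]

lemma apply_zpow_mul {w : Rˣ} {c : ℝ} (hc : 0 < c) (hw : ∀ x, f (w * x) = c * f x) (n : ℤ)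
    (x : R) : f (((w ^ n : Rˣ) : R) * x) = c ^ n * f x := by
  induction n generalizing x with
  | zero => simp
  | succ n ih =>
    rw [zpow_add_one, zpow_add_one₀ hc.ne', Units.val_mul, mul_assoc, ih, hw, mul_assoc]
  | pred n ih =>
    rw [zpow_sub_one, zpow_sub_one₀ hc.ne', Units.val_mul, mul_assoc, ih, mul_assoc]
    congr 1
    rw [eq_inv_mul_iff_mul_eq₀ hc.ne', ← hw, ← mul_assoc, Units.mul_inv, one_mul]

/-- Untilting of von Neumann regularity. -/
theorem isVonNeumannRegular_of_tilt (hf : IsSpectralNorm p f) {c c' : ℝ} (hc : 0 ≤ c)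
    (hfrob : ∀ r, f r ≤ 1 → ∃ r', f r' ≤ 1 ∧ f (r' ^ p - r) ≤ c) {w : Rˣ} (hcc' : c < c')
    (hc' : c' < 1) (hw : ∀ x, f (w * x) = c' * f x) (hT : IsVonNeumannRegular (BanachTilt h)) :
    IsVonNeumannRegular R := by
  have hc0 : 0 < c' := hc.trans_lt hcc'
  have hc1 : c < 1 := hcc'.trans hc'
  obtain ⟨π, hπ⟩ := BanachTilt.exists_scaling (h := h) hf hc hc1 hfrob hcc' hc' hw
  have hF := BanachTilt.isCompletePowMulNorm (h := h) hf
  refine isVonNeumannRegular_of_primitive (fun e he ho => ?_) fun e he he0 hprim r => ?_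
  · obtain ⟨i, hi⟩ := hF.exists_idempotent_eq_zero hT hc0 hc' hπ
      (e := fun i => BanachTilt.ofIdempotent h (he i))
      (fun i => BanachTilt.isIdempotentElem_ofIdempotent (he i))
      (fun i j hij => Subtype.ext (funext fun _ => ho i j hij))
    exact ⟨i, congrFun (congrArg Subtype.val hi) 0⟩
  by_cases hr : e * r = 0
  · exact ⟨0, by rw [hr]; ring⟩
  have hpos : 0 < f (e * r) := lt_of_le_of_ne (hf.nonneg _) fun h0 => hr (hf.eq_zero h0.symm)
  -- Powers of `w` scale in steps of `c'`, so the element can be moved into the range `(c', 1]`,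
  -- above the approximation error `c`.
  obtain ⟨n, hn1, hn2⟩ := exists_mem_Ioc_zpow hpos ((one_lt_inv₀ hc0).2 hc')
  set W : Rˣ := w ^ (n + 1) with hW
  set s := (W : R) * (e * r) with hs
  have hfs : f s = c' ^ (n + 1) * f (e * r) := apply_zpow_mul hc0 hw _ _
  have hs1 : f s ≤ 1 := by
    rw [hfs, ← le_inv_mul_iff₀ (zpow_pos hc0 _), mul_one, ← inv_zpow]; exact hn2
  have hs2 : c < f s := by
    refine hcc'.trans ?_
    rw [hfs, zpow_add_one₀ hc0.ne', mul_right_comm]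
    rw [inv_zpow, inv_lt_iff_one_lt_mul₀' (zpow_pos hc0 _)] at hn1
    exact lt_mul_of_one_lt_left hc0 hn1
  have hes : e * s = s := by rw [hs]; linear_combination (W : R) * r * he.eq
  obtain ⟨g, hg⟩ := BanachTilt.exists_sharp_sub_le (h := h) hf hc hc1 hfrob s hs1
  let E : BanachTilt h := BanachTilt.ofIdempotent h he
  have hE : IsIdempotentElem E := BanachTilt.isIdempotentElem_ofIdempotent he
  have hEg : (E * g).1 0 = e * g.1 0 := rfl
  have hd : f (s - e * g.1 0) ≤ c := by
    have h1 : s - e * g.1 0 = e * (s - g.1 0) := by linear_combination -hes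
    rw [h1]
    refine (hf.mul_le _ _).trans ?_
    rw [hf.sub_comm]
    exact (mul_le_of_le_one_left (hf.nonneg _) (hf.apply_idempotent_le he)).trans hg
  have hg0 : c < f ((E * g).1 0) := by
    have h1 := hf.add_le (s - e * g.1 0) (e * g.1 0)
    rw [sub_add_cancel] at h1
    rw [hEg]
    rcases le_max_iff.1 h1 with h2 | h2
    · exact absurd (h2.trans hd) hs2.not_ge
    · exact hs2.trans_le h2
  obtain ⟨y, hy1, hy2⟩ := hF.exists_mul_eq_idempotent hT (BanachTilt.natCast_p_eq_zero hf)
    BanachTilt.exists_pow_eq hc0 hc' hπ hE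
    (fun h0 => he0 (congrFun (congrArg Subtype.val h0) 0))
    (fun q hq hEq => by
      have hval := BanachTilt.val_eq_of_isIdempotentElem hq
      rcases hprim (q.1 0) (BanachTilt.isIdempotentElem_val hq 0)
        (congrFun (congrArg Subtype.val hEq) 0) with h1 | h1
      · exact Or.inl (Subtype.ext (funext fun m => (hval m).trans h1))
      · exact Or.inr (Subtype.ext (funext fun m => (hval m).trans h1)))
    (x := E * g) (by rw [← mul_assoc, hE.eq])
    (fun h0 => by
      rw [h0] at hg0
      exact absurd (hg0.trans_eq hf.map_zero) hc.not_gt)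
  have hy0 : e * g.1 0 * y.1 0 = e := congrFun (congrArg Subtype.val hy1) 0
  -- Multiplicativity is used here: `f (y♯)` is exactly the inverse of the size of `e * g♯`, which
  -- exceeds the error `c`.
  have hδ : f ((s - e * g.1 0) * y.1 0) < 1 := by
    have hfy : 0 < f (y.1 0) := by
      refine lt_of_le_of_ne (hf.nonneg _) fun h0 => ?_
      rw [← h0, mul_zero] at hy2
      exact zero_ne_one hy2
    refine (hf.mul_le _ _).trans_lt ?_
    rw [← hy2]
    exact mul_lt_mul_of_pos_right (hd.trans_lt hg0) hfy
  obtain ⟨u, hu⟩ := hf.isUnit_one_add hδ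
  -- On the factor of `e`, the element `s` times the inverse of its approximant is `1 + δ`.
  have h1 : s * y.1 0 = e * u := by
    rw [hu]; linear_combination -y.1 0 * hes + y.1 0 * g.1 0 * he.eq + hy0
  have h2 : s * y.1 0 * ((u⁻¹ : Rˣ) : R) = e := by
    rw [h1, mul_assoc, Units.mul_inv, mul_one]
  refine ⟨W * y.1 0 * ((u⁻¹ : Rˣ) : R), ?_⟩
  rw [hs] at h2
  linear_combination (e * r) * h2 + r * he.eq

theorem isVonNeumannRegular_iff_tilt (hf : IsSpectralNorm p f) {c c' : ℝ} (hc : 0 ≤ c)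
    (hfrob : ∀ r, f r ≤ 1 → ∃ r', f r' ≤ 1 ∧ f (r' ^ p - r) ≤ c) {w : Rˣ} (hcc' : c < c')
    (hc' : c' < 1) (hw : ∀ x, f (w * x) = c' * f x) :
    IsVonNeumannRegular R ↔ IsVonNeumannRegular (BanachTilt h) :=
  ⟨BanachTilt.isVonNeumannRegular hf, hf.isVonNeumannRegular_of_tilt hc hfrob hcc' hc' hw⟩

/-- Being a field is regularity together with the absence of nontrivial idempotents, and both pass
between the ring and its tilt. -/
theorem isField_iff_tilt (hf : IsSpectralNorm p f) {c c' : ℝ} (hc : 0 ≤ c)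
    (hfrob : ∀ r, f r ≤ 1 → ∃ r', f r' ≤ 1 ∧ f (r' ^ p - r) ≤ c) {w : Rˣ} (hcc' : c < c')
    (hc' : c' < 1) (hw : ∀ x, f (w * x) = c' * f x) :
    IsField R ↔ IsField (BanachTilt h) := by
  rw [isField_iff_isVonNeumannRegular, isField_iff_isVonNeumannRegular,
    hf.isVonNeumannRegular_iff_tilt (h := h) hc hfrob hcc' hc' hw]
  have h01 : (0 : R) ≠ 1 ↔ (0 : BanachTilt h) ≠ 1 :=
    not_congr ⟨fun h0 => Subtype.ext (funext fun _ => h0),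
      fun h0 => congrFun (congrArg Subtype.val h0) 0⟩
  have hid : (∀ e : R, IsIdempotentElem e → e = 0 ∨ e = 1) ↔
      ∀ e : BanachTilt h, IsIdempotentElem e → e = 0 ∨ e = 1 := by
    constructor
    · intro H e he
      have hval := BanachTilt.val_eq_of_isIdempotentElem he
      exact (H _ (BanachTilt.isIdempotentElem_val he 0)).imp
        (fun h0 => Subtype.ext (funext fun m => (hval m).trans h0))
        (fun h0 => Subtype.ext (funext fun m => (hval m).trans h0))
    · intro H e he
      exact (H _ (BanachTilt.isIdempotentElem_ofIdempotent (h := h) he)).imp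
        (fun h0 => congrFun (congrArg Subtype.val h0) 0)
        (fun h0 => congrFun (congrArg Subtype.val h0) 0)
  rw [h01, hid]

end IsSpectralNorm

end TiltEquivalence

/-! ### From perfectoid algebras over the two bases to spectral norms. -/

section Instances

/-- A multiplicative constant disappears on taking `n`-th roots. This turns bounds for an equivalent
norm into sharp bounds for a power-multiplicative one. -/
lemma le_of_pow_le_mul_pow {a b M : ℝ} (ha : 0 ≤ a) (hb : 0 ≤ b)
    (h : ∀ n : ℕ, 1 ≤ n → a ^ n ≤ M * b ^ n) : a ≤ b := by
  by_contra! hlt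
  have ha0 : 0 < a := hb.trans_lt hlt
  have h1 : ∀ n : ℕ, 1 ≤ n → 1 ≤ M * (b / a) ^ n := fun n hn => by
    rw [div_pow, ← mul_div_assoc, le_div_iff₀ (pow_pos ha0 n), one_mul]
    exact h n hn
  have h2 := (tendsto_pow_atTop_nhds_zero_of_lt_one (div_nonneg hb ha)
    ((div_lt_one ha0).2 hlt)).const_mul M
  rw [mul_zero] at h2
  have := ge_of_tendsto h2 (eventually_atTop.2 ⟨1, h1⟩)
  linarith

lemma IsSpectralNorm.mem_powerBounded {p : ℕ} [Fact p.Prime] {R : Type*} [NormedCommRing R]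
    [IsUltrametricDist R] {f : R → ℝ} (hf : IsSpectralNorm p f) {x : R} : x ∈ powerBounded R ↔ f x ≤ 1 := by
  constructor
  · intro hx
    obtain ⟨C, hC⟩ := isBounded_iff_forall_norm_le.1 hx
    refine le_of_pow_le_mul_pow (M := C) (hf.nonneg _) zero_le_one fun n hn => ?_
    rw [one_pow, mul_one, ← hf.map_pow _ _ hn]
    exact (hf.le_norm _).trans (hC _ ⟨n, rfl⟩)
  · intro hx
    obtain ⟨M, hM⟩ := hf.norm_le
    refine isBounded_iff_forall_norm_le.2 ⟨|M|, ?_⟩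
    rintro _ ⟨n, rfl⟩
    refine (hM _).trans ((mul_le_mul_of_nonneg_right (le_abs_self M) (hf.nonneg _)).trans ?_)
    exact mul_le_of_le_one_right (abs_nonneg M)
      ((hf.pow_le x n).trans (pow_le_one₀ (hf.nonneg _) hx))

namespace NormFamily

variable {p : ℕ} [Fact p.Prime] {A : Type*} [CommRing A] {B : SeminormedBase p A} {R : Type*}
  [NormedCommRing R] [IsUltrametricDist R] [Algebra A R] {f : R → ℝ}

/-- The scaling is known for the norm of `R`, to which `f` is only equivalent. Applied to all powers
of `a • x`, it becomes exact for `f`. -/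
lemma apply_smul_eq (N : NormFamily B R) (hf : IsSpectralNorm p f) {a : A} {c : ℝ} (hc : 0 ≤ c)
    (ha : ∀ s, B.v s a = c) (x : R) : f (a • x) = c * f x := by
  obtain ⟨M, hM⟩ := hf.norm_le
  have hpow : ∀ n : ℕ, ‖(a • x) ^ n‖ = c ^ n * ‖x ^ n‖ := fun n => by
    rw [smul_pow]
    exact N.norm_smul_eq (pow_nonneg hc n) (fun s => by rw [map_pow, ha]) _
  refine le_antisymm ?_ ?_
  · refine le_of_pow_le_mul_pow (M := M) (hf.nonneg _) (mul_nonneg hc (hf.nonneg _)) fun n hn => ?_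
    calc f (a • x) ^ n ≤ ‖(a • x) ^ n‖ := by rw [← hf.map_pow _ _ hn]; exact hf.le_norm _
      _ ≤ c ^ n * (M * f (x ^ n)) := by
          rw [hpow]; exact mul_le_mul_of_nonneg_left (hM _) (pow_nonneg hc n)
      _ = M * (c * f x) ^ n := by rw [hf.map_pow _ _ hn]; ring
  · refine le_of_pow_le_mul_pow (M := M) (mul_nonneg hc (hf.nonneg _)) (hf.nonneg _) fun n hn => ?_
    calc (c * f x) ^ n ≤ c ^ n * ‖x ^ n‖ := by
          rw [mul_pow, ← hf.map_pow _ _ hn]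
          exact mul_le_mul_of_nonneg_left (hf.le_norm _) (pow_nonneg hc n)
      _ ≤ M * f (a • x) ^ n := by rw [← hpow, ← hf.map_pow _ _ hn]; exact hM _

lemma apply_pseudoIdeal_le (N : NormFamily B R) (hf : IsSpectralNorm p f) {c : ℝ} (hc : 0 ≤ c)
    (hgens : ∀ a ∈ B.gens, ∃ d, 0 ≤ d ∧ d ≤ c ∧ ∀ s, B.v s a = d) {z : powerBounded R}
    (hz : z ∈ N.pseudoIdeal) : f z ≤ c := by
  induction hz using Submodule.span_induction with
  | mem z hz =>
    obtain ⟨a, ha, hza⟩ := hz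
    obtain ⟨d, hd, hdc, hv⟩ := hgens a ha
    rw [hza, ← mul_one (algebraMap A R a), ← Algebra.smul_def, N.apply_smul_eq hf hd hv]
    exact (mul_le_of_le_one_right hd hf.map_one_le).trans hdc
  | zero => exact hf.map_zero.trans_le hc
  | add x y _ _ hx hy => exact (hf.add_le _ _).trans (max_le hx hy)
  | smul a x _ hx =>
    refine (hf.mul_le _ _).trans ((mul_le_of_le_one_left (hf.nonneg _) ?_).trans hx)
    exact hf.mem_powerBounded.1 a.2

lemma IsPerfectoid.exists_pow_sub_le {N : NormFamily B R} (hR : N.IsPerfectoid)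
    (hf : IsSpectralNorm p f) {c : ℝ} (hc : 0 ≤ c)
    (hgens : ∀ a ∈ B.gens, ∃ d, 0 ≤ d ∧ d ≤ c ∧ ∀ s, B.v s a = d) (r : R) (hr : f r ≤ 1) :
    ∃ r', f r' ≤ 1 ∧ f (r' ^ p - r) ≤ c := by
  obtain ⟨q, hq⟩ := hR.frobenius_surjective
    (Ideal.Quotient.mk _ ⟨r, hf.mem_powerBounded.2 hr⟩)
  obtain ⟨z, rfl⟩ := Ideal.Quotient.mk_surjective q
  simp only at hq
  rw [← map_pow, Ideal.Quotient.eq] at hq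
  exact ⟨z, hf.mem_powerBounded.1 z.2, N.apply_pseudoIdeal_le hf hc hgens hq⟩

/-- Von Neumann regularity and being a field pass between a perfectoid algebra and its tilt. -/
theorem IsPerfectoid.tilt_equivalence [CompleteSpace R] {N : NormFamily B R}
    (hR : N.IsPerfectoid) {c c' : ℝ} (hc : 0 ≤ c) (hcc' : c < c') (hc' : c' < 1)
    (hgens : ∀ a ∈ B.gens, ∃ d, 0 ≤ d ∧ d ≤ c ∧ ∀ s, B.v s a = d)
    (hunit : ∃ w : A, IsUnit w ∧ ∀ s, B.v s w = c') :
    (IsVonNeumannRegular R ↔ IsVonNeumannRegular hR.tilt) ∧ (IsField R ↔ IsField hR.tilt) := by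
  obtain ⟨f, hf⟩ := N.hasSpectralNorm hR.isBounded
  obtain ⟨w, hw, hv⟩ := hunit
  have hw' : ∀ x, f ((hw.unit.map (algebraMap A R : A →* R) : Rˣ) * x) = c' * f x := fun x => by
    have := N.apply_smul_eq hf (hc.trans hcc'.le) hv x
    rwa [Algebra.smul_def] at this
  have hfrob := hR.exists_pow_sub_le hf hc hgens
  exact ⟨hf.isVonNeumannRegular_iff_tilt hc hfrob hcc' hc' hw',
    hf.isField_iff_tilt hc hfrob hcc' hc' hw'⟩

end NormFamily

section Equal

universe u v

variable {K₀ : Type u} [NontriviallyNormedField K₀] [IsUltrametricDist K₀] [CompleteSpace K₀]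
  {Δ : Type v} [Fintype Δ] [Nonempty Δ]
  {K : Δ → IntermediateField K₀ (CompletedAlgClosure K₀)}
  {p : ℕ} [hp : Fact p.Prime] (hK₀ : IsPadicField p K₀)

lemma IntegralTilt.exists_pow_eq {ϖ : ∀ α, K α} {hϖ : IsPseudoUniformizing p K ϖ}
    (x : IntegralTilt hK₀ hϖ) : ∃ y, y ^ p = x := by
  have := charP_integral_quotient hK₀ hϖ
  exact ⟨Perfection.pthRoot (integralKDelta K ⧸ integralIdeal ϖ) p x,
    RingHom.congr_fun (Perfection.frobenius_pthRoot
      (R := integralKDelta K ⧸ integralIdeal ϖ) (p := p)) x⟩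

lemma RootSystem.isUnit_flat (r : RootSystem p K) (α : Δ) :
    IsUnit (algebraMap _ (KDeltaFlat hK₀ r) (r.flat hK₀ α)) :=
  IsLocalization.map_units (KDeltaFlat hK₀ r)
    (⟨_, Submonoid.subset_closure ⟨α, rfl⟩⟩ : Submonoid.closure (Set.range (r.flat hK₀)))

lemma equalBase_v_flat (r : RootSystem p K) (α : Δ) (s : (equalBase hK₀ r).Idx) :
    (equalBase hK₀ r).v s (algebraMap _ _ (r.flat hK₀ α)) = ‖r.root α 0‖ := by
  change flatNorm hK₀ (betaFlatLoc hK₀ r s.rep _) = _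
  rw [betaFlatLoc, IsLocalization.lift_eq]
  change ‖(betaFlat hK₀ r.pseudoUniformizing s.rep (r.flat hK₀ α)).1 0‖ = _
  rw [r.betaFlat_flat hK₀, norm_embedding]

/-- A unit of `K_Δ♭` which is a `p`-th root of `ϖ_α♭`. -/
lemma exists_isUnit_equalBase_v (r : RootSystem p K) (α : Δ) :
    ∃ w, IsUnit w ∧ ∀ s, (equalBase hK₀ r).v s w = ‖r.root α 1‖ := by
  obtain ⟨y, hy⟩ := IntegralTilt.exists_pow_eq hK₀ (r.flat hK₀ α)
  have hpow : algebraMap _ (KDeltaFlat hK₀ r) y ^ p =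
      algebraMap _ (KDeltaFlat hK₀ r) (r.flat hK₀ α) := by rw [← map_pow, hy]
  refine ⟨algebraMap _ (KDeltaFlat hK₀ r) y, ?_, fun s => ?_⟩
  · exact (isUnit_pow_iff hp.out.ne_zero).1 (hpow ▸ r.isUnit_flat hK₀ α)
  · refine (pow_left_inj₀ (apply_nonneg _ _) (norm_nonneg _) hp.out.ne_zero).1 ?_
    rw [← map_pow, hpow, equalBase_v_flat, ← norm_pow, r.root_pow]

end Equal

end Instances

theorem mainTheorem9 {p : ℕ} [Fact p.Prime] {K₀ : Type*} [NontriviallyNormedField K₀]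
    [IsUltrametricDist K₀] [CompleteSpace K₀] (hK₀ : IsPadicField p K₀)
    {Δ : Type*} [Fintype Δ] [Nonempty Δ]
    (K : Δ → IntermediateField K₀ (CompletedAlgClosure K₀))
    (hK : ∀ α, IsPerfectoidField p (K α)) :
    (∀ ϖ : ∀ α, K α, IsPseudoUniformizing p K ϖ →
      ∀ (R : Type*) [NormedCommRing R] [IsUltrametricDist R] [CompleteSpace R]
        [Algebra (KDelta K) R] (N : NormFamily (mixedBase hK₀ K ϖ) R) (hR : N.IsPerfectoid),
        (IsVonNeumannRegular R ↔ IsVonNeumannRegular hR.tilt) ∧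
          (IsField R ↔ IsField hR.tilt)) ∧
    (∀ (r : RootSystem p K) (R : Type*) [NormedCommRing R] [IsUltrametricDist R]
        [CompleteSpace R] [Algebra (KDeltaFlat hK₀ r) R]
        (N : NormFamily (equalBase hK₀ r) R) (hR : N.IsPerfectoid),
        (IsVonNeumannRegular R ↔ IsVonNeumannRegular hR.tilt) ∧
          (IsField R ↔ IsField hR.tilt)) := by
  constructor
  · intro ϖ hϖ R _ _ _ _ N hR
    -- The Frobenius error `c` is the largest `‖ϖ α‖`. Non-discreteness of `K α` then gives an
    -- element of size strictly between `c` and `1` to scale with.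
    obtain ⟨α, hα⟩ := Finite.exists_max fun α => ‖ϖ α‖
    obtain ⟨x, hx1, hx2⟩ := (hK α).nondiscrete ‖ϖ α‖ (hϖ α).2
    have hx0 : x ≠ 0 := norm_pos_iff.1 ((norm_nonneg _).trans_lt hx1)
    have hv : ∀ (β : Δ) (y : K β) s, (mixedBase hK₀ K ϖ).v s (iota K β y) = ‖y‖ := fun β y s => by
      change ‖beta s.rep _‖ = _
      rw [beta_iota, norm_embedding]
    refine hR.tilt_equivalence (norm_nonneg (ϖ α)) hx1 hx2 ?_
      ⟨iota K α x, (isUnit_iff_ne_zero.2 hx0).map (iota K α), hv α x⟩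
    rintro _ ⟨β, rfl⟩
    exact ⟨_, norm_nonneg _, hα β, hv β (ϖ β)⟩
  · intro r R _ _ _ _ N hR
    obtain ⟨α, hα⟩ := Finite.exists_max fun α => ‖r.root α 0‖
    -- Over the second base, a `p`-th root of the largest `ϖ_α♭` has the required intermediate size.
    have hlt : ‖r.root α 0‖ < ‖r.root α 1‖ := by
      rw [← r.root_pow, norm_pow]
      exact pow_lt_self_of_lt_one₀ (norm_pos_iff.2 (RootSystem.norm_pos hK₀ r α 1))
        (r.norm_lt α 1) (Fact.out : p.Prime).one_lt
    refine hR.tilt_equivalence (norm_nonneg _) hlt (r.norm_lt α 1) ?_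
      (exists_isUnit_equalBase_v hK₀ r α)
    rintro _ ⟨β, rfl⟩
    exact ⟨_, norm_nonneg _, hα β, equalBase_v_flat hK₀ r β⟩
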